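/- **Conventions.** Let $n\ge 1$. For $m\ge1$ let $I_m=\{1,\dots,m\}$ be the index set of the Dynkin diagram of type $A_m$, with simple reflections $s_i$, longest element ${}_mw_0$, and involution $i\mapsto i^\vee=i^*=m+1-i$. Two words in $I_m$ are commutation equivalent if one is obtained from the other by commutation relations $s_is_j=s_js_i$ $(|i-j|\ge 2)$; $[\mathbf w]$ is the class of $\mathbf w$. An index $i$ is a *sink* (resp. *source*) of a class if some word of the class starts (resp. ends) with $i$. If $i$ is a sink of $[\mathbf i]=[i\,i_2\cdots i_N]$, the reflection functor gives $[\mathbf i]\,r_i=[i_2\cdots i_N\,i^*]$; if $i$ is a source of $[\mathbf i]=[i_1\cdots i_{N-1}\,i]$, it gives $r_i[\mathbf i]=[i^*\,i_1\cdots i_{N-1}]$; otherwise it fixes the class. The *$r$-cluster point* $[\![\mathbf i]\!]$ of $[\mathbf i]$ is the set of classes obtained from $[\mathbf i]$ by sequences of reflection functors. A Dynkin quiver $Q$ of type $A_m$ is an orientation of the diagram; a word $i_1\cdots i_l$ is *adapted to* $Q$ if $i_k$ is a sink of $i_{k-1}\cdots i_1Q$ for all $k$, where $iQ$ is $Q$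 with all arrows at $i$ reversed. $[Q]$ is the class of the reduced words of $w_0$ adapted to $Q$, and $[\![Q]\!]$ is the set of all $[Q]$ of type $A_{2n}$ (the adapted cluster point). For a word $\mathbf u$ in $I_{2n+1}$ let $\mathbf u^{k\vee}$ be $\mathbf u$ with $\vee$ applied $k$ times to every letter. The *twisted adapted cluster point* $[\![Q^\diamondsuit]\!]$ of type $A_{2n+1}$ is the $r$-cluster point of $\big[\prod_{k=0}^{2n}(1\,2\cdots n{+}1)^{k\vee}\big]$. A *twisted Coxeter element* of type $A_{2n+1}$ is an element $s_{i_1}\cdots s_{i_{n+1}}\vee$ of the coset $W\vee$, where $i_1,\dots,i_{n+1}$ contains exactly one index from each $\vee$-orbit, in any order. $\mathbf P$ is the monoid homomorphism from words in $I_{2n+1}$ to words in $I_{2n}$ with $i\mapsto i$ for $i\le n$, $n+1\mapsto\mathrm{id}$, $j\mapsto j-1$ for $j\ge n+2$. **Theorem.** All words in the classes of $[\![Q^\diamondsuit]\!]$ are reduced words of $w_0$ of type $A_{2n+1}$, and: 1. $[\mathbf w]\mapsto[\mathbf P(\mathbf w)]$ is a well-defined map $\mathbf P:[\![Q^\diamondsuit]\!]\to[\![Q]\!]$,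 and it is two-to-one and onto. 2. Every class in $[\![Q^\diamondsuit]\!]$ has $n+1$ as a source or as a sink, but not both. 3. For each Dynkin quiver $Q'$ of type $A_{2n}$, the preimage of $[Q']$ under $\mathbf P$ is obtained as follows: (i) take a reduced word of ${}_{2n}w_0$ adapted to $Q'$ (one exists); (ii) replace each letter $i\in\{n+1,\dots,2n\}$ by $i+1$; (iii) between each adjacent $n$ and $n+2$ (an occurrence of $n$ and one of $n+2$, in either order, with neither letter between them) insert one $n+1$, anywhere between them; (iv) insert one more $n+1$ at the beginning or at the end, not both. The words obtained in (iii) exist, are reduced, and form part of a single commutation class, whatever choices are made in (i) and (iii); the two words obtained in (iv) have distinct classes, and these two classes are exactly the preimage of $[Q']$. 4. The number of classes in $[\![Q^\diamondsuit]\!]$ is $2^{2n}$. 5. The number of twisted Coxeter elements of type $A_{2n+1}$ is $4\times3^{n-1}$. 6. If $s_{i_1}\cdots s_{i_{n+1}}\vee$ is a twisted Coxeter element of type $A_{2n+1}$, then $\prod_{k=0}^{2n}(i_1\cdots i_{n+1})^{k\vee}$ is a reduced word of $w_0$ whose class lies in $[\![Q^\diamondsuit]\!]$; this class depends only on the twisted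 Coxeter element and determines it. 7. A class $c\in[\![Q^\diamondsuit]\!]$ comes from a twisted Coxeter element as in 6 if and only if $\mathbf P(c)=[Q']$ for a Dynkin quiver $Q'$ of type $A_{2n}$ with $|a_i-b_i|=1$ for all $i\in I_{2n}$, where $a_i$ (resp. $b_i$) is the number of arrows of $Q'$ between $i$ and $i^\vee$ directed toward $i$ (resp. toward $i^\vee$). -/

import Mathlib

namespace TwistedAdapted

/-! ### Words in the Weyl group of type `A_m`

The index set `{1, …, m}` of the Dynkin diagram of type `A_m` is `Fin m`: the index `i` is
the element of `Fin m` with value `i - 1`. The Weyl group is the symmetric group on `m + 1` letters.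
The diagram automorphism `i ↦ m + 1 - i` is `Fin.rev`; it is also the involution `*` of the index
set that is induced by the longest element (see `longest_mul_simple_mul_longest`). -/

/-- The Weyl group of type `A_m`. -/
abbrev Weyl (m : ℕ) : Type := Equiv.Perm (Fin (m + 1))

/-- The simple reflection `s_i`. -/
def simple {m : ℕ} (i : Fin m) : Weyl m := Equiv.swap i.castSucc i.succ

/-- The longest element `w₀`. -/
def longest (m : ℕ) : Weyl m := Fin.revPerm

/-- The defining property of the involution `*`: `w₀ s_i w₀ = s_{i*}`. -/
theorem longest_mul_simple_mul_longest {m : ℕ} (i : Fin m) :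
    longest m * simple i * (longest m)⁻¹ = simple i.rev := by
  have h := Equiv.swap_apply_apply (longest m) i.castSucc i.succ
  rw [simple, ← h, simple]
  simp only [longest, Fin.revPerm_apply, Fin.rev_castSucc, Fin.rev_succ]
  exact Equiv.swap_comm _ _

/-- The element of the Weyl group that a word represents. -/
def wordProd {m : ℕ} (w : List (Fin m)) : Weyl m := (w.map simple).prod

/-- `w` is a reduced word: no shorter word represents the same element. -/
def IsReducedWord {m : ℕ} (w : List (Fin m)) : Prop :=
  ∀ u : List (Fin m), wordProd u = wordProd w → w.length ≤ u.length

/-- `w` is a reduced word of the longest element. -/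
def IsReducedLongest {m : ℕ} (w : List (Fin m)) : Prop :=
  IsReducedWord w ∧ wordProd w = longest m

/-- Adjacency of vertices in the Dynkin diagram of type `A_m`. -/
def Adjacent {m : ℕ} (i j : Fin m) : Prop := i.val + 1 = j.val ∨ j.val + 1 = i.val

/-- One application of a commutation relation `s_i s_j = s_j s_i`. -/
def CommStep {m : ℕ} (w w' : List (Fin m)) : Prop :=
  ∃ (x y : List (Fin m)) (i j : Fin m), i ≠ j ∧ ¬ Adjacent i j ∧
    w = x ++ i :: j :: y ∧ w' = x ++ j :: i :: y

/-- Commutation equivalence. -/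
def commSetoid (m : ℕ) : Setoid (List (Fin m)) := Relation.EqvGen.setoid CommStep

/-- Commutation classes of words. -/
def CommClass (m : ℕ) : Type := Quotient (commSetoid m)

/-- The commutation class `[w]`. -/
def cls {m : ℕ} (w : List (Fin m)) : CommClass m := Quotient.mk (commSetoid m) w

/-- `i` is a sink of a class: some word of the class starts with `i`. -/
def IsSink {m : ℕ} (c : CommClass m) (i : Fin m) : Prop := ∃ w, c = cls (i :: w)

/-- `i` is a source of a class: some word of the class ends with `i`. -/
def IsSource {m : ℕ} (c : CommClass m) (i : Fin m) : Prop := ∃ w, c = cls (w ++ [i])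

/-! ### Reflection functors and `r`-cluster points -/

/-- The graph of the right action `c ↦ c r_i` of the reflection functor. -/
def RightReflection {m : ℕ} (i : Fin m) (c c' : CommClass m) : Prop :=
  (∃ w, c = cls (i :: w) ∧ c' = cls (w ++ [i.rev])) ∨ (¬ IsSink c i ∧ c' = c)

/-- The graph of the left action `c ↦ r_i c` of the reflection functor. -/
def LeftReflection {m : ℕ} (i : Fin m) (c c' : CommClass m) : Prop :=
  (∃ w, c = cls (w ++ [i]) ∧ c' = cls (i.rev :: w)) ∨ (¬ IsSource c i ∧ c' = c)

/-- Reflection equivalence: `c'` is obtained from `c` by a sequence of reflection functors. -/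
def ReflEquiv {m : ℕ} : CommClass m → CommClass m → Prop :=
  Relation.ReflTransGen fun c c' => ∃ i, RightReflection i c c' ∨ LeftReflection i c c'

/-- The `r`-cluster point of a class. -/
def rCluster {m : ℕ} (c : CommClass m) : Set (CommClass m) := {c' | ReflEquiv c c'}

/-! ### Dynkin quivers and adapted words -/

/-- A Dynkin quiver of type `A_m`: an orientation of every edge of the Dynkin diagram. -/
structure DynkinQuiver (m : ℕ) where
  /-- `arrow i j` means that there is an arrow `i → j`. -/
  arrow : Fin m → Fin m → Prop
  adjacent_iff : ∀ i j, Adjacent i j ↔ arrow i j ∨ arrow j i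
  asymm : ∀ i j, arrow i j → ¬ arrow j i

namespace DynkinQuiver

variable {m : ℕ}

/-- `i` is a sink: no arrow leaves `i`. -/
def Sink (Q : DynkinQuiver m) (i : Fin m) : Prop := ∀ j, ¬ Q.arrow i j

/-- The quiver `i Q`, in which all arrows incident with `i` are reversed. -/
def reflect (Q : DynkinQuiver m) (i : Fin m) : DynkinQuiver m where
  arrow a b := ((a = i ∨ b = i) ∧ Q.arrow b a) ∨ (¬ (a = i ∨ b = i) ∧ Q.arrow a b)
  adjacent_iff a b := by
    have h := Q.adjacent_iff a b
    rw [h]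
    tauto
  asymm a b := by
    have h := Q.asymm a b
    have h' := Q.asymm b a
    tauto

/-- `i₁ i₂ ⋯ i_l` is adapted to `Q`: each `i_k` is a sink of `i_{k-1} ⋯ i₂ i₁ Q`. -/
def Adapted : DynkinQuiver m → List (Fin m) → Prop
  | _, [] => True
  | Q, i :: w => Q.Sink i ∧ (Q.reflect i).Adapted w

/-- `w` is a reduced word of the longest element that is adapted to `Q`. -/
def IsAdaptedLongest (Q : DynkinQuiver m) (w : List (Fin m)) : Prop :=
  IsReducedLongest w ∧ Q.Adapted w

/-- `c` is the class `[Q]`, that is, the class of a reduced word of the longest element that is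
adapted to `Q`. -/
def IsClassOf (Q : DynkinQuiver m) (c : CommClass m) : Prop :=
  ∃ w, Q.IsAdaptedLongest w ∧ c = cls w

/-- The number of arrows between `i` and `j` that are directed toward `i`: arrows `p → q` on the
segment between `i` and `j` whose head `q` is nearer to `i` than the tail `p`. -/
noncomputable def arrowsToward (Q : DynkinQuiver m) (i j : Fin m) : ℕ :=
  {p : Fin m × Fin m | Q.arrow p.1 p.2 ∧ p.1 ∈ Set.uIcc i j ∧ p.2 ∈ Set.uIcc i j ∧
    Nat.dist p.2.val i.val < Nat.dist p.1.val i.val}.ncard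

/-- `|a_i - b_i| = 1` for all `i`, where `a_i` and `b_i` are the numbers of arrows between `i` and
`i^∨` that are directed toward `i` and toward `i^∨`. -/
def Balanced (Q : DynkinQuiver m) : Prop :=
  ∀ i : Fin m, |(Q.arrowsToward i i.rev : ℤ) - (Q.arrowsToward i.rev i : ℤ)| = 1

end DynkinQuiver

/-- The adapted cluster point `⟦Q⟧` of type `A_m`: all classes `[Q]`. -/
def adaptedCluster (m : ℕ) : Set (CommClass m) := {c | ∃ Q : DynkinQuiver m, Q.IsClassOf c}

/-! ### Twisted Coxeter elements and the twisted adapted cluster point of type `A_{2n+1}` -/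

/-- The word `∏_{k=0}^{2n} u^{k∨}`, where `u^{k∨}` is `u` with `∨` applied `k` times to each
letter. -/
def twistedPower {n : ℕ} (u : List (Fin (2 * n + 1))) : List (Fin (2 * n + 1)) :=
  (List.range (2 * n + 1)).flatMap fun k => u.map (Fin.rev^[k])

/-- The word `1 2 ⋯ n+1`. -/
def initialWord (n : ℕ) : List (Fin (2 * n + 1)) :=
  (List.finRange (n + 1)).map (Fin.castLE (by omega))

/-- The twisted adapted cluster point of type `A_{2n+1}`: the `r`-cluster point of the class of
`∏_{k=0}^{2n} (1 2 ⋯ n+1)^{k∨}`. -/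
def twistedCluster (n : ℕ) : Set (CommClass (2 * n + 1)) :=
  rCluster (cls (twistedPower (initialWord n)))

/-- `u` contains exactly one letter of each `∨`-orbit, and contains it once. -/
def IsTransversal {m : ℕ} (u : List (Fin m)) : Prop :=
  ∀ i : Fin m, u.countP (fun j => decide (j = i ∨ j = i.rev)) = 1

/-- The automorphism of the Weyl group with `s_i ↦ s_{i^∨}`. In type `A` it is conjugation by the
longest element, see `longest_mul_simple_mul_longest`. -/
def veeAut (m : ℕ) : MulAut (Weyl m) := MulAut.conj (longest m)

/-- The group in which the coset `W ∨` lives. -/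
abbrev ExtendedWeyl (m : ℕ) : Type := Weyl m ⋊[MonoidHom.id (MulAut (Weyl m))] MulAut (Weyl m)

/-- The element `s_{i_1} ⋯ s_{i_k} ∨` of the coset `W ∨`. -/
def twistedElement {m : ℕ} (u : List (Fin m)) : ExtendedWeyl m :=
  SemidirectProduct.inl (wordProd u) * SemidirectProduct.inr (veeAut m)

/-- The twisted Coxeter elements of type `A_m`. -/
def twistedCoxeterElements (m : ℕ) : Set (ExtendedWeyl m) :=
  {x | ∃ u : List (Fin m), IsTransversal u ∧ x = twistedElement u}

/-- The index `n + 1` of `A_{2n+1}`. -/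
def mid (n : ℕ) : Fin (2 * n + 1) := ⟨n, by omega⟩

/-- `P` on letters: `i ↦ i` for `i ≤ n`, `n + 1` is deleted, and `j ↦ j - 1` for `j ≥ n + 2`. -/
def letterP {n : ℕ} (j : Fin (2 * n + 1)) : Option (Fin (2 * n)) :=
  if h : j.val < n then some ⟨j.val, by omega⟩
  else if h' : j.val = n then none
  else some ⟨j.val - 1, by omega⟩

/-- The monoid homomorphism `P` from words of type `A_{2n+1}` to words of type `A_{2n}`. -/
def wordP {n : ℕ} (w : List (Fin (2 * n + 1))) : List (Fin (2 * n)) := w.filterMap letterP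

/-! ### The surgery -/

/-- The index shift: `i ↦ i` for `i ≤ n` and `i ↦ i + 1` for `i ≥ n + 1`. -/
def shift {n : ℕ} (i : Fin (2 * n)) : Fin (2 * n + 1) :=
  if i.val < n then ⟨i.val, by omega⟩ else ⟨i.val + 1, by omega⟩

/-- In a word in the letters `n` and `n + 2`, put one letter `n + 1` between each `n` and `n + 2`
that stand next to each other, in either order. -/
def insertMid {n : ℕ} : List (Fin (2 * n + 1)) → List (Fin (2 * n + 1))
  | [] => []
  | [a] => [a]
  | a :: b :: l => if a = b then a :: insertMid (b :: l) else a :: mid n :: insertMid (b :: l)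

/-- `v` arises from the shifted word of `w` by inserting one letter `n + 1` between each adjacent
`n` and `n + 2`, at an arbitrary place between them, and nothing else. Here an `n` and an `n + 2`
are adjacent if neither `n` nor `n + 2` occurs between them. -/
def IsInsertion {n : ℕ} (w : List (Fin (2 * n))) (v : List (Fin (2 * n + 1))) : Prop :=
  v.filter (fun j => decide (j ≠ mid n)) = w.map shift ∧
  v.filter (fun j => decide (j.val + 1 = n ∨ j.val = n ∨ j.val = n + 1)) =
    insertMid ((w.map shift).filter fun j => decide (j.val + 1 = n ∨ j.val = n + 1))

end TwistedAdapted

open TwistedAdapted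

namespace TwistedAdapted

/-! ### Words and commutation classes -/

section Words

variable {m : ℕ}

/-! Commutation classes are encoded by height functions on the Dynkin diagram. A letter can be fired
at `a` when it is a strict local minimum of `a`, and firing raises it by a fixed step. Along a walk
from `a` to `c` the number of firings of each letter is forced, and the order of the firings is
forced up to commutation; so all words that lead from `a` to `c` form one commutation class
(`Walk.cls_eq`, `walk_iff_of_cls_eq`). A full word leads from `a` to `bar a`, the reversal of `a`
raised by a period. If `i` can be fired at `a`, moving `i` from the front to the end as `i^*` turns
a full word of `a` into one of the fired function (`FiringSystem.full_cons_iff`). Reflection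
functors are thus single firings, possibly backwards, and a cluster point is the set of all valid
height functions up to constants (`FiringSystem.rCluster_classOf`). Being a word of `w₀` of the
right length is invariant under these moves, so it is checked on one explicit power of a half
Coxeter word in each type.

In type `A_{2n}` adjacent heights differ by 2 and the step is 4. Such functions up to constants are
the Dynkin quivers, firing is reflection at a sink, and the adapted reduced words of `w₀` are the
full words (`full_of_isReducedLongest`).

In type `A_{2n+1}` the outer letters carry a height function of type `A_{2n}`, whereas the middle
letter has step 2 and lies at the minimum of its two neighbours plus or minus 1. Deleting the middle
letter forgets only this sign, hence the map is onto and two-to-one; the sign says whether the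
middle letter is a sink (minus) or a source (plus). A firing of a neighbour changes plus to minus
and a firing of the middle letter changes it back. The two neighbours alternate, which is the rule
for inserting the middle letter (`walk_of_insertion`).

A transversal word `u` leads from a suitable `a` to the reversal of `a` raised by 2, so its twisted
power of `2n+1` factors is a full word. The functions that occur are those whose heights at `i` and
`i^∨` differ by 2 for every outer `i`; in terms of quivers, `2 (a_i - b_i) = ±2`. A word without
repeated letters is determined up to commutation by its product, which makes the correspondence
injective. For the counts, the middle height is set to 0 and the pairs of heights are read outwards:
4 initial pairs, then 4 continuations each, of which 3 preserve balance. -/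

@[simp] theorem wordProd_nil : wordProd ([] : List (Fin m)) = 1 := rfl

@[simp] theorem wordProd_cons (i : Fin m) (w : List (Fin m)) :
    wordProd (i :: w) = simple i * wordProd w := rfl

@[simp] theorem wordProd_append (w w' : List (Fin m)) :
    wordProd (w ++ w') = wordProd w * wordProd w' := by
  simp [wordProd]

theorem Adjacent.symm {i j : Fin m} (h : Adjacent i j) : Adjacent j i := Or.symm h

theorem adjacent_comm {i j : Fin m} : Adjacent i j ↔ Adjacent j i := ⟨Or.symm, Or.symm⟩

theorem Adjacent.ne {i j : Fin m} (h : Adjacent i j) : i ≠ j := by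
  rintro rfl
  rcases h with h | h <;> omega

theorem adjacent_rev {i j : Fin m} : Adjacent i.rev j.rev ↔ Adjacent i j := by
  simp only [Adjacent, Fin.val_rev]
  omega

theorem simple_mul_self (i : Fin m) : simple i * simple i = 1 := Equiv.swap_mul_self _ _

theorem simple_comm {i j : Fin m} (hij : i ≠ j) (h : ¬ Adjacent i j) :
    simple i * simple j = simple j * simple i := by
  apply (Equiv.Perm.Disjoint.commute _).eq
  apply Equiv.Perm.disjoint_swap_swap
  have h1 : i.val ≠ j.val := fun h => hij (Fin.ext h)
  simp only [Adjacent] at h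
  simp [Fin.ext_iff]
  omega

theorem cls_eq_iff {w w' : List (Fin m)} : cls w = cls w' ↔ Relation.EqvGen CommStep w w' :=
  Quotient.eq

theorem CommStep.cls_eq {w w' : List (Fin m)} (h : CommStep w w') : cls w = cls w' :=
  cls_eq_iff.2 (Relation.EqvGen.rel _ _ h)

/-- A function on words that is invariant under commutation relations is a class function. -/
theorem eq_of_cls_eq {β : Sort*} (f : List (Fin m) → β)
    (hf : ∀ w w', CommStep w w' → f w = f w') {w w' : List (Fin m)} (h : cls w = cls w') :
    f w = f w' := by
  have h' := cls_eq_iff.1 h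
  induction h' with
  | rel x y hxy => exact hf x y hxy
  | refl x => rfl
  | symm x y hxy ih => exact (ih (cls_eq_iff.2 hxy)).symm
  | trans x y z hxy hyz ih1 ih2 =>
    exact (ih1 (cls_eq_iff.2 hxy)).trans (ih2 (cls_eq_iff.2 hyz))

theorem wordProd_eq_of_cls_eq {w w' : List (Fin m)} (h : cls w = cls w') :
    wordProd w = wordProd w' := by
  refine eq_of_cls_eq wordProd ?_ h
  rintro w w' ⟨x, y, i, j, hij, hadj, rfl, rfl⟩
  simp only [wordProd_append, wordProd_cons, ← mul_assoc]
  rw [mul_assoc (wordProd x), simple_comm hij hadj, ← mul_assoc]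

theorem perm_of_cls_eq {w w' : List (Fin m)} (h : cls w = cls w') : w.Perm w' := by
  have h' := cls_eq_iff.1 h
  induction h' with
  | rel x y hxy =>
    obtain ⟨x, y, i, j, -, -, rfl, rfl⟩ := hxy
    exact (List.Perm.swap _ _ _).append_left x
  | refl x => rfl
  | symm x y hxy ih => exact (ih (cls_eq_iff.2 hxy)).symm
  | trans x y z hxy hyz ih1 ih2 =>
    exact (ih1 (cls_eq_iff.2 hxy)).trans (ih2 (cls_eq_iff.2 hyz))

theorem cls_append_congr (x y : List (Fin m)) {w w' : List (Fin m)} (h : cls w = cls w') :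
    cls (x ++ w ++ y) = cls (x ++ w' ++ y) := by
  refine eq_of_cls_eq (fun w => cls (x ++ w ++ y)) ?_ h
  rintro w w' ⟨x', y', i, j, hij, hadj, rfl, rfl⟩
  exact CommStep.cls_eq ⟨x ++ x', y' ++ y, i, j, hij, hadj, by simp, by simp⟩

theorem cls_cons_congr (i : Fin m) {w w' : List (Fin m)} (h : cls w = cls w') :
    cls (i :: w) = cls (i :: w') := by
  simpa using cls_append_congr [i] [] h

/-- A letter that commutes with all letters of `x` can be moved to the front of `x`. -/
theorem cls_move {i : Fin m} (x y : List (Fin m)) (h : ∀ j ∈ x, j ≠ i ∧ ¬ Adjacent j i) :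
    cls (x ++ i :: y) = cls (i :: (x ++ y)) := by
  induction x with
  | nil => rfl
  | cons j x ih =>
    have h1 := cls_cons_congr j (ih fun k hk => h k (by simp [hk]))
    refine h1.trans (CommStep.cls_eq ?_)
    have hj := h j (by simp)
    exact ⟨[], x ++ y, j, i, hj.1, hj.2, by simp, by simp⟩

end Words

/-! ### Inversions and reduced words of the longest element -/

section Length

variable {m : ℕ}

/-- The inversions of a permutation. -/
def inversions (σ : Weyl m) : Finset (Fin (m + 1) × Fin (m + 1)) :=
  Finset.univ.filter fun p => p.1 < p.2 ∧ σ p.2 < σ p.1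

theorem mem_inversions {σ : Weyl m} {p : Fin (m + 1) × Fin (m + 1)} :
    p ∈ inversions σ ↔ p.1 < p.2 ∧ σ p.2 < σ p.1 := by
  simp [inversions]

theorem simple_lt_simple {i : Fin m} {x y : Fin (m + 1)} (hxy : x < y)
    (h : ¬ (x = i.castSucc ∧ y = i.succ)) : simple i x < simple i y := by
  simp only [simple, Equiv.swap_apply_def]
  simp only [Fin.ext_iff, Fin.lt_def, Fin.val_castSucc, Fin.val_succ] at *
  split_ifs <;> simp <;> omega

/-- `s_i` preserves the order of every pair except `(i, i+1)`, so apart from this pair the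
inversions of `σ s_i` come from those of `σ`. -/
theorem card_inversions_mul_simple_le (σ : Weyl m) (i : Fin m) :
    (inversions (σ * simple i)).card ≤ (inversions σ).card + 1 := by
  have h : (inversions (σ * simple i)).erase (i.castSucc, i.succ) ⊆
      (inversions σ).image (Prod.map (simple i) (simple i)) := by
    rintro ⟨x, y⟩ hxy
    simp only [Finset.mem_erase, mem_inversions, ne_eq, Prod.mk.injEq,
      Equiv.Perm.mul_apply] at hxy
    obtain ⟨hne, hlt, hσ⟩ := hxy
    have hs : ∀ z, simple i (simple i z) = z := fun z => Equiv.swap_apply_self _ _ _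
    refine Finset.mem_image.2 ⟨(simple i x, simple i y), ?_, by simp [hs]⟩
    rw [mem_inversions]
    exact ⟨simple_lt_simple hlt hne, hσ⟩
  have h1 := Finset.card_le_card h
  have h2 := Finset.card_image_le (s := inversions σ) (f := Prod.map (simple i) (simple i))
  have h3 := Finset.pred_card_le_card_erase (s := inversions (σ * simple i))
    (a := (i.castSucc, i.succ))
  omega

theorem card_inversions_wordProd_le (w : List (Fin m)) :
    (inversions (wordProd w)).card ≤ w.length := by
  induction w using List.reverseRecOn with
  | nil =>
    simp only [wordProd_nil, List.length_nil, nonpos_iff_eq_zero, Finset.card_eq_zero]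
    ext p
    simp only [mem_inversions, Equiv.Perm.one_apply, Finset.notMem_empty, iff_false]
    exact fun h => lt_asymm h.1 h.2
  | append_singleton w i ih =>
    have h := card_inversions_mul_simple_le (wordProd w) i
    simp only [wordProd_append, wordProd_cons, wordProd_nil, mul_one, List.length_append,
      List.length_singleton]
    omega

theorem card_inversions_longest : (inversions (longest m)).card * 2 = m * (m + 1) := by
  have h : inversions (longest m) =
      (Finset.univ.sigma (fun y : Fin (m + 1) => Finset.Iio y)).map
        ⟨fun p => (p.2, p.1), by rintro ⟨x, y⟩ ⟨x', y'⟩ h; simp_all⟩ := by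
    ext ⟨x, y⟩
    simp only [mem_inversions, longest, Fin.revPerm_apply, Fin.rev_lt_rev, and_self,
      Finset.mem_map, Finset.mem_sigma, Finset.mem_univ, Finset.mem_Iio, true_and, Sigma.exists]
    constructor
    · exact fun h => ⟨y, x, h, rfl⟩
    · rintro ⟨a, b, h, hab⟩
      obtain ⟨rfl, rfl⟩ := Prod.mk.inj hab
      exact h
  rw [h, Finset.card_map, Finset.card_sigma]
  simp only [Fin.card_Iio]
  rw [Fin.sum_univ_eq_sum_range (fun i => i), Finset.sum_range_id_mul_two]
  simp [mul_comm]

/-- The word represents the longest element and has its length. -/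
def IsLongWord (w : List (Fin m)) : Prop := wordProd w = longest m ∧ w.length * 2 = m * (m + 1)

/-- The number of inversions bounds the length of every word from below, and `w₀` has `m(m+1)/2` of
them. -/
theorem IsLongWord.isReducedLongest {w : List (Fin m)} (h : IsLongWord w) :
    IsReducedLongest w := by
  refine ⟨fun u hu => ?_, h.1⟩
  have h1 := card_inversions_wordProd_le u
  have h2 := card_inversions_longest (m := m)
  rw [hu, h.1] at h1
  have h3 := h.2
  omega

theorem IsLongWord.of_cls_eq {w w' : List (Fin m)} (h : IsLongWord w) (hc : cls w = cls w') :
    IsLongWord w' :=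
  ⟨(wordProd_eq_of_cls_eq hc).symm.trans h.1, by rw [← (perm_of_cls_eq hc).length_eq]; exact h.2⟩

/-- The relation `w₀ s_{i*} = s_i w₀` lets a first letter `i` be traded for a last letter `i*`. -/
theorem isLongWord_rotate {i : Fin m} {w : List (Fin m)} :
    IsLongWord (i :: w) ↔ IsLongWord (w ++ [i.rev]) := by
  have h : longest m * simple i.rev = simple i * longest m := by
    have h1 := longest_mul_simple_mul_longest i.rev
    rw [Fin.rev_rev] at h1
    rw [← h1]
    group
  have h2 : wordProd (i :: w) = longest m ↔ wordProd (w ++ [i.rev]) = longest m := by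
    simp only [wordProd_append, wordProd_cons, wordProd_nil, mul_one]
    constructor
    · intro h3
      have h4 : wordProd w = simple i * longest m := by
        rw [← h3, ← mul_assoc, simple_mul_self, one_mul]
      rw [h4, ← h, mul_assoc, simple_mul_self, mul_one]
    · intro h3
      have h4 : wordProd w = longest m * simple i.rev := by
        rw [← h3, mul_assoc, simple_mul_self, mul_one]
      rw [h4, h, ← mul_assoc, simple_mul_self, one_mul]
  simp only [IsLongWord, h2, List.length_cons, List.length_append, List.length_nil, zero_add]

theorem IsReducedWord.of_append_left {x w : List (Fin m)} (h : IsReducedWord (x ++ w)) :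
    IsReducedWord w := by
  intro u hu
  have h1 := h (x ++ u) (by simp [hu])
  simpa using h1

theorem IsReducedWord.of_cls_eq {w w' : List (Fin m)} (h : IsReducedWord w)
    (hc : cls w = cls w') : IsReducedWord w' := by
  intro u hu
  rw [← (perm_of_cls_eq hc).length_eq]
  exact h u (hu.trans (wordProd_eq_of_cls_eq hc).symm)

/-- Reflection functors preserve the property that the words of a class are reduced words of the
longest element. -/
theorem ReflEquiv.isLongWord {c c' : CommClass m} (h : ReflEquiv c c')
    (hc : ∀ w, cls w = c → IsLongWord w) : ∀ w, cls w = c' → IsLongWord w := by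
  induction h with
  | refl => exact hc
  | tail _ hstep ih =>
    obtain ⟨i, (⟨w, rfl, rfl⟩ | ⟨-, rfl⟩) | (⟨w, rfl, rfl⟩ | ⟨-, rfl⟩)⟩ := hstep
    · exact fun v hv => (isLongWord_rotate.1 (ih _ rfl)).of_cls_eq hv.symm
    · exact ih
    · refine fun v hv => (isLongWord_rotate.2 ?_).of_cls_eq hv.symm
      rw [Fin.rev_rev]
      exact ih _ rfl
    · exact ih

end Length

/-! ### Supports -/

section Support

variable {m : ℕ}

/-- Among the simple reflections only `s_j` moves a point across the cut after position `j`. This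
cut is the probe for the letter `j` in what follows. -/
theorem simple_le_iff {i j : Fin m} (h : i ≠ j) (x : Fin (m + 1)) :
    (simple i x).val ≤ j.val ↔ x.val ≤ j.val := by
  have h1 : i.val ≠ j.val := fun h' => h (Fin.ext h')
  simp only [simple, Equiv.swap_apply_def]
  split_ifs with h2 h3
  · subst h2; simp; omega
  · subst h3; simp; omega
  · rfl

theorem wordProd_le_iff {w : List (Fin m)} {j : Fin m} (h : j ∉ w) (x : Fin (m + 1)) :
    (wordProd w x).val ≤ j.val ↔ x.val ≤ j.val := by
  induction w with
  | nil => simp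
  | cons i w ih =>
    rw [List.mem_cons, not_or] at h
    rw [wordProd_cons, Equiv.Perm.mul_apply, simple_le_iff (Ne.symm h.1), ih h.2]

/-- Each cut is respected by one of the two words, hence by the common product. A permutation that
respects every cut is the identity. -/
theorem wordProd_eq_one_of_disjoint {w w' : List (Fin m)} (h : wordProd w = wordProd w')
    (hd : ∀ j, j ∉ w ∨ j ∉ w') : wordProd w = 1 := by
  have key : ∀ (j : Fin m) x, (wordProd w x).val ≤ j.val ↔ x.val ≤ j.val := by
    intro j x
    rcases hd j with hj | hj
    · exact wordProd_le_iff hj x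
    · rw [h]; exact wordProd_le_iff hj x
  ext x
  rw [Equiv.Perm.one_apply]
  have h1 := x.isLt
  have h2 := (wordProd w x).isLt
  by_contra hne
  rcases Nat.lt_or_gt_of_ne hne with hlt | hlt
  · have := key ⟨(wordProd w x).val, by omega⟩ x
    simp only [le_refl, true_iff] at this
    omega
  · have := key ⟨x.val, by omega⟩ x
    simp only [le_refl, iff_true] at this
    omega

/-- The support of a word without repeated letters can be read off from its product. -/
theorem mem_iff_of_nodup {w : List (Fin m)} (hw : w.Nodup) (j : Fin m) :
    j ∈ w ↔ ∃ x, ¬ ((wordProd w x).val ≤ j.val ↔ x.val ≤ j.val) := by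
  constructor
  · intro hj
    obtain ⟨a, b, rfl⟩ := List.append_of_mem hj
    rw [List.nodup_middle, List.nodup_cons, List.mem_append, not_or] at hw
    -- The point that arrives at the only occurrence of `s_j` just below the cut; it is carried
    -- across and never returns.
    refine ⟨(wordProd b)⁻¹ j.castSucc, ?_⟩
    simp only [wordProd_append, wordProd_cons, Equiv.Perm.mul_apply]
    rw [← Equiv.Perm.mul_apply (wordProd b), mul_inv_cancel, Equiv.Perm.one_apply,
      wordProd_le_iff hw.1.1, ← wordProd_le_iff hw.1.2 ((wordProd b)⁻¹ _)]
    simp [simple]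
  · rintro ⟨x, hx⟩
    by_contra hj
    exact hx (wordProd_le_iff hj x)

/-! ### The order of two letters in a word -/

theorem exists_eq_append_of_pair_sublist {α : Type*} {w : List α} {i j : α}
    (h : [i, j].Sublist w) : ∃ a b c, w = a ++ i :: (b ++ j :: c) := by
  obtain ⟨r₁, r₂, rfl, h1, h2⟩ := List.cons_sublist_iff.1 h
  obtain ⟨a, s, rfl⟩ := List.append_of_mem h1
  obtain ⟨t, c, rfl⟩ := List.append_of_mem (List.singleton_sublist.1 h2)
  exact ⟨a, s ++ t, c, by simp⟩

theorem pair_sublist_of_eq_append {α : Type*} {a b c : List α} {i j : α} :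
    [i, j].Sublist (a ++ i :: (b ++ j :: c)) :=
  ((List.singleton_sublist.2 (by simp)).cons_cons i).trans (List.sublist_append_right _ _)

theorem pair_sublist_total {α : Type*} {w : List α} {i j : α} (hij : i ≠ j)
    (hi : i ∈ w) (hj : j ∈ w) : [i, j].Sublist w ∨ [j, i].Sublist w := by
  obtain ⟨a, r, rfl⟩ := List.append_of_mem hi
  rcases List.mem_append.1 hj with h | h
  · obtain ⟨b, c, rfl⟩ := List.append_of_mem h
    right
    simp
  · obtain ⟨b, c, rfl⟩ := List.append_of_mem ((List.mem_cons.1 h).resolve_left hij.symm)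
    exact Or.inl pair_sublist_of_eq_append

theorem pair_sublist_asymm {α : Type*} {w : List α} (hw : w.Nodup) {i j : α} (hij : i ≠ j)
    (h : [i, j].Sublist w) : ¬ [j, i].Sublist w := by
  intro h'
  obtain ⟨a, b, c, rfl⟩ := exists_eq_append_of_pair_sublist h
  rw [List.nodup_middle, List.nodup_cons] at hw
  obtain ⟨r₁, r₂, h0, h1, h2⟩ := List.cons_sublist_iff.1 h'
  have hi := List.singleton_sublist.1 h2
  simp only [List.mem_append, List.mem_cons, not_or, List.nodup_append, List.nodup_cons] at hw
  rcases List.append_eq_append_iff.1 h0 with ⟨t, rfl, h3⟩ | ⟨t, rfl, h3⟩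
  · rcases t with _ | ⟨k, t⟩
    · grind
    · grind
  · grind

/-- The order of two adjacent letters of a word without repeated letters can be read off from its
product. -/
theorem pair_sublist_iff_of_nodup {w : List (Fin m)} (hw : w.Nodup) {i j : Fin m}
    (hij : i.val + 1 = j.val) (hi : i ∈ w) (hj : j ∈ w) :
    [j, i].Sublist w ↔ ∃ x : Fin (m + 1), x.val ≤ i.val ∧ j.val < (wordProd w x).val := by
  have hne : i ≠ j := fun h => by subst h; omega
  constructor
  · intro hs
    obtain ⟨a, b, c, rfl⟩ := exists_eq_append_of_pair_sublist hs
    have hia : i ∉ a ∧ i ∉ b ∧ i ∉ c ∧ j ∉ a ∧ j ∉ b ∧ j ∉ c := by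
      simp only [List.nodup_append, List.nodup_cons, List.mem_append, List.mem_cons] at hw
      grind
    obtain ⟨h1, h2, h3, h4, h5, h6⟩ := hia
    -- Products act from right to left: this point meets `s_i` first and is lifted over the cut `i`,
    -- then meets `s_j` and is lifted over the cut `j`.
    refine ⟨(wordProd c)⁻¹ i.castSucc, ?_, ?_⟩
    · rw [← wordProd_le_iff h3, ← Equiv.Perm.mul_apply, mul_inv_cancel, Equiv.Perm.one_apply]
      simp
    · simp only [wordProd_append, wordProd_cons, Equiv.Perm.mul_apply]
      rw [← Equiv.Perm.mul_apply (wordProd c), mul_inv_cancel, Equiv.Perm.one_apply,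
        ← not_le, wordProd_le_iff h4]
      have e1 : simple i i.castSucc = i.succ := Equiv.swap_apply_left _ _
      -- Only one point lies between the cuts `i` and `j`, and `b` respects both.
      have e2 : wordProd b i.succ = j.castSucc := by
        have h7 := wordProd_le_iff h2 i.succ
        have h8 := wordProd_le_iff h5 i.succ
        simp only [Fin.val_succ] at h7 h8
        apply Fin.ext
        simp only [Fin.val_castSucc]
        omega
      have e3 : simple j j.castSucc = j.succ := Equiv.swap_apply_left _ _
      rw [e1, e2, e3]
      simp
  · rintro ⟨x, hx, hx'⟩
    refine (pair_sublist_total hne hi hj).resolve_left fun hs => ?_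
    obtain ⟨a, b, c, rfl⟩ := exists_eq_append_of_pair_sublist hs
    have hia : i ∉ b ∧ i ∉ c ∧ j ∉ a := by
      simp only [List.nodup_append, List.nodup_cons, List.mem_append, List.mem_cons] at hw
      grind
    obtain ⟨h1, h2, h3⟩ := hia
    simp only [wordProd_append, wordProd_cons, Equiv.Perm.mul_apply] at hx'
    rw [← not_le, wordProd_le_iff h3, simple_le_iff hne] at hx'
    rw [← wordProd_le_iff h2, ← simple_le_iff (Ne.symm hne), ← wordProd_le_iff h1] at hx
    omega

/-- A word without repeated letters is determined up to commutation by its letters and the order of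
adjacent ones. -/
theorem cls_eq_of_pair_sublist {u u' : List (Fin m)} (hu : u.Nodup) (hp : u.Perm u')
    (h : ∀ i j, Adjacent i j → [i, j].Sublist u' → [i, j].Sublist u) : cls u = cls u' := by
  induction u generalizing u' with
  | nil => rw [hp.nil_eq]
  | cons i u ih =>
    obtain ⟨x, y, rfl⟩ := List.append_of_mem (hp.subset List.mem_cons_self)
    have hu' := hp.nodup hu
    -- Since `i` comes first in `u`, no letter adjacent to it can precede it in `u'`; it can
    -- therefore be commuted to the front.
    have hxy : ∀ j ∈ x, j ≠ i ∧ ¬ Adjacent j i := by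
      intro j hj
      have hne : j ≠ i := by
        rintro rfl
        simp only [List.nodup_append] at hu'
        grind
      refine ⟨hne, fun hadj => ?_⟩
      obtain ⟨a, b, rfl⟩ := List.append_of_mem hj
      have h1 := h j i hadj (by simp)
      have h2 : [i, j].Sublist (i :: u) := by
        apply List.Sublist.cons_cons
        rw [List.singleton_sublist]
        have := hp.mem_iff (a := j)
        simp only [List.mem_cons, hne, false_or] at this
        exact this.2 (by simp)
      exact pair_sublist_asymm hu hne h1 h2
    rw [cls_move x y hxy]
    apply cls_cons_congr
    have hp' : u.Perm (x ++ y) := (hp.trans List.perm_middle).cons_inv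
    refine ih hu.of_cons hp' fun k l hkl hs => ?_
    have hs' : [k, l].Sublist (x ++ i :: y) :=
      hs.trans ((List.sublist_cons_self i y).append_left x)
    have h1 := h k l hkl hs'
    rcases List.sublist_cons_iff.1 h1 with h2 | ⟨r, h2, h3⟩
    · exact h2
    · have hki : k = i := (List.cons.inj h2).1
      subst hki
      have := hp'.symm.subset (hs.subset (a := k) (by simp))
      exact absurd this (List.nodup_cons.1 hu).1

/-- Words without repeated letters that have the same product are commutation equivalent. -/
theorem cls_eq_of_wordProd_eq {u u' : List (Fin m)} (hu : u.Nodup) (hu' : u'.Nodup)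
    (h : wordProd u = wordProd u') : cls u = cls u' := by
  have hmem : ∀ j, j ∈ u ↔ j ∈ u' := fun j => by
    rw [mem_iff_of_nodup hu, mem_iff_of_nodup hu', h]
  refine cls_eq_of_pair_sublist hu ((List.perm_ext_iff_of_nodup hu hu').2 hmem) ?_
  intro i j hadj hs
  have hi' : i ∈ u' := hs.subset (by simp)
  have hj' : j ∈ u' := hs.subset (by simp)
  have hi := (hmem i).2 hi'
  have hj := (hmem j).2 hj'
  have hne := hadj.ne
  rcases hadj with hij | hij
  · refine (pair_sublist_total hne hi hj).resolve_right fun hs' => ?_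
    rw [pair_sublist_iff_of_nodup hu hij hi hj, h,
      ← pair_sublist_iff_of_nodup hu' hij hi' hj'] at hs'
    exact pair_sublist_asymm hu' hne hs hs'
  · rw [pair_sublist_iff_of_nodup hu hij hj hi, h,
      ← pair_sublist_iff_of_nodup hu' hij hj' hi']
    exact hs

end Support

/-! ### Firing words along height functions -/

section Walks

variable {m : ℕ}

/-- The letter `i` can be fired at the height function `a`: it is a strict local minimum. -/
def Fires (a : Fin m → ℤ) (i : Fin m) : Prop := ∀ j, Adjacent i j → a i < a j

/-- Raise the height of `i` by its step. -/
def bump (d a : Fin m → ℤ) (i : Fin m) : Fin m → ℤ := Function.update a i (a i + d i)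

/-- The letters of the word can be fired successively, which leads from `a` to `c`. -/
def Walk (d : Fin m → ℤ) : (Fin m → ℤ) → List (Fin m) → (Fin m → ℤ) → Prop
  | a, [], c => a = c
  | a, i :: w, c => Fires a i ∧ Walk d (bump d a i) w c

variable {d a c : Fin m → ℤ}

@[simp] theorem bump_self (i : Fin m) : bump d a i i = a i + d i := by simp [bump]

theorem bump_of_ne {i j : Fin m} (h : j ≠ i) : bump d a i j = a j := by simp [bump, h]

theorem bump_apply (i j : Fin m) : bump d a i j = a j + if j = i then d i else 0 := by
  by_cases h : j = i
  · subst h; simp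
  · simp [bump_of_ne h, h]

theorem le_bump (hd : ∀ i, 0 < d i) (i j : Fin m) : a j ≤ bump d a i j := by
  have := hd i
  rw [bump_apply]
  split_ifs <;> omega

@[simp] theorem walk_nil : Walk d a [] c ↔ a = c := Iff.rfl

@[simp] theorem walk_cons {i : Fin m} {w : List (Fin m)} :
    Walk d a (i :: w) c ↔ Fires a i ∧ Walk d (bump d a i) w c := Iff.rfl

theorem walk_append {x y : List (Fin m)} :
    Walk d a (x ++ y) c ↔ ∃ b, Walk d a x b ∧ Walk d b y c := by
  induction x generalizing a with
  | nil => simp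
  | cons i x ih => simp [ih, and_assoc]

theorem Walk.append {b : Fin m → ℤ} {x y : List (Fin m)} (hx : Walk d a x b)
    (hy : Walk d b y c) : Walk d a (x ++ y) c := walk_append.2 ⟨b, hx, hy⟩

theorem Walk.eq_add_count {w : List (Fin m)} (h : Walk d a w c) (i : Fin m) :
    c i = a i + w.count i * d i := by
  induction w generalizing a with
  | nil => rw [walk_nil] at h; simp [h]
  | cons j w ih =>
    rw [ih h.2, bump_apply, List.count_cons]
    by_cases hij : i = j
    · subst hij
      simp only [if_true, beq_self_eq_true]
      push_cast
      ring
    · simp [hij, Ne.symm hij]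

theorem Walk.le (hd : ∀ i, 0 < d i) {w : List (Fin m)} (h : Walk d a w c) (i : Fin m) :
    a i ≤ c i := by
  rw [h.eq_add_count i]
  have := hd i
  have : (0 : ℤ) ≤ w.count i * d i := by positivity
  omega

theorem bump_comm (i j : Fin m) : bump d (bump d a i) j = bump d (bump d a j) i := by
  ext k
  simp only [bump_apply]
  ring

theorem fires_bump_iff {i j : Fin m} (hne : i ≠ j) (h : ¬ Adjacent i j) :
    Fires (bump d a i) j ↔ Fires a j := by
  have key : ∀ k, Adjacent j k → bump d a i k = a k := by
    intro k hk
    apply bump_of_ne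
    rintro rfl
    exact h hk.symm
  simp only [Fires, bump_of_ne hne.symm]
  exact forall₂_congr fun k hk => by rw [key k hk]

/-- Firing a letter affects neither the height nor the neighbours of a distinct nonadjacent letter.
-/
theorem CommStep.walk_iff {w w' : List (Fin m)} (h : CommStep w w') :
    Walk d a w c ↔ Walk d a w' c := by
  obtain ⟨x, y, i, j, hne, hadj, rfl, rfl⟩ := h
  simp only [walk_append, walk_cons]
  refine exists_congr fun b => and_congr_right fun _ => ?_
  rw [fires_bump_iff hne hadj, fires_bump_iff hne.symm fun h => hadj h.symm, bump_comm]
  tauto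

theorem walk_iff_of_cls_eq {w w' : List (Fin m)} (h : cls w = cls w') :
    Walk d a w c ↔ Walk d a w' c :=
  iff_of_eq (eq_of_cls_eq (fun w => Walk d a w c) (fun _ _ h => propext h.walk_iff) h)

/-- If `i` can be fired and is not fired along `x`, then nothing adjacent to `i` is fired. -/
theorem Walk.not_adjacent_of_fires {x : List (Fin m)} (h : Walk d a x c)
    {i : Fin m} (hi : Fires a i) (hx : i ∉ x) : ∀ j ∈ x, j ≠ i ∧ ¬ Adjacent j i := by
  induction x generalizing a with
  | nil => simp
  | cons k x ih =>
    rw [List.mem_cons, not_or] at hx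
    have hk : ¬ Adjacent k i := fun hk => lt_asymm (hi k hk.symm) (h.1 i hk)
    have hi' : Fires (bump d a k) i := (fires_bump_iff (Ne.symm hx.1) hk).2 hi
    intro j hj
    rcases List.mem_cons.1 hj with rfl | hj
    · exact ⟨Ne.symm hx.1, hk⟩
    · exact ih h.2 hi' hx.2 j hj

/-- Two words that lead from `a` to `c` are commutation equivalent. -/
theorem Walk.cls_eq (hd : ∀ i, 0 < d i) {w w' : List (Fin m)} (h : Walk d a w c)
    (h' : Walk d a w' c) : cls w = cls w' := by
  induction w generalizing a w' with
  | nil =>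
    rcases w' with _ | ⟨i, w'⟩
    · rfl
    · have h1 := h'.2.le hd i
      rw [walk_nil] at h
      subst h
      have := hd i
      simp at h1
      omega
  | cons i w ih =>
    -- The walk along `i :: w` ends with `i` strictly above `a i`, so `w'` must raise it as well.
    have hi : i ∈ w' := by
      by_contra hi
      have h1 := h'.eq_add_count i
      have h2 := h.2.le hd i
      rw [List.count_eq_zero_of_not_mem hi] at h1
      have := hd i
      simp at h1 h2
      omega
    obtain ⟨x, y, rfl, hx⟩ : ∃ x y, w' = x ++ i :: y ∧ i ∉ x :=
      List.eq_append_cons_of_mem hi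
    -- As `i` can be fired at `a`, no neighbour of `i` is fired before the first `i` of `w'`.
    have hm : cls (x ++ i :: y) = cls (i :: (x ++ y)) := by
      obtain ⟨b, hb, -⟩ := walk_append.1 h'
      exact cls_move x y (hb.not_adjacent_of_fires h.1 hx)
    rw [hm]
    exact cls_cons_congr i (ih h.2 ((walk_iff_of_cls_eq hm).1 h').2)

theorem bump_add (K : ℤ) (i : Fin m) :
    bump d (fun j => a j + K) i = fun j => bump d a i j + K := by
  ext j
  simp only [bump_apply]
  ring

theorem fires_add_iff (K : ℤ) (i : Fin m) : Fires (fun j => a j + K) i ↔ Fires a i := by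
  simp [Fires]

theorem walk_add_iff (K : ℤ) {w : List (Fin m)} :
    Walk d (fun j => a j + K) w (fun j => c j + K) ↔ Walk d a w c := by
  induction w generalizing a with
  | nil => simp [funext_iff]
  | cons i w ih => rw [walk_cons, walk_cons, fires_add_iff, bump_add, ih]

theorem fires_rev_iff (i : Fin m) : Fires (fun j => a j.rev) i ↔ Fires a i.rev := by
  constructor
  · intro h j hj
    have h1 := h j.rev (by rwa [← adjacent_rev, Fin.rev_rev])
    simpa only [Fin.rev_rev] using h1
  · exact fun h j hj => h j.rev (adjacent_rev.2 hj)

theorem bump_rev (hd : ∀ i, d i.rev = d i) (i : Fin m) :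
    bump d (fun j => a j.rev) i = fun j => bump d a i.rev j.rev := by
  ext j
  simp only [bump_apply, Fin.rev_inj, hd]

theorem Walk.rev (hd : ∀ i, d i.rev = d i) {w : List (Fin m)} (h : Walk d a w c) :
    Walk d (fun j => a j.rev) (w.map Fin.rev) (fun j => c j.rev) := by
  induction w generalizing a with
  | nil => rw [walk_nil] at h; simp [h]
  | cons i w ih =>
    rw [List.map_cons, walk_cons, fires_rev_iff, bump_rev hd, Fin.rev_rev]
    exact ⟨h.1, ih h.2⟩

/-- The word `u u^∨ u^{2∨} ⋯` with `N` factors. -/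
def revPower (N : ℕ) (u : List (Fin m)) : List (Fin m) :=
  (List.range N).flatMap fun k => u.map (Fin.rev^[k])

theorem revPower_succ (N : ℕ) (u : List (Fin m)) :
    revPower (N + 1) u = revPower N u ++ u.map (Fin.rev^[N]) := by
  simp [revPower, List.range_succ]

theorem Walk.rev_iterate (hd : ∀ i, d i.rev = d i) {w : List (Fin m)} (h : Walk d a w c) (k : ℕ) :
    Walk d (fun j => a (Fin.rev^[k] j)) (w.map (Fin.rev^[k])) (fun j => c (Fin.rev^[k] j)) := by
  induction k with
  | zero => simpa using h
  | succ k ih =>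
    have h1 := ih.rev hd
    rw [List.map_map] at h1
    rw [Function.iterate_succ']
    convert h1 using 4
    all_goals exact (Function.Commute.iterate_self _ _ _).symm

/-- Each factor reverses the height function and raises it by `K`; the next factor is reversed too,
so it can be fired in turn. -/
theorem Walk.revPower (hd : ∀ i, d i.rev = d i) {u : List (Fin m)} {K : ℤ}
    (h : Walk d a u fun j => a j.rev + K) (N : ℕ) :
    Walk d a (revPower N u) fun j => a (Fin.rev^[N] j) + N * K := by
  induction N with
  | zero => simp [TwistedAdapted.revPower]
  | succ N ih =>
    rw [revPower_succ]
    refine ih.append ?_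
    have h1 := (walk_add_iff (N * K)).2 (h.rev_iterate hd N)
    convert h1 using 2 with j
    rw [Function.iterate_succ_apply']
    push_cast
    ring

/-- A word without repeated letters can be fired if this is so for pairs of adjacent letters. -/
theorem walk_of_nodup {u : List (Fin m)} (hu : u.Nodup)
    (h : ∀ i ∈ u, ∀ j, Adjacent i j →
      (¬ [j, i].Sublist u → a i < a j) ∧ ([j, i].Sublist u → a i < a j + d j)) :
    Walk d a u fun j => a j + if j ∈ u then d j else 0 := by
  -- When `i` is fired, a neighbour `j` stands at `a j + d j` if it precedes `i` in `u`, and still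
  -- at `a j` otherwise.
  induction u generalizing a with
  | nil => simp
  | cons i u ih =>
    rw [List.nodup_cons] at hu
    refine ⟨fun j hj => (h i (by simp) j hj).1 ?_, ?_⟩
    · rw [List.sublist_cons_iff]
      rintro (hs | ⟨r, hr, hs⟩)
      · exact hu.1 (hs.subset (by simp))
      · exact hj.ne (List.cons.inj hr).1.symm
    · have h1 := ih (a := bump d a i) hu.2 fun k hk j hj => ?_
      · convert h1 using 2 with j
        rw [bump_apply]
        by_cases hji : j = i
        · subst hji; simp [hu.1]
        · simp [hji]
      · have hki : k ≠ i := fun h => hu.1 (h ▸ hk)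
        have h2 := h k (List.mem_cons_of_mem _ hk) j hj
        rw [bump_of_ne hki, bump_apply]
        have h3 : [j, k].Sublist (i :: u) ↔ [j, k].Sublist u ∨ j = i := by
          rw [List.sublist_cons_iff]
          simp [hk]
        rw [h3] at h2
        by_cases hji : j = i
        · subst hji
          have h4 : ¬ [j, k].Sublist u := fun hs => hu.1 (hs.subset (by simp))
          simpa [h4] using h2
        · simpa [hji] using h2

end Walks

/-! ### Firing systems -/

/-- A class of height functions on the Dynkin diagram of type `A_m` in which firing words behave
like the adapted words of quivers. -/
structure FiringSystem (m : ℕ) where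
  /-- The amount by which the height of a letter is raised. -/
  step : Fin m → ℤ
  /-- The height functions. -/
  Valid : (Fin m → ℤ) → Prop
  /-- The height by which the diagram has moved after a word of the longest element. -/
  period : ℤ
  step_pos : ∀ i, 0 < step i
  step_rev : ∀ i, step i.rev = step i
  valid_bump : ∀ {a i}, Valid a → Fires a i → Valid (bump step a i)
  valid_add : ∀ {a} (K : ℤ), Valid a → Valid fun i => a i + K
  valid_rev : ∀ {a}, Valid a → Valid fun i => a i.rev
  ne_of_adjacent : ∀ {a i j}, Valid a → Adjacent i j → a i ≠ a j
  -- The axiom behind `exists_walk`: a letter above a neighbour that has already reached its final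
  -- height has less than one step left, so it is finished too.
  lt_of_adjacent : ∀ {a c i j}, Valid a → Valid c → Adjacent i j → a j < a i → c j = a j →
    c i < a i + step i
  exists_shift : ∀ {a c}, Valid a → Valid c →
    ∃ K : ℤ, ∀ i, ∃ k : ℕ, c i + K = a i + k * step i
  exists_period : ∀ {a}, Valid a → ∀ i, ∃ k : ℕ, 0 < k ∧ a i.rev + period = a i + k * step i

namespace FiringSystem

variable {m : ℕ} (S : FiringSystem m)

theorem valid_of_walk {a c : Fin m → ℤ} {w : List (Fin m)} (ha : S.Valid a)
    (h : Walk S.step a w c) : S.Valid c := by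
  induction w generalizing a with
  | nil => rw [walk_nil] at h; exact h ▸ ha
  | cons i w ih => exact ih (S.valid_bump ha h.1) h.2

/-- Greedy firing: among the letters below their target, one of least height can be fired. A lower
neighbour would already be at its target, which `lt_of_adjacent` excludes. The induction is on the
total deficit. -/
theorem exists_walk {a c : Fin m → ℤ} (ha : S.Valid a) (hc : S.Valid c)
    (h : ∀ i, ∃ k : ℕ, c i = a i + k * S.step i) : ∃ w, Walk S.step a w c := by
  have hle : ∀ i, a i ≤ c i := by
    intro i
    obtain ⟨k, hk⟩ := h i
    have h1 := S.step_pos i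
    have h2 : (0 : ℤ) ≤ k * S.step i := by positivity
    omega
  induction hN : (∑ i, (c i - a i)).toNat using Nat.strong_induction_on generalizing a with
  | _ N ih =>
  by_cases hac : a = c
  · exact ⟨[], hac⟩
  have hne : (Finset.univ.filter fun i => a i < c i).Nonempty := by
    by_contra hne
    rw [Finset.not_nonempty_iff_eq_empty, Finset.filter_eq_empty_iff] at hne
    exact hac (funext fun i => le_antisymm (hle i) (not_lt.1 (hne (Finset.mem_univ i))))
  obtain ⟨i, hi, hmin⟩ := Finset.exists_min_image _ a hne
  simp only [Finset.mem_filter, Finset.mem_univ, true_and] at hi hmin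
  have hstep := S.step_pos i
  obtain ⟨k, hk⟩ := h i
  have hk0 : k ≠ 0 := by
    rintro rfl
    simp at hk
    omega
  obtain ⟨k, rfl⟩ := Nat.exists_eq_succ_of_ne_zero hk0
  have hci : bump S.step a i i + k * S.step i = c i := by
    rw [hk, bump_self]
    push_cast
    ring
  have hci' : a i + S.step i ≤ c i := by
    have h2 : (0 : ℤ) ≤ k * S.step i := by positivity
    rw [bump_self] at hci
    omega
  have hfire : Fires a i := by
    intro j hj
    by_contra hlt
    have hlt' : a j < a i := lt_of_le_of_ne (not_lt.1 hlt) (S.ne_of_adjacent ha hj).symm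
    have hcj : c j = a j := by
      by_contra hcj
      have := hmin j (lt_of_le_of_ne (hle j) (Ne.symm hcj))
      omega
    have := S.lt_of_adjacent ha hc hj hlt' hcj
    omega
  have hle' : ∀ j, bump S.step a i j ≤ c j := by
    intro j
    rw [bump_apply]
    split_ifs with hji
    · subst hji; exact hci'
    · simpa using hle j
  have hlt : (∑ j, (c j - bump S.step a i j)).toNat < N := by
    have h1 : ∑ j, (c j - bump S.step a i j) < ∑ j, (c j - a j) := by
      refine Finset.sum_lt_sum (fun j _ => ?_) ⟨i, Finset.mem_univ i, ?_⟩
      · have := le_bump (a := a) S.step_pos i j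
        omega
      · rw [bump_self]; omega
    have h2 : 0 ≤ ∑ j, (c j - bump S.step a i j) :=
      Finset.sum_nonneg fun j _ => by have := hle' j; omega
    omega
  have hdiv : ∀ j, ∃ k : ℕ, c j = bump S.step a i j + k * S.step j := by
    intro j
    by_cases hji : j = i
    · subst hji; exact ⟨k, hci.symm⟩
    · rw [bump_of_ne hji]; exact h j
  obtain ⟨w, hw⟩ := ih _ hlt (S.valid_bump ha hfire) hdiv hle' rfl
  exact ⟨i :: w, hfire, hw⟩

/-- The height function at the end of a word of the longest element. -/
def bar (a : Fin m → ℤ) : Fin m → ℤ := fun i => a i.rev + S.period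

theorem valid_bar {a : Fin m → ℤ} (ha : S.Valid a) : S.Valid (S.bar a) :=
  S.valid_add _ (S.valid_rev ha)

theorem fires_bar_iff {a : Fin m → ℤ} (i : Fin m) : Fires (S.bar a) i ↔ Fires a i.rev :=
  (fires_add_iff _ _).trans (fires_rev_iff _)

theorem bump_bar {a : Fin m → ℤ} (i : Fin m) :
    bump S.step (S.bar a) i = S.bar (bump S.step a i.rev) := by
  unfold bar
  rw [bump_add, bump_rev S.step_rev]

/-- The word is fired from `a` to `bar a`. -/
def Full (a : Fin m → ℤ) (w : List (Fin m)) : Prop := Walk S.step a w (S.bar a)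

/-- The commutation class of the full words of `a`. -/
noncomputable def classOf (a : Fin m → ℤ) : CommClass m := cls (Classical.epsilon (S.Full a))

theorem exists_full {a : Fin m → ℤ} (ha : S.Valid a) : ∃ w, S.Full a w :=
  S.exists_walk ha (S.valid_bar ha) fun i =>
    (S.exists_period ha i).imp fun _ h => h.2

/-- The full words of `a` are closed under commutation and are all equivalent, so they form exactly
one class. -/
theorem cls_eq_classOf_iff {a : Fin m → ℤ} (ha : S.Valid a) {w : List (Fin m)} :
    cls w = S.classOf a ↔ S.Full a w := by
  have h : S.Full a (Classical.epsilon (S.Full a)) := Classical.epsilon_spec (S.exists_full ha)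
  exact ⟨fun hw => (walk_iff_of_cls_eq hw).2 h, fun hw => hw.cls_eq S.step_pos h⟩

theorem full_add_iff {a : Fin m → ℤ} (K : ℤ) {w : List (Fin m)} :
    S.Full (fun i => a i + K) w ↔ S.Full a w := by
  have h : S.bar (fun i => a i + K) = fun i => S.bar a i + K := by
    ext i
    simp only [bar]
    ring
  rw [Full, h, walk_add_iff, Full]

theorem classOf_add {a : Fin m → ℤ} (ha : S.Valid a) (K : ℤ) :
    S.classOf (fun i => a i + K) = S.classOf a := by
  obtain ⟨w, hw⟩ := S.exists_full ha
  rw [← (S.cls_eq_classOf_iff ha).2 hw,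
    (S.cls_eq_classOf_iff (S.valid_add K ha)).2 ((S.full_add_iff K).2 hw)]

/-- The reflection functor on heights: firing `i` at `a` corresponds to firing `i^*` at `bar a`, so
both ends of the walk move together. -/
theorem full_cons_iff {a : Fin m → ℤ} {i : Fin m} {w : List (Fin m)} (hi : Fires a i) :
    S.Full a (i :: w) ↔ S.Full (bump S.step a i) (w ++ [i.rev]) := by
  have hb : bump S.step (S.bar a) i.rev = S.bar (bump S.step a i) := by
    rw [bump_bar, Fin.rev_rev]
  constructor
  · intro h
    refine Walk.append h.2 ⟨?_, hb⟩
    rw [fires_bar_iff, Fin.rev_rev]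
    exact hi
  · intro h
    obtain ⟨b, hb1, -, hb2⟩ := walk_append.1 h
    rw [walk_nil, ← hb] at hb2
    refine ⟨hi, ?_⟩
    convert hb1
    ext j
    have := congrFun hb2 j
    simp only [bump_apply] at this
    omega

/-- A letter is a sink of the class of `a` if and only if it can be fired at `a`. -/
theorem isSink_classOf_iff {a : Fin m → ℤ} (ha : S.Valid a) (i : Fin m) :
    IsSink (S.classOf a) i ↔ Fires a i := by
  constructor
  · rintro ⟨w, hw⟩
    exact ((S.cls_eq_classOf_iff ha).1 hw.symm).1
  · intro hi
    obtain ⟨w, hw⟩ := S.exists_walk (S.valid_bump ha hi) (S.valid_bar ha) fun j => by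
      obtain ⟨k, hk0, hk⟩ := S.exists_period ha j
      by_cases hj : j = i
      · subst hj
        obtain ⟨k, rfl⟩ := Nat.exists_eq_succ_of_ne_zero hk0.ne'
        refine ⟨k, hk.trans ?_⟩
        rw [bump_self]
        push_cast
        ring
      · exact ⟨k, by rw [bump_of_ne hj]; exact hk⟩
    exact ⟨w, ((S.cls_eq_classOf_iff ha).2 (walk_cons.2 ⟨hi, hw⟩)).symm⟩

/-- A word of the class of `a` that ends with `i` arises by a reflection functor. -/
theorem exists_bump_of_full_append {a : Fin m → ℤ} (ha : S.Valid a) {i : Fin m}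
    {w : List (Fin m)} (h : S.Full a (w ++ [i])) :
    ∃ b, S.Valid b ∧ Fires b i.rev ∧ bump S.step b i.rev = a ∧ S.Full b (i.rev :: w) := by
  obtain ⟨e, he, hi, hb⟩ := walk_append.1 h
  rw [walk_nil] at hb
  -- `bar` is invertible. The function sought is the preimage of `e`, the height function just
  -- before the last letter.
  have hbe : S.bar (fun j => e j.rev + -S.period) = e := by
    ext j
    simp [bar]
  have hve : S.Valid (fun j => e j.rev + -S.period) :=
    S.valid_add _ (S.valid_rev (S.valid_of_walk ha he))
  have hfire : Fires (fun j => e j.rev + -S.period) i.rev := by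
    rw [← S.fires_bar_iff, hbe]
    exact hi
  have hba : bump S.step (fun j => e j.rev + -S.period) i.rev = a := by
    have h1 : S.bar (bump S.step (fun j => e j.rev + -S.period) i.rev) = S.bar a := by
      rw [← bump_bar, hbe, hb]
    ext j
    have h2 := congrFun h1 j.rev
    simp only [bar, Fin.rev_rev] at h2
    omega
  refine ⟨_, hve, hfire, hba, (S.full_cons_iff hfire).2 ?_⟩
  rw [Fin.rev_rev, hba]
  exact h

theorem isSource_classOf_iff {a : Fin m → ℤ} (ha : S.Valid a) (i : Fin m) :
    IsSource (S.classOf a) i ↔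
      ∃ b, S.Valid b ∧ Fires b i.rev ∧ bump S.step b i.rev = a := by
  constructor
  · rintro ⟨w, hw⟩
    obtain ⟨b, hb, hi, hba, -⟩ :=
      S.exists_bump_of_full_append ha ((S.cls_eq_classOf_iff ha).1 hw.symm)
    exact ⟨b, hb, hi, hba⟩
  · rintro ⟨b, hb, hi, rfl⟩
    obtain ⟨w, hw⟩ := (S.isSink_classOf_iff hb i.rev).2 hi
    refine ⟨w, ((S.cls_eq_classOf_iff ha).2 ?_).symm⟩
    have := (S.full_cons_iff hi).1 ((S.cls_eq_classOf_iff hb).1 hw.symm)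
    rwa [Fin.rev_rev] at this

theorem rightReflection_bump {a : Fin m → ℤ} (ha : S.Valid a) {i : Fin m} (hi : Fires a i) :
    RightReflection i (S.classOf a) (S.classOf (bump S.step a i)) := by
  obtain ⟨w, hw⟩ := (S.isSink_classOf_iff ha i).2 hi
  refine Or.inl ⟨w, hw, ((S.cls_eq_classOf_iff (S.valid_bump ha hi)).2 ?_).symm⟩
  exact (S.full_cons_iff hi).1 ((S.cls_eq_classOf_iff ha).1 hw.symm)

theorem reflEquiv_of_walk {a c : Fin m → ℤ} {w : List (Fin m)} (ha : S.Valid a)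
    (h : Walk S.step a w c) : ReflEquiv (S.classOf a) (S.classOf c) := by
  induction w generalizing a with
  | nil => rw [walk_nil] at h; subst h; exact Relation.ReflTransGen.refl
  | cons i w ih =>
    exact Relation.ReflTransGen.head ⟨i, Or.inl (S.rightReflection_bump ha h.1)⟩
      (ih (S.valid_bump ha h.1) h.2)

/-- A suitable constant makes `c` reachable from `a` by firing, and constants do not change the
class. -/
theorem reflEquiv {a c : Fin m → ℤ} (ha : S.Valid a) (hc : S.Valid c) :
    ReflEquiv (S.classOf a) (S.classOf c) := by
  obtain ⟨K, hK⟩ := S.exists_shift ha hc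
  obtain ⟨w, hw⟩ := S.exists_walk ha (S.valid_add K hc) hK
  rw [← S.classOf_add hc K]
  exact S.reflEquiv_of_walk ha hw

/-- The cluster point of the class of a height function consists of the classes of all height
functions. -/
theorem rCluster_classOf {a : Fin m → ℤ} (ha : S.Valid a) :
    rCluster (S.classOf a) = {c | ∃ b, S.Valid b ∧ c = S.classOf b} := by
  ext c
  constructor
  · intro h
    induction h with
    | refl => exact ⟨a, ha, rfl⟩
    | tail _ hstep ih =>
      obtain ⟨b, hb, rfl⟩ := ih
      obtain ⟨i, (⟨w, hw, rfl⟩ | ⟨-, rfl⟩) | (⟨w, hw, rfl⟩ | ⟨-, rfl⟩)⟩ := hstep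
      · have hf := (S.cls_eq_classOf_iff hb).1 hw.symm
        exact ⟨_, S.valid_bump hb hf.1,
          (S.cls_eq_classOf_iff (S.valid_bump hb hf.1)).2 ((S.full_cons_iff hf.1).1 hf)⟩
      · exact ⟨b, hb, rfl⟩
      · obtain ⟨e, he, -, -, hf⟩ :=
          S.exists_bump_of_full_append hb ((S.cls_eq_classOf_iff hb).1 hw.symm)
        exact ⟨e, he, (S.cls_eq_classOf_iff he).2 hf⟩
      · exact ⟨b, hb, rfl⟩
  · rintro ⟨b, hb, rfl⟩
    exact S.reflEquiv ha hb

/-- If some full word is a word of the longest element, so are all. -/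
theorem isLongWord_of_full {a c : Fin m → ℤ} (ha : S.Valid a) (hc : S.Valid c)
    {w v : List (Fin m)} (hw : S.Full a w) (hl : IsLongWord w) (hv : S.Full c v) :
    IsLongWord v :=
  (S.reflEquiv ha hc).isLongWord
    (fun _ hu => hl.of_cls_eq (((S.cls_eq_classOf_iff ha).2 hw).trans hu.symm)) v
    ((S.cls_eq_classOf_iff hc).2 hv)

/-- An odd number of reversals is a single reversal, and the total rise `N * K` is the period; hence
the end is `bar a`. -/
theorem full_revPower {a : Fin m → ℤ} {K : ℤ} {N : ℕ} (hN : Odd N) (hK : N * K = S.period)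
    {u : List (Fin m)} (h : Walk S.step a u fun j => a j.rev + K) :
    S.Full a (revPower N u) := by
  have h1 := h.revPower S.step_rev N
  have h2 : (Fin.rev^[N] : Fin m → Fin m) = Fin.rev :=
    Function.Involutive.iterate_odd Fin.rev_involutive hN
  rwa [h2, hK] at h1

end FiringSystem

/-! ### The height functions of Dynkin quivers -/

section AdaptedSystem

variable {m : ℕ}

/-- The heights of adjacent letters differ by `2`. -/
def IsHeight (a : Fin m → ℤ) : Prop := ∀ i j, Adjacent i j → a i = a j + 2 ∨ a j = a i + 2

theorem IsHeight.of_succ {a : Fin m → ℤ}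
    (h : ∀ i j : Fin m, i.val + 1 = j.val → a i = a j + 2 ∨ a j = a i + 2) : IsHeight a := by
  rintro i j (hij | hij)
  · exact h i j hij
  · exact (h j i hij).symm

theorem IsHeight.sub {a : Fin m → ℤ} (ha : IsHeight a) (k : ℕ) (i j : Fin m)
    (h : i.val + k = j.val) : a i - a j ≤ 2 * k ∧ a j - a i ≤ 2 * k ∧ 4 ∣ a j - a i - 2 * k := by
  induction k generalizing j with
  | zero =>
    have : i = j := Fin.ext h
    subst this
    simp
  | succ k ih =>
    have h1 := ih ⟨j.val - 1, by omega⟩ (by simp; omega)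
    have h2 := ha ⟨j.val - 1, by omega⟩ j (Or.inl (by simp; omega))
    push_cast
    omega

theorem IsHeight.dvd_sub {a c : Fin m → ℤ} (ha : IsHeight a) (hc : IsHeight c) (i j : Fin m) :
    4 ∣ (c i - a i) - (c j - a j) := by
  rcases le_total i.val j.val with h | h
  · have h1 := (ha.sub (j.val - i.val) i j (by omega)).2.2
    have h2 := (hc.sub (j.val - i.val) i j (by omega)).2.2
    omega
  · have h1 := (ha.sub (i.val - j.val) j i (by omega)).2.2
    have h2 := (hc.sub (i.val - j.val) j i (by omega)).2.2
    omega

/-- The heights of `i` and `i^∨` differ by at most `2(m-1)`, so twice the Coxeter number `m+1`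
leaves room for at least one step of 4. The congruence modulo 4 holds because every slope is 2
modulo 4. -/
theorem IsHeight.exists_period {a : Fin m → ℤ} (ha : IsHeight a) (i : Fin m) :
    ∃ k : ℕ, 0 < k ∧ a i.rev + 2 * (m + 1) = a i + k * 4 := by
  have h : 4 ≤ a i.rev + 2 * (m + 1) - a i ∧ 4 ∣ a i.rev + 2 * (m + 1) - a i := by
    have hi := i.isLt
    rcases le_total i.val i.rev.val with h | h
    · have h1 := ha.sub (i.rev.val - i.val) i i.rev (by omega)
      rw [Fin.val_rev] at h1 h
      omega
    · have h1 := ha.sub (i.val - i.rev.val) i.rev i (by omega)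
      rw [Fin.val_rev] at h1 h
      omega
  obtain ⟨h1, k, hk⟩ := h
  exact ⟨k.toNat, by omega, by omega⟩

theorem exists_shift_of_dvd {a c d : Fin m → ℤ} (hd : ∀ i, 0 < d i ∧ d i ∣ 4) (r : ℤ)
    (h : ∀ i, d i ∣ c i + r - a i) : ∃ K : ℤ, ∀ i, ∃ k : ℕ, c i + K = a i + k * d i := by
  -- The constant `r` produces the divisibility. The multiple of 4 preserves it, as every step
  -- divides 4, and is large enough to make all differences nonnegative.
  refine ⟨r + 4 * ∑ j, |c j + r - a j|, fun i => ?_⟩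
  obtain ⟨hpos, hdvd⟩ := hd i
  have h1 : |c i + r - a i| ≤ ∑ j, |c j + r - a j| :=
    Finset.single_le_sum (f := fun j => |c j + r - a j|) (fun j _ => abs_nonneg _)
      (Finset.mem_univ i)
  obtain ⟨k, hk⟩ : d i ∣ (c i + r - a i) + 4 * ∑ j, |c j + r - a j| :=
    dvd_add (h i) (hdvd.mul_right _)
  have h2 := neg_abs_le (c i + r - a i)
  have h3 : 0 ≤ k := by
    by_contra hneg
    have : d i * k < 0 := mul_neg_of_pos_of_neg hpos (not_le.1 hneg)
    have := abs_nonneg (c i + r - a i)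
    omega
  refine ⟨k.toNat, ?_⟩
  rw [Int.toNat_of_nonneg h3, mul_comm k]
  omega

theorem IsHeight.add {a : Fin m → ℤ} (ha : IsHeight a) (K : ℤ) : IsHeight fun i => a i + K := by
  intro i j hij
  have := ha i j hij
  simp only
  omega

theorem IsHeight.rev {a : Fin m → ℤ} (ha : IsHeight a) : IsHeight fun i => a i.rev :=
  fun i j hij => ha i.rev j.rev (adjacent_rev.2 hij)

theorem IsHeight.bump {a : Fin m → ℤ} (ha : IsHeight a) {i : Fin m} (hi : Fires a i) :
    IsHeight (bump (fun _ => 4) a i) := by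
  intro j k hjk
  have h1 := ha j k hjk
  simp only [bump_apply]
  by_cases hj : j = i
  · subst hj
    have h2 := hi k hjk
    simp only [if_true, hjk.ne.symm, if_false]
    omega
  · by_cases hk : k = i
    · subst hk
      have h2 := hi j hjk.symm
      simp only [if_true, hjk.ne, if_false]
      omega
    · simp only [hj, hk, if_false]
      omega

/-- The firing system of the adapted words of type `A_m`. -/
def adaptedSystem (m : ℕ) : FiringSystem m where
  -- The usual heights, with slopes 1 and step 2, are doubled to leave odd values free for the
  -- middle letter of type `A_{2n+1}`.
  step _ := 4
  Valid := IsHeight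
  period := 2 * (m + 1)
  step_pos _ := by norm_num
  step_rev _ := rfl
  valid_bump ha hi := ha.bump hi
  valid_add K ha := ha.add K
  valid_rev ha := ha.rev
  ne_of_adjacent ha h := by
    have := ha _ _ h
    omega
  lt_of_adjacent ha hc h := by
    have := ha _ _ h
    have := hc _ _ h
    omega
  exists_shift {a c} ha hc := by
    rcases m with _ | m
    · exact ⟨0, fun i => i.elim0⟩
    · refine exists_shift_of_dvd (fun _ => by norm_num) (a 0 - c 0) fun i => ?_
      have := ha.dvd_sub hc i 0
      omega
  exists_period := IsHeight.exists_period

/-- The difference `c - a` is a multiple of 4 and changes by at most 4 along an edge, so it cannot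
pass from positive to negative: one of the two functions is the minimum at both ends. -/
theorem IsHeight.min {a c : Fin m → ℤ} (ha : IsHeight a) (hc : IsHeight c)
    (h : ∀ i, 4 ∣ c i - a i) : IsHeight fun i => min (a i) (c i) := by
  intro i j hij
  have h1 := ha i j hij
  have h2 := hc i j hij
  have h3 := h i
  have h4 := h j
  simp only
  omega

end AdaptedSystem

namespace DynkinQuiver

variable {m : ℕ}

/-- `a` is a height function of `Q`: arrows go down. -/
structure HasHeight (Q : DynkinQuiver m) (a : Fin m → ℤ) : Prop where
  isHeight : IsHeight a
  arrow_iff : ∀ i j, Q.arrow i j ↔ Adjacent i j ∧ a j < a i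

theorem ext' {Q Q' : DynkinQuiver m} (h : ∀ i j, Q.arrow i j ↔ Q'.arrow i j) : Q = Q' := by
  have h' : Q.arrow = Q'.arrow := by
    ext i j
    exact h i j
  cases Q
  cases Q'
  cases h'
  rfl

theorem exists_hasHeight (Q : DynkinQuiver m) : ∃ a, Q.HasHeight a := by
  classical
  -- Partial sums of the slopes. The default 0 is never reached, since `k + 1 ≤ i < m`.
  let a : Fin m → ℤ := fun i => ∑ k ∈ Finset.range i.val,
    if h : k + 1 < m then (if Q.arrow ⟨k + 1, h⟩ ⟨k, by omega⟩ then 2 else -2) else 0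
  have ha : ∀ i j : Fin m, i.val + 1 = j.val → a j = a i + if Q.arrow j i then 2 else -2 := by
    intro i j hij
    obtain ⟨j, hj⟩ := j
    obtain ⟨i, hi⟩ := i
    simp only at hij
    subst hij
    simp only [a]
    rw [Finset.sum_range_succ, dif_pos hj]
  refine ⟨a, IsHeight.of_succ fun i j hij => ?_, fun i j => ?_⟩
  · have := ha i j hij
    split_ifs at this <;> omega
  · have h1 := Q.adjacent_iff i j
    have h2 := Q.asymm i j
    have h3 := Q.asymm j i
    constructor
    · intro h
      have hij := h1.2 (Or.inl h)
      refine ⟨hij, ?_⟩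
      rcases hij with hij | hij
      · have := ha i j hij
        simp only [h2 h, if_false] at this
        omega
      · have := ha j i hij
        simp only [h, if_true] at this
        omega
    · rintro ⟨hij, hlt⟩
      by_contra hn
      have h4 := (h1.1 hij).resolve_left hn
      rcases hij with hij | hij
      · have := ha i j hij
        simp only [h4, if_true] at this
        omega
      · have := ha j i hij
        simp only [hn, if_false] at this
        omega

/-- The quiver of a height function. -/
def ofHeight (a : Fin m → ℤ) (ha : IsHeight a) : DynkinQuiver m where
  arrow i j := Adjacent i j ∧ a j < a i
  adjacent_iff i j := by
    constructor
    · intro h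
      have := ha i j h
      rcases this with h1 | h1
      · exact Or.inl ⟨h, by omega⟩
      · exact Or.inr ⟨h.symm, by omega⟩
    · rintro (h | h)
      · exact h.1
      · exact h.1.symm
  asymm i j h h' := lt_asymm h.2 h'.2

theorem ofHeight_hasHeight (a : Fin m → ℤ) (ha : IsHeight a) : (ofHeight a ha).HasHeight a :=
  ⟨ha, fun _ _ => Iff.rfl⟩

theorem HasHeight.unique {Q : DynkinQuiver m} {a b : Fin m → ℤ} (ha : Q.HasHeight a)
    (hb : Q.HasHeight b) : ∃ K, b = fun i => a i + K := by
  rcases m with _ | m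
  · exact ⟨0, funext fun i => i.elim0⟩
  refine ⟨b 0 - a 0, funext fun ⟨k, hk⟩ => ?_⟩
  induction k with
  | zero => simp
  | succ k ih =>
    have h1 := ih (by omega)
    have hadj : Adjacent (⟨k, by omega⟩ : Fin (m + 1)) ⟨k + 1, hk⟩ := Or.inl rfl
    have h2 := ha.isHeight _ _ hadj
    have h3 := hb.isHeight _ _ hadj
    have h4 := (ha.arrow_iff _ _).symm.trans (hb.arrow_iff ⟨k, by omega⟩ ⟨k + 1, hk⟩)
    simp only [hadj, true_and] at h4
    omega

theorem HasHeight.sink_iff {Q : DynkinQuiver m} {a : Fin m → ℤ} (h : Q.HasHeight a) (i : Fin m) :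
    Q.Sink i ↔ Fires a i := by
  refine forall_congr' fun j => ?_
  rw [h.arrow_iff]
  constructor
  · intro h1 hij
    have := h.isHeight i j hij
    have h2 : ¬ a j < a i := fun h3 => h1 ⟨hij, h3⟩
    omega
  · rintro h1 ⟨h2, h3⟩
    exact lt_asymm h3 (h1 h2)

/-- A sink lies 2 below each neighbour and, after a step of 4, lies 2 above: all its arrows are
reversed. -/
theorem HasHeight.reflect {Q : DynkinQuiver m} {a : Fin m → ℤ} (h : Q.HasHeight a) {i : Fin m}
    (hi : Fires a i) : (Q.reflect i).HasHeight (bump (fun _ => 4) a i) := by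
  refine ⟨h.isHeight.bump hi, fun j k => ?_⟩
  change ((j = i ∨ k = i) ∧ Q.arrow k j) ∨ (¬ (j = i ∨ k = i) ∧ Q.arrow j k) ↔ _
  rw [h.arrow_iff, h.arrow_iff, adjacent_comm (i := k)]
  by_cases hjk : Adjacent j k
  · have h1 := h.isHeight j k hjk
    simp only [hjk, true_and, bump_apply]
    by_cases hj : j = i
    · subst hj
      have h2 := hi k hjk
      simp only [hjk.ne.symm, if_true, if_false, true_and, not_true, false_and, or_false]
      omega
    · by_cases hk : k = i
      · subst hk
        have h2 := hi j hjk.symm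
        simp only [or_true, hjk.ne, if_true, if_false, true_and, not_true, false_and, or_false]
        omega
      · simp [hj, hk]
  · simp [hjk]

theorem HasHeight.adapted_iff {Q : DynkinQuiver m} {a : Fin m → ℤ} (h : Q.HasHeight a)
    {w : List (Fin m)} : Q.Adapted w ↔ ∃ c, Walk (fun _ => 4) a w c := by
  induction w generalizing Q a with
  | nil => simp [Adapted]
  | cons i w ih =>
    simp only [Adapted, walk_cons, exists_and_left, h.sink_iff]
    exact and_congr_right fun hi => ih (h.reflect hi)

/-- A word determines the orientation of the edges at its letters in quivers to which it is
adapted. -/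
theorem Adapted.arrow_iff {Q Q' : DynkinQuiver m} {w : List (Fin m)} (h : Q.Adapted w)
    (h' : Q'.Adapted w) {i j : Fin m} (hij : Adjacent i j) (hi : i ∈ w) :
    Q.arrow i j ↔ Q'.arrow i j := by
  -- The edge is untouched until `i` or `j` first occurs in the word, and that letter is then a sink
  -- in both quivers.
  induction w generalizing Q Q' with
  | nil => simp at hi
  | cons k w ih =>
    by_cases hik : i = k
    · subst hik
      exact iff_of_false (h.1 j) (h'.1 j)
    by_cases hjk : j = k
    · subst hjk
      exact iff_of_true (((Q.adjacent_iff i j).1 hij).resolve_right (h.1 i))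
        (((Q'.adjacent_iff i j).1 hij).resolve_right (h'.1 i))
    · have h1 := ih h.2 h'.2 ((List.mem_cons.1 hi).resolve_left hik)
      have h2 : ∀ Q'' : DynkinQuiver m, (Q''.reflect k).arrow i j ↔ Q''.arrow i j := by
        intro Q''
        change ((i = k ∨ j = k) ∧ _) ∨ (¬ (i = k ∨ j = k) ∧ _) ↔ _
        simp [hik, hjk]
      rwa [h2, h2] at h1

end DynkinQuiver

theorem FiringSystem.Full.mem {m : ℕ} {S : FiringSystem m} {a : Fin m → ℤ} {w : List (Fin m)}
    (ha : S.Valid a) (h : S.Full a w) (i : Fin m) : i ∈ w := by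
  obtain ⟨k, hk0, hk⟩ := S.exists_period ha i
  have h1 := Walk.eq_add_count h i
  have h2 := S.step_pos i
  by_contra hi
  rw [List.count_eq_zero_of_not_mem hi] at h1
  simp only [FiringSystem.bar] at h1
  have : (0 : ℤ) < k * S.step i := by positivity
  simp at h1
  omega

/-! ### A product of half Coxeter words -/

section HalfCoxeter

/-- The word `1 2 ⋯ k`. -/
def initialSegment {m : ℕ} (k : ℕ) (h : k ≤ m) : List (Fin m) :=
  (List.finRange k).map (Fin.castLE h)

variable {m : ℕ}

theorem mem_initialSegment {k : ℕ} {h : k ≤ m} {i : Fin m} :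
    i ∈ initialSegment k h ↔ i.val < k := by
  simp only [initialSegment, List.mem_map, List.mem_finRange, true_and]
  constructor
  · rintro ⟨j, rfl⟩; simp
  · exact fun hi => ⟨⟨i.val, hi⟩, rfl⟩

theorem pairwise_initialSegment {k : ℕ} {h : k ≤ m} :
    (initialSegment k h).Pairwise (· < ·) := by
  rw [initialSegment, List.pairwise_map]
  exact (List.pairwise_lt_finRange k).imp id

theorem nodup_initialSegment {k : ℕ} {h : k ≤ m} : (initialSegment k h).Nodup :=
  pairwise_initialSegment.imp ne_of_lt

theorem pair_sublist_initialSegment {k : ℕ} {h : k ≤ m} {i j : Fin m} (hj : j.val < k) :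
    [i, j].Sublist (initialSegment k h) ↔ i < j := by
  constructor
  · intro hs
    simpa using pairwise_initialSegment.sublist hs
  · intro hij
    have hij' : i.val < j.val := hij
    refine (pair_sublist_total hij.ne (mem_initialSegment.2 (by omega))
      (mem_initialSegment.2 hj)).resolve_right fun hs => ?_
    have h1 : j < i := by simpa using pairwise_initialSegment.sublist hs
    exact lt_asymm hij h1

theorem initialSegment_succ {k : ℕ} (h : k + 1 ≤ m) :
    initialSegment (k + 1) h = initialSegment k (by omega) ++ [⟨k, h⟩] := by
  simp only [initialSegment, List.finRange_succ_last, List.map_append, List.map_map,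
    List.map_cons, List.map_nil]
  rfl

theorem wordProd_initialSegment {k : ℕ} (h : k ≤ m) (x : Fin (m + 1)) :
    (wordProd (initialSegment k h) x).val =
      if x.val < k then x.val + 1 else if x.val = k then 0 else x.val := by
  induction k generalizing x with
  | zero =>
    simp only [initialSegment, List.finRange_zero, List.map_nil, wordProd_nil,
      Equiv.Perm.one_apply]
    split_ifs <;> omega
  | succ k ih =>
    rw [initialSegment_succ, wordProd_append, Equiv.Perm.mul_apply, ih]
    simp only [wordProd_cons, wordProd_nil, mul_one, simple, Equiv.swap_apply_def]
    simp only [Fin.ext_iff, Fin.val_castSucc, Fin.val_succ]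
    split_ifs <;> simp_all <;> omega

theorem wordProd_map_rev_iterate (u : List (Fin m)) (k : ℕ) :
    wordProd (u.map (Fin.rev^[k])) = longest m ^ k * wordProd u * (longest m ^ k)⁻¹ := by
  have h1 : ∀ v : List (Fin m), wordProd (v.map Fin.rev) =
      longest m * wordProd v * (longest m)⁻¹ := by
    intro v
    induction v with
    | nil => simp
    | cons i v ih =>
      rw [List.map_cons, wordProd_cons, wordProd_cons, ih, ← longest_mul_simple_mul_longest]
      group
  induction k with
  | zero => simp
  | succ k ih =>
    rw [Function.iterate_succ', ← List.map_map, h1, ih, pow_succ']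
    group

/-- Consecutive factors are conjugates by successive powers of `w₀`, so the product telescopes. -/
theorem wordProd_revPower (u : List (Fin m)) (N : ℕ) :
    wordProd (revPower N u) = (wordProd u * longest m) ^ N * (longest m ^ N)⁻¹ := by
  induction N with
  | zero => simp [revPower]
  | succ N ih =>
    rw [revPower_succ, wordProd_append, ih, wordProd_map_rev_iterate, pow_succ, pow_succ]
    group

theorem longest_mul_self : longest m * longest m = 1 := by
  ext x
  simp [longest]

/-- The permutation is the cycle `0 → m → 1 → m-1 → 2 → ⋯ → n → 0` of length `2n+1`. For `k = n` it
contains every point; for `k = n+1` the point `n+1` remains and is fixed. -/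
theorem wordProd_initialSegment_mul_longest_pow {n k : ℕ} (h : k ≤ m) (hk : k + n = m)
    (hn : k = n ∨ k = n + 1) :
    (wordProd (initialSegment k h) * longest m) ^ (2 * n + 1) = 1 := by
  set f := wordProd (initialSegment k h) * longest m with hf
  have hfx : ∀ x, (f x).val =
      if x.val < n then m - x.val else if x.val = n then 0 else m + 1 - x.val := by
    intro x
    have hx := x.isLt
    rw [hf, Equiv.Perm.mul_apply, wordProd_initialSegment]
    simp only [longest, Fin.revPerm_apply, Fin.val_rev]
    split_ifs <;> omega
  clear_value f
  have heven : ∀ j, j ≤ n → ((f ^ (2 * j)) 0).val = j := by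
    intro j
    induction j with
    | zero => simp
    | succ j ih =>
      intro hj
      have h1 := ih (by omega)
      rw [show 2 * (j + 1) = 2 * j + 1 + 1 by ring, pow_succ', pow_succ',
        Equiv.Perm.mul_apply, Equiv.Perm.mul_apply, hfx, hfx, h1]
      split_ifs <;> omega
  have hzero : (f ^ (2 * n + 1)) 0 = 0 := by
    apply Fin.ext
    rw [pow_succ', Equiv.Perm.mul_apply, hfx, heven n le_rfl]
    simp
  -- The power commutes with `f`, so fixing 0 it fixes the whole orbit of 0.
  have horbit : ∀ j, (f ^ (2 * n + 1)) ((f ^ j) 0) = (f ^ j) 0 := by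
    intro j
    rw [← Equiv.Perm.mul_apply, (Commute.pow_pow_self f _ _).eq, Equiv.Perm.mul_apply, hzero]
  ext x
  rw [Equiv.Perm.one_apply]
  have hx := x.isLt
  rcases le_or_gt x.val n with h1 | h1
  · have h2 : (f ^ (2 * x.val)) 0 = x := Fin.ext (heven x h1)
    rw [← h2, horbit]
  · rcases le_or_gt x.val k with h3 | h3
    · have h4 : f x = x := by
        apply Fin.ext
        rw [hfx]
        split_ifs <;> omega
      exact congrArg Fin.val (Function.IsFixedPt.perm_pow h4 _)
    · have h2 : (f ^ (2 * (m - x.val) + 1)) 0 = x := by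
        apply Fin.ext
        rw [pow_succ', Equiv.Perm.mul_apply, hfx, heven _ (by omega)]
        split_ifs <;> omega
      rw [← h2, horbit]

theorem length_revPower (u : List (Fin m)) (N : ℕ) : (revPower N u).length = N * u.length := by
  simp [revPower]

theorem isLongWord_revPower_initialSegment {n k : ℕ} (h : k ≤ m) (hk : k + n = m)
    (hn : k = n ∨ k = n + 1) : IsLongWord (revPower (2 * n + 1) (initialSegment k h)) := by
  constructor
  · rw [wordProd_revPower, wordProd_initialSegment_mul_longest_pow h hk hn, pow_succ, pow_mul,
      pow_two, longest_mul_self, one_pow, one_mul, one_mul, inv_eq_iff_mul_eq_one,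
      longest_mul_self]
  · rw [length_revPower, initialSegment, List.length_map, List.length_finRange]
    rcases hn with rfl | rfl <;> subst hk <;> ring

end HalfCoxeter

/-! ### Adapted reduced words of the longest element of type `A_{2n}` -/

section AdaptedLongest

theorem exists_full_isLongWord (n : ℕ) :
    ∃ (a : Fin (2 * n) → ℤ) (w : List (Fin (2 * n))),
      IsHeight a ∧ (adaptedSystem (2 * n)).Full a w ∧ IsLongWord w := by
  -- A tent, chosen so that reversing it and adding 2 has the same effect as firing each of the
  -- first `n` letters once.
  let a : Fin (2 * n) → ℤ := fun i => if i.val < n then 2 * i else 2 * (2 * n - i)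
  have ha : IsHeight a := IsHeight.of_succ fun i j hij => by
    simp only [a]
    split_ifs <;> omega
  refine ⟨a, revPower (2 * n + 1) (initialSegment n (by omega)), ha, ?_,
    isLongWord_revPower_initialSegment _ (by omega) (Or.inl rfl)⟩
  refine FiringSystem.full_revPower _ (K := 2) (by simp) ?_ ?_
  · simp only [adaptedSystem]
    push_cast
    ring
  · have hfun : (fun j => a j.rev + 2) =
        fun j => a j + if j ∈ initialSegment n (by omega) then 4 else 0 := by
      ext j
      have := j.isLt
      simp only [a, mem_initialSegment, Fin.val_rev]
      split_ifs <;> omega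
    rw [hfun]
    refine walk_of_nodup (d := fun _ => 4) nodup_initialSegment fun i hi j hj => ?_
    rw [mem_initialSegment] at hi
    rw [pair_sublist_initialSegment hi, Fin.lt_def]
    simp only [a]
    rcases hj with hj | hj <;> split_ifs <;> omega

theorem isLongWord_of_adaptedSystem_full {n : ℕ} {a : Fin (2 * n) → ℤ} (ha : IsHeight a)
    {w : List (Fin (2 * n))} (hw : (adaptedSystem (2 * n)).Full a w) : IsLongWord w := by
  obtain ⟨c, v, hc, hv, hl⟩ := exists_full_isLongWord n
  exact (adaptedSystem (2 * n)).isLongWord_of_full hc ha hv hl hw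

/-- The reduced words of the longest element that can be fired from `a` are the full words. -/
theorem full_of_isReducedLongest {n : ℕ} {a c : Fin (2 * n) → ℤ} (ha : IsHeight a)
    {w : List (Fin (2 * n))} (hw : Walk (fun _ => 4) a w c) (hr : IsReducedLongest w) :
    (adaptedSystem (2 * n)).Full a w := by
  set S := adaptedSystem (2 * n)
  have hstep : ∀ i, S.step i = 4 := fun _ => rfl
  obtain ⟨v, hv⟩ := S.exists_full ha
  have hvl := isLongWord_of_adaptedSystem_full ha hv
  have hlen : w.length = v.length := le_antisymm
    (hr.1 v (hvl.1.trans hr.2.symm)) (hvl.isReducedLongest.1 w (hr.2.trans hvl.1.symm))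
  have hw' : Walk S.step a w c := hw
  have hc : IsHeight c := S.valid_of_walk ha hw'
  have hb : IsHeight (S.bar a) := S.valid_bar ha
  have hcw := fun i => hw'.eq_add_count i
  have hbv := fun i => Walk.eq_add_count hv i
  simp only [hstep] at hcw hbv
  have hdvd : ∀ i, 4 ∣ S.bar a i - c i := by
    intro i
    have h1 := hcw i
    have h2 := hbv i
    omega
  -- The meet of the ends of `w` and of a full word `v`. Both words factor through it, with common
  -- beginning `x` and remainders `y` and `z`.
  set e : Fin (2 * n) → ℤ := fun i => min (c i) (S.bar a i) with he
  have hev : S.Valid e := hc.min hb hdvd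
  obtain ⟨x, hx⟩ := S.exists_walk ha hev fun i => by
    refine ⟨min (w.count i) (v.count i), ?_⟩
    have h1 := hcw i
    have h2 := hbv i
    simp only [he, hstep]
    push_cast
    omega
  obtain ⟨y, hy⟩ := S.exists_walk hev hc fun i => by
    refine ⟨w.count i - v.count i, ?_⟩
    have h1 := hcw i
    have h2 := hbv i
    simp only [he, hstep]
    omega
  obtain ⟨z, hz⟩ := S.exists_walk hev hb fun i => by
    refine ⟨v.count i - w.count i, ?_⟩
    have h1 := hcw i
    have h2 := hbv i
    simp only [he, hstep]
    omega
  have hwxy : cls w = cls (x ++ y) := hw'.cls_eq S.step_pos (hx.append hy)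
  have hvxz : cls v = cls (x ++ z) := Walk.cls_eq S.step_pos hv (hx.append hz)
  have hprod : wordProd y = wordProd z := by
    have h1 := wordProd_eq_of_cls_eq hwxy
    have h2 := wordProd_eq_of_cls_eq hvxz
    rw [hr.2, wordProd_append] at h1
    rw [hvl.1, wordProd_append] at h2
    exact mul_left_cancel (h1.symm.trans h2)
  -- At each letter one of the two ends attains the minimum, and its remainder does not use the
  -- letter.
  have hdisj : ∀ j, j ∉ y ∨ j ∉ z := by
    intro j
    have h1 := hy.eq_add_count j
    have h2 := hz.eq_add_count j
    by_contra hcon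
    push Not at hcon
    have h3 := List.count_pos_iff.2 hcon.1
    have h4 := List.count_pos_iff.2 hcon.2
    simp only [he, hstep] at h1 h2
    omega
  have hone := wordProd_eq_one_of_disjoint hprod hdisj
  -- `y` represents the identity and is a suffix of a reduced word, hence is empty; `z` then is
  -- empty by comparison of lengths.
  have hy0 : y.length ≤ 0 := (hr.1.of_cls_eq hwxy).of_append_left [] (by simp [hone])
  have hz0 : z.length = 0 := by
    have h1 := (perm_of_cls_eq hwxy).length_eq
    have h2 := (perm_of_cls_eq hvxz).length_eq
    simp only [List.length_append] at h1 h2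
    omega
  have hyn := List.length_eq_zero_iff.1 (Nat.le_zero.1 hy0)
  have hzn := List.length_eq_zero_iff.1 hz0
  subst hyn hzn
  rw [walk_nil] at hy hz
  rw [← hy, hz] at hw'
  exact hw'

theorem DynkinQuiver.HasHeight.isAdaptedLongest_iff {n : ℕ} {Q : DynkinQuiver (2 * n)}
    {a : Fin (2 * n) → ℤ} (h : Q.HasHeight a) {w : List (Fin (2 * n))} :
    Q.IsAdaptedLongest w ↔ (adaptedSystem (2 * n)).Full a w := by
  constructor
  · rintro ⟨h1, h2⟩
    obtain ⟨c, hc⟩ := h.adapted_iff.1 h2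
    exact full_of_isReducedLongest h.isHeight hc h1
  · intro hw
    exact ⟨(isLongWord_of_adaptedSystem_full h.isHeight hw).isReducedLongest,
      h.adapted_iff.2 ⟨_, hw⟩⟩

theorem DynkinQuiver.HasHeight.isClassOf_iff {n : ℕ} {Q : DynkinQuiver (2 * n)}
    {a : Fin (2 * n) → ℤ} (h : Q.HasHeight a) {c : CommClass (2 * n)} :
    Q.IsClassOf c ↔ c = (adaptedSystem (2 * n)).classOf a := by
  constructor
  · rintro ⟨w, hw, rfl⟩
    exact ((adaptedSystem (2 * n)).cls_eq_classOf_iff h.isHeight).2 (h.isAdaptedLongest_iff.1 hw)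
  · rintro rfl
    obtain ⟨w, hw⟩ := (adaptedSystem (2 * n)).exists_full h.isHeight
    exact ⟨w, h.isAdaptedLongest_iff.2 hw,
      (((adaptedSystem (2 * n)).cls_eq_classOf_iff h.isHeight).2 hw).symm⟩

/-- A full word contains every letter, so it determines the direction of every arrow. -/
theorem DynkinQuiver.IsClassOf.unique {n : ℕ} {Q Q' : DynkinQuiver (2 * n)}
    {c : CommClass (2 * n)} (h : Q.IsClassOf c) (h' : Q'.IsClassOf c) : Q = Q' := by
  obtain ⟨a, ha⟩ := Q.exists_hasHeight
  obtain ⟨a', ha'⟩ := Q'.exists_hasHeight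
  obtain ⟨w, hw, rfl⟩ := h
  have hf := ha.isAdaptedLongest_iff.1 hw
  have hf' := ((adaptedSystem (2 * n)).cls_eq_classOf_iff ha'.isHeight).1 (ha'.isClassOf_iff.1 h')
  refine DynkinQuiver.ext' fun i j => ?_
  by_cases hij : Adjacent i j
  · exact hw.2.arrow_iff (ha'.adapted_iff.2 ⟨_, hf'⟩) hij (hf.mem ha.isHeight i)
  · have h1 : ∀ Q : DynkinQuiver (2 * n), ¬ Q.arrow i j :=
      fun Q h => hij ((Q.adjacent_iff i j).2 (Or.inl h))
    exact iff_of_false (h1 Q) (h1 Q')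

end AdaptedLongest

/-! ### The height functions of the twisted adapted cluster point -/

section Shift

variable {n : ℕ}

@[simp] theorem mid_val : (mid n).val = n := rfl

theorem ne_mid_iff {j : Fin (2 * n + 1)} : j ≠ mid n ↔ j.val ≠ n := by
  simp [Fin.ext_iff]

theorem mid_rev : (mid n).rev = mid n := by
  apply Fin.ext
  simp only [Fin.val_rev, mid_val]
  omega

theorem rev_eq_mid_iff {j : Fin (2 * n + 1)} : j.rev = mid n ↔ j = mid n := by
  rw [Fin.rev_eq_iff, mid_rev]

theorem rev_eq_self_iff {j : Fin (2 * n + 1)} : j.rev = j ↔ j = mid n := by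
  simp only [Fin.ext_iff, Fin.val_rev, mid_val]
  omega

theorem shift_val (i : Fin (2 * n)) :
    (shift i).val = if i.val < n then i.val else i.val + 1 := by
  unfold shift
  split_ifs <;> rfl

theorem shift_ne_mid (i : Fin (2 * n)) : shift i ≠ mid n := by
  rw [ne_mid_iff, shift_val]
  split_ifs <;> omega

theorem shift_injective : Function.Injective (shift (n := n)) := by
  intro i j h
  have h1 := congrArg Fin.val h
  rw [shift_val, shift_val] at h1
  apply Fin.ext
  split_ifs at h1 <;> omega

theorem shift_rev (i : Fin (2 * n)) : shift i.rev = (shift i).rev := by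
  apply Fin.ext
  rw [shift_val, Fin.val_rev, Fin.val_rev, shift_val]
  have := i.isLt
  split_ifs <;> omega

theorem exists_shift_eq {j : Fin (2 * n + 1)} (h : j ≠ mid n) : ∃ i, shift i = j := by
  rw [ne_mid_iff] at h
  have hj := j.isLt
  by_cases h1 : j.val < n
  · refine ⟨⟨j.val, by omega⟩, Fin.ext ?_⟩
    rw [shift_val]
    simp [h1]
  · refine ⟨⟨j.val - 1, by omega⟩, Fin.ext ?_⟩
    rw [shift_val]
    simp only
    split_ifs <;> omega

@[simp] theorem letterP_shift (i : Fin (2 * n)) : letterP (shift i) = some i := by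
  have h := shift_val i
  unfold letterP
  split_ifs at h ⊢ <;> first | omega | simp [h]

@[simp] theorem letterP_mid : letterP (mid n) = none := by simp [letterP]

@[simp] theorem wordP_nil : wordP ([] : List (Fin (2 * n + 1))) = [] := rfl

@[simp] theorem wordP_mid_cons (w : List (Fin (2 * n + 1))) : wordP (mid n :: w) = wordP w := by
  simp [wordP]

@[simp] theorem wordP_shift_cons (i : Fin (2 * n)) (w : List (Fin (2 * n + 1))) :
    wordP (shift i :: w) = i :: wordP w := by
  simp [wordP]

end Shift

/-! ### Heights and firing in type `A_{2n+1}`, and deletion of the middle letter -/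

section TwistedSystem

variable {n : ℕ}

/-- The height functions of the twisted adapted cluster point. -/
structure IsTwistedHeight (a : Fin (2 * n + 1) → ℤ) : Prop where
  outer : ∀ i j : Fin (2 * n + 1), i.val + 1 = j.val → i.val ≠ n → j.val ≠ n →
    a i = a j + 2 ∨ a j = a i + 2
  central : ∀ i j : Fin (2 * n + 1), i.val + 1 = n → j.val = n + 1 →
    a i = a j + 2 ∨ a j = a i + 2
  mid_eq : ∀ i j : Fin (2 * n + 1), i.val + 1 = n → j.val = n + 1 →
    a (mid n) = min (a i) (a j) + 1 ∨ a (mid n) = min (a i) (a j) - 1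

namespace IsTwistedHeight

variable {a c : Fin (2 * n + 1) → ℤ}

theorem isHeight (ha : IsTwistedHeight a) : IsHeight fun i : Fin (2 * n) => a (shift i) := by
  refine IsHeight.of_succ fun i j hij => ?_
  have hi := shift_val i
  have hj := shift_val j
  by_cases h : i.val + 1 = n
  · exact ha.central _ _ (by split_ifs at hi <;> omega) (by split_ifs at hj <;> omega)
  · apply ha.outer <;> split_ifs at hi hj <;> omega

theorem outer' (ha : IsTwistedHeight a) {i j : Fin (2 * n + 1)} (hij : Adjacent i j)
    (hi : i ≠ mid n) (hj : j ≠ mid n) : a i = a j + 2 ∨ a j = a i + 2 := by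
  rw [ne_mid_iff] at hi hj
  rcases hij with hij | hij
  · exact ha.outer i j hij hi hj
  · exact (ha.outer j i hij hj hi).symm

theorem adjacent_mid (ha : IsTwistedHeight a) {j : Fin (2 * n + 1)} (hj : Adjacent (mid n) j) :
    a j = a (mid n) + 1 ∨ a j = a (mid n) - 1 ∨ a j = a (mid n) + 3 := by
  rcases hj with hj | hj <;> simp only [mid_val] at hj
  · have h0 := j.isLt
    have h1 := ha.central ⟨n - 1, by omega⟩ j (by simp; omega) hj.symm
    have h2 := ha.mid_eq ⟨n - 1, by omega⟩ j (by simp; omega) hj.symm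
    omega
  · have h1 := ha.central j ⟨n + 1, by omega⟩ hj rfl
    have h2 := ha.mid_eq j ⟨n + 1, by omega⟩ hj rfl
    omega

theorem add (ha : IsTwistedHeight a) (K : ℤ) : IsTwistedHeight fun i => a i + K := by
  constructor
  · intro i j hij hi hj
    have := ha.outer i j hij hi hj
    omega
  · intro i j hi hj
    have := ha.central i j hi hj
    omega
  · intro i j hi hj
    have := ha.mid_eq i j hi hj
    omega

theorem rev (ha : IsTwistedHeight a) : IsTwistedHeight fun i => a i.rev := by
  constructor
  · intro i j hij hi hj
    have h1 := i.isLt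
    have h2 := j.isLt
    exact (ha.outer j.rev i.rev (by simp only [Fin.val_rev]; omega)
      (by simp only [Fin.val_rev]; omega) (by simp only [Fin.val_rev]; omega)).symm
  · intro i j hi hj
    exact (ha.central j.rev i.rev (by simp only [Fin.val_rev]; omega)
      (by simp only [Fin.val_rev]; omega)).symm
  · intro i j hi hj
    simp only [mid_rev]
    rw [min_comm]
    exact ha.mid_eq j.rev i.rev (by simp only [Fin.val_rev]; omega)
      (by simp only [Fin.val_rev]; omega)

end IsTwistedHeight

/-- The steps of the letters. -/
def twistedStep (j : Fin (2 * n + 1)) : ℤ := if j = mid n then 2 else 4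

@[simp] theorem twistedStep_mid : twistedStep (mid n) = 2 := if_pos rfl

theorem twistedStep_of_ne {j : Fin (2 * n + 1)} (h : j ≠ mid n) : twistedStep j = 4 := if_neg h

@[simp] theorem twistedStep_shift (i : Fin (2 * n)) : twistedStep (shift i) = 4 :=
  twistedStep_of_ne (shift_ne_mid i)

/-- Near the middle there are two moves. The middle letter can be fired only at offset -1, and its
step 2 leads to +1. A neighbour of it can be fired only if it is the lower one and the offset is +1;
the minimum then rises by 2 and the offset becomes -1. -/
theorem IsTwistedHeight.bump {a : Fin (2 * n + 1) → ℤ} (ha : IsTwistedHeight a)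
    {i : Fin (2 * n + 1)} (hi : Fires a i) : IsTwistedHeight (bump twistedStep a i) := by
  have hL : ∀ j k : Fin (2 * n + 1), j.val + 1 = n → k.val = n + 1 → i = j →
      a i < a (mid n) := by
    rintro j k hj hk rfl
    exact hi _ (Or.inl hj)
  have hR : ∀ j k : Fin (2 * n + 1), j.val + 1 = n → k.val = n + 1 → i = k →
      a i < a (mid n) := by
    rintro j k hj hk rfl
    exact hi _ (Or.inr hk.symm)
  constructor
  · intro j k hjk hj hk
    have h1 := ha.outer j k hjk hj hk
    have h2 : i = j → a i < a k := by rintro rfl; exact hi _ (Or.inl hjk)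
    have h3 : i = k → a i < a j := by rintro rfl; exact hi _ (Or.inr hjk)
    have h4 := twistedStep_of_ne (ne_mid_iff.2 hj)
    have h5 := twistedStep_of_ne (ne_mid_iff.2 hk)
    have hne : j ≠ k := by rintro rfl; omega
    simp only [bump_apply]
    by_cases hji : j = i
    · subst hji
      have := h2 rfl
      simp only [if_true, hne.symm, if_false]
      omega
    · by_cases hki : k = i
      · subst hki
        have := h3 rfl
        simp only [if_true, hne, if_false]
        omega
      · simp only [hji, hki, if_false]
        omega
  all_goals
    intro j k hj hk
    have h1 := ha.central j k hj hk
    have h2 := ha.mid_eq j k hj hk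
    have h3 := hL j k hj hk
    have h4 := hR j k hj hk
    have h5 : i = mid n → a i < a j ∧ a i < a k := by
      rintro rfl
      exact ⟨hi _ (Or.inr hj), hi _ (Or.inl hk.symm)⟩
    have hjm : j ≠ mid n := ne_mid_iff.2 (by omega)
    have hkm : k ≠ mid n := ne_mid_iff.2 (by omega)
    have hjk : j ≠ k := by rintro rfl; omega
    simp only [bump_apply]
    by_cases hji : j = i
    · subst hji
      have := h3 rfl
      simp only [if_true, hjk.symm, hjm.symm, if_false, twistedStep_of_ne hjm]
      omega
    · by_cases hki : k = i
      · subst hki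
        have := h4 rfl
        simp only [if_true, hjk, hkm.symm, if_false, twistedStep_of_ne hkm]
        omega
      · by_cases hmi : mid n = i
        · subst hmi
          have := h5 rfl
          simp only [if_true, hji, hki, if_false, twistedStep_mid]
          omega
        · simp only [hji, hki, hmi, if_false]
          omega

theorem IsTwistedHeight.exists_shift {a c : Fin (2 * n + 1) → ℤ} (hn : 1 ≤ n)
    (ha : IsTwistedHeight a) (hc : IsTwistedHeight c) :
    ∃ K : ℤ, ∀ i, ∃ k : ℕ, c i + K = a i + k * twistedStep i := by
  let i₀ : Fin (2 * n) := ⟨0, by omega⟩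
  refine exists_shift_of_dvd (fun i => ?_) (a (shift i₀) - c (shift i₀)) fun i => ?_
  · unfold twistedStep
    split_ifs <;> norm_num
  · by_cases hi : i = mid n
    · subst hi
      -- The middle step is 2, so only parity matters, and the middle height always has the parity
      -- opposite to that of its neighbours.
      let i₁ : Fin (2 * n) := ⟨n - 1, by omega⟩
      have h1 := ha.isHeight.dvd_sub hc.isHeight i₁ i₀
      have hadj : Adjacent (mid n) (shift i₁) := by
        right
        rw [shift_val]
        simp only [i₁, mid_val]
        split_ifs <;> omega
      have h2 := ha.adjacent_mid hadj
      have h3 := hc.adjacent_mid hadj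
      rw [twistedStep_mid]
      omega
    · obtain ⟨i, rfl⟩ := exists_shift_eq hi
      have h1 := ha.isHeight.dvd_sub hc.isHeight i i₀
      rw [twistedStep_shift]
      omega

theorem IsTwistedHeight.exists_period {a : Fin (2 * n + 1) → ℤ}
    (ha : IsTwistedHeight a) (i : Fin (2 * n + 1)) :
    ∃ k : ℕ, 0 < k ∧ a i.rev + 2 * (2 * n + 1) = a i + k * twistedStep i := by
  by_cases hi : i = mid n
  · subst hi
    refine ⟨2 * n + 1, by omega, ?_⟩
    rw [mid_rev, twistedStep_mid]
    push_cast
    ring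
  · obtain ⟨i, rfl⟩ := exists_shift_eq hi
    obtain ⟨k, hk, h⟩ := ha.isHeight.exists_period i
    refine ⟨k, hk, ?_⟩
    rw [twistedStep_shift, ← h, shift_rev]
    push_cast
    ring

/-- The firing system of the twisted adapted cluster point. -/
def twistedSystem (n : ℕ) (hn : 1 ≤ n) : FiringSystem (2 * n + 1) where
  step := twistedStep
  Valid := IsTwistedHeight
  period := 2 * (2 * n + 1)
  step_pos i := by
    unfold twistedStep
    split_ifs <;> norm_num
  step_rev i := by
    simp only [twistedStep, rev_eq_mid_iff]
  valid_bump ha hi := ha.bump hi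
  valid_add K ha := ha.add K
  valid_rev ha := ha.rev
  ne_of_adjacent {a i j} ha h := by
    by_cases hi : i = mid n
    · subst hi
      have := ha.adjacent_mid h
      omega
    · by_cases hj : j = mid n
      · subst hj
        have := ha.adjacent_mid h.symm
        omega
      · have := ha.outer' h hi hj
        omega
  lt_of_adjacent {a c i j} ha hc h := by
    by_cases hi : i = mid n
    · subst hi
      have := ha.adjacent_mid h
      have := hc.adjacent_mid h
      rw [twistedStep_mid]
      omega
    · rw [twistedStep_of_ne hi]
      by_cases hj : j = mid n
      · subst hj
        have := ha.adjacent_mid h.symm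
        have := hc.adjacent_mid h.symm
        omega
      · have := ha.outer' h hi hj
        have := hc.outer' h hi hj
        omega
  exists_shift ha hc := IsTwistedHeight.exists_shift hn ha hc
  exists_period ha := IsTwistedHeight.exists_period ha

/-- Firing and deletion of the letter `n + 1`. -/
theorem Walk.wordP {a c : Fin (2 * n + 1) → ℤ} {w : List (Fin (2 * n + 1))}
    (ha : IsTwistedHeight a) (h : Walk twistedStep a w c) :
    Walk (fun _ => 4) (fun i => a (shift i)) (wordP w) (fun i => c (shift i)) := by
  induction w generalizing a with
  | nil => rw [walk_nil] at h; simp [h]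
  | cons k w ih =>
    have h1 := ih (ha.bump h.1) h.2
    by_cases hk : k = mid n
    · subst hk
      rw [wordP_mid_cons]
      simpa only [bump_of_ne (shift_ne_mid _)] using h1
    · obtain ⟨k, rfl⟩ := exists_shift_eq hk
      rw [wordP_shift_cons, walk_cons]
      constructor
      · intro j hj
        have hjk : a (shift k) = a (shift j) + 2 ∨ a (shift j) = a (shift k) + 2 :=
          ha.isHeight k j hj
        have hf := h.1
        by_cases hadj : Adjacent (shift k) (shift j)
        · exact hf _ hadj
        -- Here `k` and `j` become adjacent only through the deletion. Since `shift k` lies below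
        -- the middle letter, which is at most the minimum plus 1, it is the lower of the two.
        · have hk' := shift_val k
          have hj' := shift_val j
          have hkm : Adjacent (shift k) (mid n) := by
            rcases hj with hj | hj <;> simp only [Adjacent, mid_val] at hadj ⊢ <;>
              split_ifs at hk' hj' <;> omega
          have h2 := hf _ hkm
          have h3 : a (mid n) = min (a (shift k)) (a (shift j)) + 1 ∨
              a (mid n) = min (a (shift k)) (a (shift j)) - 1 := by
            rcases hj with hj | hj
            · apply ha.mid_eq <;> simp only [Adjacent] at hadj <;>
                split_ifs at hk' hj' <;> omega
            · rw [min_comm]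
              apply ha.mid_eq <;> simp only [Adjacent] at hadj <;>
                split_ifs at hk' hj' <;> omega
          change a (shift k) < a (shift j)
          omega
      · convert h1 using 2 with i
        simp only [bump_apply, shift_injective.eq_iff, twistedStep_shift]

theorem Full.wordP {hn : 1 ≤ n} {a : Fin (2 * n + 1) → ℤ} {w : List (Fin (2 * n + 1))}
    (ha : IsTwistedHeight a) (h : (twistedSystem n hn).Full a w) :
    (adaptedSystem (2 * n)).Full (fun i => a (shift i)) (wordP w) := by
  have h1 := Walk.wordP ha h
  have h2 : (adaptedSystem (2 * n)).bar (fun i => a (shift i)) =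
      fun i => (twistedSystem n hn).bar a (shift i) := by
    ext i
    simp only [FiringSystem.bar, shift_rev]
    simp [adaptedSystem, twistedSystem]
  unfold FiringSystem.Full
  rw [h2]
  exact h1

/-- The extension of a height function of type `A_{2n}` by a height of the letter `n + 1`, which
is the lowest height of its neighbours plus `ε`. -/
def twistedLift (hn : 1 ≤ n) (a : Fin (2 * n) → ℤ) (ε : ℤ) (j : Fin (2 * n + 1)) : ℤ :=
  (letterP j).elim (min (a ⟨n - 1, by omega⟩) (a ⟨n, by omega⟩) + ε) a

variable {hn : 1 ≤ n}

@[simp] theorem twistedLift_shift (a : Fin (2 * n) → ℤ) (ε : ℤ) (i : Fin (2 * n)) :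
    twistedLift hn a ε (shift i) = a i := by simp [twistedLift]

theorem twistedLift_mid (a : Fin (2 * n) → ℤ) (ε : ℤ) :
    twistedLift hn a ε (mid n) = min (a ⟨n - 1, by omega⟩) (a ⟨n, by omega⟩) + ε := by
  simp [twistedLift]

theorem twistedLift_of_lt (a : Fin (2 * n) → ℤ) (ε : ℤ) {j : Fin (2 * n + 1)} (h : j.val < n) :
    twistedLift hn a ε j = a ⟨j.val, by omega⟩ := by
  simp [twistedLift, letterP, h]

theorem twistedLift_of_gt (a : Fin (2 * n) → ℤ) (ε : ℤ) {j : Fin (2 * n + 1)} (h : n < j.val) :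
    twistedLift hn a ε j = a ⟨j.val - 1, by omega⟩ := by
  simp [twistedLift, letterP, h.ne', not_lt.2 h.le]

theorem isTwistedHeight_twistedLift {a : Fin (2 * n) → ℤ} (ha : IsHeight a) {ε : ℤ}
    (hε : ε = 1 ∨ ε = -1) : IsTwistedHeight (twistedLift hn a ε) := by
  constructor
  · intro i j hij hi hj
    rcases Nat.lt_or_gt_of_ne hi with hi | hi
    · rw [twistedLift_of_lt _ _ hi, twistedLift_of_lt _ _ (by omega)]
      exact ha _ _ (Or.inl hij)
    · rw [twistedLift_of_gt _ _ hi, twistedLift_of_gt _ _ (by omega)]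
      exact ha _ _ (Or.inl (by simp only; omega))
  · intro i j hi hj
    rw [twistedLift_of_lt _ _ (by omega), twistedLift_of_gt _ _ (by omega)]
    exact ha _ _ (Or.inl (by simp only; omega))
  · intro i j hi hj
    rw [twistedLift_of_lt _ _ (j := i) (by omega), twistedLift_of_gt _ _ (j := j) (by omega),
      twistedLift_mid]
    have h1 : (⟨n - 1, by omega⟩ : Fin (2 * n)) = ⟨i.val, by omega⟩ := by
      apply Fin.ext; simp only; omega
    have h2 : (⟨n, by omega⟩ : Fin (2 * n)) = ⟨j.val - 1, by omega⟩ := by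
      apply Fin.ext; simp only; omega
    rw [h1, h2]
    omega

theorem IsTwistedHeight.exists_eq_lift {a : Fin (2 * n + 1) → ℤ}
    (ha : IsTwistedHeight a) :
    ∃ ε : ℤ, (ε = 1 ∨ ε = -1) ∧ a = twistedLift hn (fun i => a (shift i)) ε := by
  have h1 : shift (⟨n - 1, by omega⟩ : Fin (2 * n)) = ⟨n - 1, by omega⟩ := by
    apply Fin.ext
    rw [shift_val]
    simp only
    split_ifs <;> omega
  have h2 : shift (⟨n, by omega⟩ : Fin (2 * n)) = ⟨n + 1, by omega⟩ := by
    apply Fin.ext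
    rw [shift_val]
    simp
  have h3 := ha.mid_eq ⟨n - 1, by omega⟩ ⟨n + 1, by omega⟩ (by simp only; omega) rfl
  refine ⟨a (mid n) - min (a ⟨n - 1, by omega⟩) (a ⟨n + 1, by omega⟩), by omega, ?_⟩
  ext j
  by_cases hj : j = mid n
  · subst hj
    rw [twistedLift_mid, h1, h2]
    omega
  · obtain ⟨i, rfl⟩ := exists_shift_eq hj
    rw [twistedLift_shift]

theorem twistedLift_mid_eq (a : Fin (2 * n) → ℤ) (ε : ℤ) :
    twistedLift hn a ε (mid n) = min (twistedLift hn a ε ⟨n - 1, by omega⟩)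
      (twistedLift hn a ε ⟨n + 1, by omega⟩) + ε := by
  rw [twistedLift_mid, twistedLift_of_lt _ _ (by simp only; omega),
    twistedLift_of_gt _ _ (by simp only; omega)]
  simp

theorem fires_mid_twistedLift {a : Fin (2 * n) → ℤ} {ε : ℤ} (hε : ε = 1 ∨ ε = -1) :
    Fires (twistedLift hn a ε) (mid n) ↔ ε = -1 := by
  have h := twistedLift_mid_eq (hn := hn) a ε
  constructor
  · intro hf
    have h1 := hf ⟨n - 1, by omega⟩ (Or.inr (by simp only [mid_val]; omega))
    have h2 := hf ⟨n + 1, by omega⟩ (Or.inl (by simp only [mid_val]))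
    omega
  · rintro rfl j hj
    have h3 : j = ⟨n - 1, by omega⟩ ∨ j = ⟨n + 1, by omega⟩ := by
      simp only [Adjacent, mid_val] at hj
      simp only [Fin.ext_iff]
      omega
    rcases h3 with rfl | rfl <;> omega

theorem bump_twistedLift (a : Fin (2 * n) → ℤ) (ε : ℤ) :
    bump twistedStep (twistedLift hn a ε) (mid n) = twistedLift hn a (ε + 2) := by
  ext j
  by_cases hj : j = mid n
  · subst hj
    rw [bump_self, twistedLift_mid, twistedLift_mid, twistedStep_mid]
    omega
  · obtain ⟨i, rfl⟩ := exists_shift_eq hj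
    rw [bump_of_ne hj, twistedLift_shift, twistedLift_shift]

theorem twistedLift_add (a : Fin (2 * n) → ℤ) (ε K : ℤ) :
    twistedLift hn (fun i => a i + K) ε = fun j => twistedLift hn a ε j + K := by
  ext j
  by_cases hj : j = mid n
  · subst hj
    rw [twistedLift_mid, twistedLift_mid]
    omega
  · obtain ⟨i, rfl⟩ := exists_shift_eq hj
    rw [twistedLift_shift, twistedLift_shift]

theorem bar_twistedLift (a : Fin (2 * n) → ℤ) (ε : ℤ) :
    (twistedSystem n hn).bar (twistedLift hn a ε) =
      twistedLift hn ((adaptedSystem (2 * n)).bar a) ε := by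
  ext j
  by_cases hj : j = mid n
  · subst hj
    simp only [FiringSystem.bar, mid_rev]
    have h1 : (⟨n - 1, by omega⟩ : Fin (2 * n)).rev = ⟨n, by omega⟩ := by
      apply Fin.ext; simp only [Fin.val_rev]; omega
    have h2 : (⟨n, by omega⟩ : Fin (2 * n)).rev = ⟨n - 1, by omega⟩ := by
      apply Fin.ext; simp only [Fin.val_rev]; omega
    rw [twistedLift_mid, twistedLift_mid]
    simp only [FiringSystem.bar, h1, h2, adaptedSystem, twistedSystem]
    push_cast
    omega
  · obtain ⟨i, rfl⟩ := exists_shift_eq hj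
    rw [twistedLift_shift, FiringSystem.bar, ← shift_rev, twistedLift_shift]
    simp [FiringSystem.bar, adaptedSystem, twistedSystem]

theorem isSink_mid_iff {a : Fin (2 * n) → ℤ} (ha : IsHeight a) {ε : ℤ} (hε : ε = 1 ∨ ε = -1) :
    IsSink ((twistedSystem n hn).classOf (twistedLift hn a ε)) (mid n) ↔ ε = -1 := by
  rw [(twistedSystem n hn).isSink_classOf_iff (isTwistedHeight_twistedLift ha hε),
    fires_mid_twistedLift hε]

/-- A source arises by a firing of its opposite letter. The middle letter is its own opposite, and
its firing leads from offset -1 to +1. -/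
theorem isSource_mid_iff {a : Fin (2 * n) → ℤ} (ha : IsHeight a) {ε : ℤ} (hε : ε = 1 ∨ ε = -1) :
    IsSource ((twistedSystem n hn).classOf (twistedLift hn a ε)) (mid n) ↔ ε = 1 := by
  rw [(twistedSystem n hn).isSource_classOf_iff (isTwistedHeight_twistedLift ha hε), mid_rev]
  constructor
  · rintro ⟨b, hb, hf, hba⟩
    obtain ⟨η, hη, hbη⟩ := IsTwistedHeight.exists_eq_lift (hn := hn) hb
    rw [hbη, fires_mid_twistedLift hη] at hf
    subst hf
    rw [hbη] at hba
    change bump twistedStep _ _ = _ at hba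
    rw [bump_twistedLift] at hba
    have h0 : (fun i => b (shift i)) = a := by
      ext i
      have := congrFun hba (shift i)
      rwa [twistedLift_shift, twistedLift_shift] at this
    rw [h0] at hba
    have := congrFun hba (mid n)
    rw [twistedLift_mid, twistedLift_mid] at this
    omega
  · rintro rfl
    exact ⟨twistedLift hn a (-1), isTwistedHeight_twistedLift ha (Or.inr rfl),
      (fires_mid_twistedLift (Or.inr rfl)).2 rfl, bump_twistedLift a (-1)⟩

/-- The class determines the height function up to a constant. -/
theorem exists_eq_add_of_classOf_eq {a c : Fin (2 * n + 1) → ℤ} (ha : IsTwistedHeight a)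
    (hc : IsTwistedHeight c)
    (h : (twistedSystem n hn).classOf a = (twistedSystem n hn).classOf c) :
    ∃ K, c = fun i => a i + K := by
  obtain ⟨w, hw⟩ := (twistedSystem n hn).exists_full ha
  have hw' := ((twistedSystem n hn).cls_eq_classOf_iff hc).1
    ((((twistedSystem n hn).cls_eq_classOf_iff ha).2 hw).trans h)
  have hQa := DynkinQuiver.ofHeight_hasHeight _ ha.isHeight
  have hQc := DynkinQuiver.ofHeight_hasHeight _ hc.isHeight
  have h1 := hQa.isClassOf_iff.2
    (((adaptedSystem (2 * n)).cls_eq_classOf_iff ha.isHeight).2 (Full.wordP ha hw))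
  have h2 := hQc.isClassOf_iff.2
    (((adaptedSystem (2 * n)).cls_eq_classOf_iff hc.isHeight).2 (Full.wordP hc hw'))
  -- Deletion of the middle letter recovers the quiver, hence the outer heights up to a constant.
  have hQ := h1.unique h2
  rw [hQ] at hQa
  obtain ⟨K, hK⟩ := hQa.unique hQc
  refine ⟨K, ?_⟩
  obtain ⟨ε, hε, haε⟩ := IsTwistedHeight.exists_eq_lift (hn := hn) ha
  obtain ⟨η, hη, hcη⟩ := IsTwistedHeight.exists_eq_lift (hn := hn) hc
  -- Whether the middle letter is a sink depends on the class alone and reveals the offset.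
  have hεη : ε = η := by
    have h3 := isSink_mid_iff (hn := hn) ha.isHeight hε
    have h4 := isSink_mid_iff (hn := hn) hc.isHeight hη
    rw [← haε] at h3
    rw [← hcη, ← h] at h4
    have h5 := h3.symm.trans h4
    omega
  rw [hcη, hK, twistedLift_add, ← hεη, ← haε]

end TwistedSystem

/-! ### Insertion of the letter `n + 1` -/

section Insertion

variable {n : ℕ}

/-- The letters `n` and `n + 2` of the shifted word. -/
def centralWord (w : List (Fin (2 * n))) : List (Fin (2 * n + 1)) :=
  (w.map shift).filter fun j => decide (j.val + 1 = n ∨ j.val = n + 1)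

theorem centralWord_cons (i : Fin (2 * n)) (w : List (Fin (2 * n))) :
    centralWord (i :: w) =
      if (shift i).val + 1 = n ∨ (shift i).val = n + 1 then shift i :: centralWord w
      else centralWord w := by
  simp [centralWord, List.filter_cons]

theorem insertMid_eq_cons (a : Fin (2 * n + 1)) (l : List (Fin (2 * n + 1))) :
    ∃ l', insertMid (a :: l) = a :: l' := by
  rcases l with _ | ⟨b, l⟩
  · exact ⟨_, rfl⟩
  · unfold insertMid
    split_ifs
    · exact ⟨_, rfl⟩
    · exact ⟨_, rfl⟩

theorem exists_isInsertion (w : List (Fin (2 * n))) : ∃ v, IsInsertion w v := by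
  change ∃ v : List (Fin (2 * n + 1)), v.filter (fun j => decide (j ≠ mid n)) = w.map shift ∧
    v.filter (fun j => decide (j.val + 1 = n ∨ j.val = n ∨ j.val = n + 1)) =
      insertMid (centralWord w)
  induction w with
  | nil => exact ⟨[], rfl, rfl⟩
  | cons i w ih =>
    obtain ⟨v, hv1, hv2⟩ := ih
    have hne := shift_ne_mid i
    have hne' := ne_mid_iff.1 hne
    have hfilter : ∀ v : List (Fin (2 * n + 1)), (shift i :: v).filter
        (fun j => decide (j ≠ mid n)) = shift i :: v.filter (fun j => decide (j ≠ mid n)) :=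
      fun v => List.filter_cons_of_pos (by simpa using hne)
    rw [centralWord_cons]
    by_cases hi : (shift i).val + 1 = n ∨ (shift i).val = n + 1
    · rw [if_pos hi]
      have hi' : (shift i).val + 1 = n ∨ (shift i).val = n ∨ (shift i).val = n + 1 := by tauto
      rcases hw : centralWord w with _ | ⟨b, l⟩
      · rw [hw] at hv2
        refine ⟨shift i :: v, by rw [hfilter, hv1, List.map_cons], ?_⟩
        rw [List.filter_cons_of_pos (by simpa using hi'), hv2]
        rfl
      · rw [hw] at hv2
        by_cases hb : shift i = b
        · refine ⟨shift i :: v, by rw [hfilter, hv1, List.map_cons], ?_⟩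
          rw [insertMid, if_pos hb, ← hv2]
          simp [hi']
        · refine ⟨shift i :: mid n :: v, by
            rw [hfilter, List.filter_cons_of_neg (by simp), hv1, List.map_cons], ?_⟩
          rw [insertMid, if_neg hb, ← hv2]
          simp [hi']
    · rw [if_neg hi]
      refine ⟨shift i :: v, by rw [hfilter, hv1, List.map_cons], ?_⟩
      rw [← hv2]
      simp only [List.filter_cons]
      rw [if_neg]
      simp only [decide_eq_true_eq]
      tauto

/-- The first of two adjacent letters in a word is the lower one. -/
theorem Walk.centralWord_ne {b c : Fin (2 * n) → ℤ} {w : List (Fin (2 * n))}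
    (h : Walk (fun _ => 4) b w c) {k : Fin (2 * n)} (hk : k.val + 1 = n ∨ k.val = n)
    (hb : b k.rev < b k) (l : List (Fin (2 * n + 1))) : centralWord w ≠ shift k :: l := by
  have hadj : Adjacent k k.rev := by
    simp only [Adjacent, Fin.val_rev]
    omega
  induction w generalizing b with
  | nil => simp [centralWord]
  | cons i w ih =>
    rw [centralWord_cons]
    by_cases hik : i = k
    · subst hik
      exact absurd (h.1 _ hadj) (not_lt.2 hb.le)
    by_cases hi : (shift i).val + 1 = n ∨ (shift i).val = n + 1
    · rw [if_pos hi]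
      intro heq
      exact hik (shift_injective (List.cons.inj heq).1)
    · rw [if_neg hi]
      refine ih h.2 ?_
      have hir : k.rev ≠ i := by
        rintro rfl
        rw [shift_val, Fin.val_rev] at hi
        split_ifs at hi <;> omega
      rwa [bump_of_ne (Ne.symm hik), bump_of_ne hir]

/-- The induction carries the state of the middle letter. At offset +1 a neighbour of it is due
next. At offset -1 either the middle letter is due, or no neighbour is left and the walk ends at
this offset. Firing a neighbour passes from the first state to the second, firing the middle letter
passes back, and all other letters leave the state alone. -/
theorem walk_of_insertion {a c : Fin (2 * n + 1) → ℤ} {w : List (Fin (2 * n))}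
    {v : List (Fin (2 * n + 1))} (ha : IsTwistedHeight a)
    (hw : Walk (fun _ => 4) (fun i => a (shift i)) w fun i => c (shift i))
    (hv : v.filter (fun j => decide (j ≠ mid n)) = w.map shift)
    (hc : ∀ i j : Fin (2 * n + 1), i.val + 1 = n → j.val = n + 1 →
      c (mid n) = min (c i) (c j) - 1)
    (hn : 1 ≤ n)
    (h : ((∀ i j : Fin (2 * n + 1), i.val + 1 = n → j.val = n + 1 →
          a (mid n) = min (a i) (a j) + 1) ∧ centralWord w ≠ [] ∧
        v.filter (fun j => decide (j.val + 1 = n ∨ j.val = n ∨ j.val = n + 1)) =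
          insertMid (centralWord w)) ∨
      ((∀ i j : Fin (2 * n + 1), i.val + 1 = n → j.val = n + 1 →
          a (mid n) = min (a i) (a j) - 1) ∧
        ((centralWord w ≠ [] ∧
          v.filter (fun j => decide (j.val + 1 = n ∨ j.val = n ∨ j.val = n + 1)) =
            mid n :: insertMid (centralWord w)) ∨
        (centralWord w = [] ∧
          v.filter (fun j => decide (j.val + 1 = n ∨ j.val = n ∨ j.val = n + 1)) = [])))) :
    Walk twistedStep a v c := by
  induction v generalizing a w with
  | nil =>
    have hw0 : w = [] := by simpa using hv.symm
    subst hw0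
    rw [walk_nil] at hw
    rcases h with ⟨-, h, -⟩ | ⟨h, -⟩
    · exact absurd rfl h
    · rw [walk_nil]
      ext j
      by_cases hj : j = mid n
      · subst hj
        have e1 : ∀ i, i ≠ mid n → a i = c i := by
          intro i hi
          obtain ⟨i, rfl⟩ := exists_shift_eq hi
          exact congrFun hw i
        rw [h ⟨n - 1, by omega⟩ ⟨n + 1, by omega⟩ (by simp only; omega) rfl,
          hc ⟨n - 1, by omega⟩ ⟨n + 1, by omega⟩ (by simp only; omega) rfl,
          e1 _ (ne_mid_iff.2 (by simp only; omega)), e1 _ (ne_mid_iff.2 (by simp only; omega))]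
      · obtain ⟨j, rfl⟩ := exists_shift_eq hj
        exact congrFun hw j
  | cons k v ih =>
    by_cases hk : k = mid n
    · subst hk
      simp only [ne_eq, not_true_eq_false, decide_false, Bool.false_eq_true, not_false_eq_true,
        List.filter_cons_of_neg] at hv
      rw [List.filter_cons_of_pos (by simp)] at h
      rcases h with ⟨-, h1, h2⟩ | ⟨hlow, ⟨h1, h2⟩ | ⟨-, h2⟩⟩
      · obtain ⟨x, l, hx⟩ := List.exists_cons_of_ne_nil h1
        obtain ⟨l', hl'⟩ := insertMid_eq_cons x l
        rw [hx, hl'] at h2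
        have hxm : x ≠ mid n := by
          have hmem : x ∈ centralWord w := by simp [hx]
          simp only [centralWord, List.mem_filter, List.mem_map] at hmem
          obtain ⟨⟨y, -, rfl⟩, -⟩ := hmem
          exact shift_ne_mid y
        exact absurd (List.cons.inj h2).1.symm hxm
      · have hf : Fires a (mid n) := by
          intro j hj
          have h3 := hlow ⟨n - 1, by omega⟩ ⟨n + 1, by omega⟩ (by simp only; omega) rfl
          have h4 : j = ⟨n - 1, by omega⟩ ∨ j = ⟨n + 1, by omega⟩ := by
            simp only [Adjacent, mid_val] at hj
            simp only [Fin.ext_iff]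
            omega
          rcases h4 with rfl | rfl <;> omega
        refine ⟨hf, ih (ha.bump hf) ?_ hv (Or.inl ⟨?_, h1, (List.cons.inj h2).2⟩)⟩
        · simpa only [bump_of_ne (shift_ne_mid _)] using hw
        · intro i j hi hj
          have h3 := hlow i j hi hj
          rw [bump_self, bump_of_ne (ne_mid_iff.2 (by omega)),
            bump_of_ne (ne_mid_iff.2 (by omega)), twistedStep_mid]
          omega
      · simp at h2
    · obtain ⟨k, rfl⟩ := exists_shift_eq hk
      rw [List.filter_cons_of_pos (by simp [hk])] at hv
      rcases w with _ | ⟨k', w⟩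
      · simp at hv
      rw [List.map_cons] at hv
      obtain ⟨hkk, hv'⟩ := List.cons.inj hv
      have hkk' := shift_injective hkk
      subst hkk'
      have hbump : bump (fun _ => 4) (fun i => a (shift i)) k =
          fun i => bump twistedStep a (shift k) (shift i) := by
        ext i
        simp only [bump_apply, shift_injective.eq_iff, twistedStep_shift]
      have hw2 := hw.2
      rw [hbump] at hw2
      rw [centralWord_cons] at h
      have houter : ∀ j, j ≠ mid n → Adjacent (shift k) j → a (shift k) < a j := by
        intro j hj hadj
        obtain ⟨j, rfl⟩ := exists_shift_eq hj
        apply hw.1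
        have h1 := shift_val k
        have h2 := shift_val j
        simp only [Adjacent] at hadj ⊢
        split_ifs at h1 h2 <;> omega
      by_cases hcen : (shift k).val + 1 = n ∨ (shift k).val = n + 1
      · rw [if_pos hcen, List.filter_cons_of_pos (by simp; tauto)] at h
        rcases h with ⟨hup, -, h2⟩ | ⟨-, ⟨-, h2⟩ | ⟨h2, -⟩⟩
        · have hkv : k.val + 1 = n ∨ k.val = n := by
            rw [shift_val] at hcen
            split_ifs at hcen <;> omega
          -- The two neighbours of the middle letter are adjacent in type `A_{2n}`; the one that is
          -- fired there is the lower one, so it also lies below the middle letter.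
          have hlt : a (shift k) < a (shift k.rev) := by
            apply hw.1
            simp only [Adjacent, Fin.val_rev]
            omega
          have hpair : ∀ i j : Fin (2 * n + 1), i.val + 1 = n → j.val = n + 1 →
              (i = shift k ∧ j = shift k.rev) ∨ (i = shift k.rev ∧ j = shift k) := by
            intro i j hi hj
            rw [shift_rev]
            simp only [Fin.ext_iff, Fin.val_rev]
            omega
          have hf : Fires a (shift k) := by
            intro j hj
            by_cases hjm : j = mid n
            · subst hjm
              have h3 := hup ⟨n - 1, by omega⟩ ⟨n + 1, by omega⟩ (by simp only; omega) rfl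
              rcases hpair ⟨n - 1, by omega⟩ ⟨n + 1, by omega⟩ (by simp only; omega) rfl with
                ⟨h4, h5⟩ | ⟨h4, h5⟩ <;> rw [h4, h5] at h3 <;> omega
            · exact houter j hjm hj
          have hne : shift k.rev ≠ shift k := by
            intro h
            rw [h] at hlt
            exact lt_irrefl _ hlt
          have hlow : ∀ i j : Fin (2 * n + 1), i.val + 1 = n → j.val = n + 1 →
              bump twistedStep a (shift k) (mid n) = min (bump twistedStep a (shift k) i)
                (bump twistedStep a (shift k) j) - 1 := by
            intro i j hi hj
            have h3 := hup i j hi hj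
            have h4 := ha.central i j hi hj
            rw [bump_of_ne (Ne.symm hk)]
            rcases hpair i j hi hj with ⟨rfl, rfl⟩ | ⟨rfl, rfl⟩ <;>
              rw [bump_of_ne hne, bump_self, twistedStep_shift] <;> omega
          refine ⟨hf, ih (ha.bump hf) hw2 hv' (Or.inr ⟨hlow, ?_⟩)⟩
          rcases hcw : centralWord w with _ | ⟨y, l⟩
          · rw [hcw, insertMid] at h2
            exact Or.inr ⟨rfl, (List.cons.inj h2).2⟩
          · left
            refine ⟨by simp, ?_⟩
            -- The neighbours alternate: once fired, a neighbour stands above the other one and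
            -- cannot be the next of the two.
            have hy : shift k ≠ y := by
              rintro rfl
              refine hw2.centralWord_ne hkv ?_ l hcw
              have h4 : a (shift k) = a (shift k.rev) + 2 ∨ a (shift k.rev) = a (shift k) + 2 :=
                ha.isHeight k k.rev (by simp only [Adjacent, Fin.val_rev]; omega)
              rw [bump_of_ne hne, bump_self, twistedStep_shift]
              omega
            rw [hcw, insertMid, if_neg hy] at h2
            exact (List.cons.inj h2).2
        · exact absurd (List.cons.inj h2).1 hk
        · simp at h2
      · have hkn := ne_mid_iff.1 hk
        rw [if_neg hcen, List.filter_cons_of_neg (by simp; omega)] at h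
        have hf : Fires a (shift k) := by
          intro j hj
          refine houter j ?_ hj
          rintro rfl
          simp only [Adjacent, mid_val] at hj
          omega
        have hsame : ∀ i j : Fin (2 * n + 1), i.val + 1 = n → j.val = n + 1 →
            bump twistedStep a (shift k) i = a i ∧ bump twistedStep a (shift k) j = a j := by
          intro i j hi hj
          constructor <;> apply bump_of_ne <;> rintro rfl <;> omega
        have hsame' : bump twistedStep a (shift k) (mid n) = a (mid n) := bump_of_ne (Ne.symm hk)
        refine ⟨hf, ih (ha.bump hf) hw2 hv' (h.imp (And.imp_left fun h i j hi hj => ?_)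
          (And.imp_left fun h i j hi hj => ?_))⟩ <;>
        · rw [hsame', (hsame i j hi hj).1, (hsame i j hi hj).2]
          exact h i j hi hj

/-- The offset goes from +1 to -1. One more middle letter closes the gap: in front it gives a full
word for offset -1, behind a full word for offset +1. -/
theorem isInsertion_walk {hn : 1 ≤ n} {a c : Fin (2 * n) → ℤ} {w : List (Fin (2 * n))}
    {v : List (Fin (2 * n + 1))} (ha : IsHeight a) (hw : Walk (fun _ => 4) a w c)
    (hmem : ∀ i, i ∈ w) (h : IsInsertion w v) :
    Walk twistedStep (twistedLift hn a 1) v (twistedLift hn c (-1)) := by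
  have hmid : ∀ (b : Fin (2 * n) → ℤ) (ε : ℤ) (i j : Fin (2 * n + 1)), i.val + 1 = n →
      j.val = n + 1 → twistedLift hn b ε (mid n) =
        min (twistedLift hn b ε i) (twistedLift hn b ε j) + ε := by
    intro b ε i j hi hj
    have h1 : twistedLift hn b ε i = twistedLift hn b ε ⟨n - 1, by omega⟩ :=
      congrArg _ (Fin.ext (by simp only; omega))
    have h2 : twistedLift hn b ε j = twistedLift hn b ε ⟨n + 1, by omega⟩ :=
      congrArg _ (Fin.ext hj)
    rw [h1, h2]
    exact twistedLift_mid_eq b ε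
  refine walk_of_insertion (isTwistedHeight_twistedLift ha (Or.inl rfl)) ?_ h.1
    (hmid c (-1)) hn (Or.inl ⟨hmid a 1, ?_, h.2⟩)
  · simpa using hw
  · have h1 : shift (⟨n, by omega⟩ : Fin (2 * n)) ∈ centralWord w := by
      simp only [centralWord, List.mem_filter, List.mem_map]
      refine ⟨⟨_, hmem _, rfl⟩, ?_⟩
      rw [shift_val]
      simp
    exact List.ne_nil_of_mem h1

theorem full_mid_cons_of_isInsertion {hn : 1 ≤ n} {a : Fin (2 * n) → ℤ} {w : List (Fin (2 * n))}
    {v : List (Fin (2 * n + 1))} (ha : IsHeight a) (hw : (adaptedSystem (2 * n)).Full a w)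
    (h : IsInsertion w v) :
    (twistedSystem n hn).Full (twistedLift hn a (-1)) (mid n :: v) := by
  have h1 := isInsertion_walk (hn := hn) ha hw (hw.mem ha) h
  have h2 : bump (twistedSystem n hn).step (twistedLift hn a (-1)) (mid n) = twistedLift hn a 1 :=
    bump_twistedLift a (-1)
  refine ⟨(fires_mid_twistedLift (Or.inr rfl)).2 rfl, ?_⟩
  rw [h2, bar_twistedLift]
  exact h1

theorem full_append_mid_of_isInsertion {hn : 1 ≤ n} {a : Fin (2 * n) → ℤ}
    {w : List (Fin (2 * n))} {v : List (Fin (2 * n + 1))} (ha : IsHeight a)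
    (hw : (adaptedSystem (2 * n)).Full a w) (h : IsInsertion w v) :
    (twistedSystem n hn).Full (twistedLift hn a 1) (v ++ [mid n]) := by
  have h1 := isInsertion_walk (hn := hn) ha hw (hw.mem ha) h
  have h2 : bump (twistedSystem n hn).step
      (twistedLift hn ((adaptedSystem (2 * n)).bar a) (-1)) (mid n) =
      twistedLift hn ((adaptedSystem (2 * n)).bar a) 1 := bump_twistedLift _ (-1)
  refine Walk.append h1 ⟨(fires_mid_twistedLift (Or.inr rfl)).2 rfl, ?_⟩
  rw [bar_twistedLift, ← h2]
  rfl

end Insertion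

/-! ### Height functions of twisted Coxeter elements -/

section Transversal

variable {n : ℕ}

theorem IsTransversal.exists_mem {m : ℕ} {u : List (Fin m)} (hu : IsTransversal u) (i : Fin m) :
    i ∈ u ∨ i.rev ∈ u := by
  have h := hu i
  have h1 : 0 < u.countP (fun j => decide (j = i ∨ j = i.rev)) := by omega
  obtain ⟨j, hj, hj'⟩ := List.countP_pos_iff.1 h1
  rcases of_decide_eq_true hj' with rfl | rfl
  · exact Or.inl hj
  · exact Or.inr hj

theorem IsTransversal.nodup {m : ℕ} {u : List (Fin m)} (hu : IsTransversal u) : u.Nodup := by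
  rw [List.nodup_iff_count_le_one]
  intro i
  rw [← hu i]
  exact List.countP_mono_left fun j _ hj => by simp_all

theorem IsTransversal.notMem_rev {m : ℕ} {u : List (Fin m)} (hu : IsTransversal u) {i : Fin m}
    (hi : i ∈ u) (hne : i.rev ≠ i) : i.rev ∉ u := by
  intro hr
  have h := hu i
  rw [List.countP_eq_length_filter, List.length_eq_one_iff] at h
  obtain ⟨x, hx⟩ := h
  have h1 : i ∈ [x] := by rw [← hx]; simp [hi]
  have h2 : i.rev ∈ [x] := by rw [← hx]; simp [hr]
  rw [List.mem_singleton] at h1 h2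
  exact hne (h2.trans h1.symm)

theorem isTransversal_of_count {m : ℕ} {u : List (Fin m)}
    (h : ∀ i, if i.rev = i then u.count i = 1 else u.count i + u.count i.rev = 1) :
    IsTransversal u := by
  intro i
  have h1 := h i
  have h2 : ∀ v : List (Fin m), v.countP (fun j => decide (j = i ∨ j = i.rev)) =
      if i.rev = i then v.count i else v.count i + v.count i.rev := by
    intro v
    split_ifs with hr
    · rw [hr, List.count]
      congr 1
      ext j
      simp [beq_eq_decide]
    · induction v with
      | nil => simp
      | cons j v ih =>
        simp only [List.countP_cons, List.count_cons, ih]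
        by_cases hj : j = i
        · subst hj
          simp [Ne.symm hr]
          omega
        · by_cases hj' : j = i.rev
          · subst hj'
            simp [hr]
            omega
          · simp [hj, hj']
  rw [h2]
  split_ifs at h1 ⊢ <;> exact h1

/-- The distance of a letter from the letter `n + 1`. -/
def distMid (i : Fin (2 * n + 1)) : ℕ := (i.val - n) + (n - i.val)

theorem distMid_rev (i : Fin (2 * n + 1)) : distMid i.rev = distMid i := by
  simp only [distMid, Fin.val_rev]
  omega

theorem eq_or_eq_rev_of_distMid_eq {i j : Fin (2 * n + 1)} (h : distMid i = distMid j) :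
    i = j ∨ i = j.rev := by
  simp only [distMid] at h
  simp only [Fin.ext_iff, Fin.val_rev]
  omega

open Classical in
/-- The height of the letter of `u` at the given distance from the letter `n + 1`. -/
noncomputable def transversalHeight (u : List (Fin (2 * n + 1))) : ℕ → ℤ
  | 0 => 0
  -- Adjacent letters of `u` are ordered by height as they are in the word. Consecutive letters on
  -- opposite sides of the diagram get equal heights, because then each lies 2 below the letter
  -- opposite to the other.
  | k + 1 => transversalHeight u k +
      if ∃ x y, distMid x = k ∧ distMid y = k + 1 ∧ Adjacent x y ∧ [y, x].Sublist u then
        if k = 0 then -1 else -2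
      else if ∃ x y, distMid x = k ∧ distMid y = k + 1 ∧ Adjacent x y ∧ [x, y].Sublist u then
        if k = 0 then 1 else 2
      else 0

theorem IsTransversal.mem_unique {u : List (Fin (2 * n + 1))} (hu : IsTransversal u)
    {x y : Fin (2 * n + 1)} (hx : x ∈ u) (hy : y ∈ u) (h : distMid x = distMid y) : x = y := by
  rcases eq_or_eq_rev_of_distMid_eq h with h | rfl
  · exact h
  · by_contra hne
    exact hu.notMem_rev hy hne hx

theorem IsTransversal.transversalHeight_of_sublist {u : List (Fin (2 * n + 1))}
    {x y : Fin (2 * n + 1)} (hd : distMid y = distMid x + 1)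
    (hadj : Adjacent x y) (h : [y, x].Sublist u) :
    transversalHeight u (distMid y) =
      transversalHeight u (distMid x) + if distMid x = 0 then -1 else -2 := by
  rw [hd, transversalHeight, if_pos ⟨x, y, rfl, hd, hadj, h⟩]

theorem IsTransversal.transversalHeight_of_sublist' {u : List (Fin (2 * n + 1))}
    (hu : IsTransversal u) {x y : Fin (2 * n + 1)} (hd : distMid y = distMid x + 1)
    (hadj : Adjacent x y) (h : [x, y].Sublist u) :
    transversalHeight u (distMid y) =
      transversalHeight u (distMid x) + if distMid x = 0 then 1 else 2 := by
  have hx : x ∈ u := h.subset (by simp)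
  have hy : y ∈ u := h.subset (by simp)
  rw [hd, transversalHeight, if_neg, if_pos ⟨x, y, rfl, hd, hadj, h⟩]
  rintro ⟨x', y', hx', hy', -, h'⟩
  rw [hu.mem_unique (h'.subset (by simp)) hx hx',
    hu.mem_unique (h'.subset (by simp)) hy (hy'.trans hd.symm)] at h'
  exact pair_sublist_asymm hu.nodup hadj.ne h h'

theorem IsTransversal.transversalHeight_of_not_adjacent {u : List (Fin (2 * n + 1))}
    (hu : IsTransversal u) {x y : Fin (2 * n + 1)} (hd : distMid y = distMid x + 1)
    (hadj : ¬ Adjacent x y) (hx : x ∈ u) (hy : y ∈ u) :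
    transversalHeight u (distMid y) = transversalHeight u (distMid x) := by
  rw [hd, transversalHeight, if_neg, if_neg, add_zero]
  all_goals
    rintro ⟨x', y', hx', hy', h, h'⟩
    rw [hu.mem_unique (h'.subset (by simp)) hx hx',
      hu.mem_unique (h'.subset (by simp)) hy (hy'.trans hd.symm)] at h
    exact hadj h

/-- Every transversal word is fired along a height function, which it reverses up to a constant. -/
theorem IsTransversal.exists_walk {u : List (Fin (2 * n + 1))} (hu : IsTransversal u) :
    ∃ a, IsTwistedHeight a ∧ a (mid n) = 0 ∧ Walk twistedStep a u fun j => a j.rev + 2 := by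
  classical
  set α := transversalHeight u with hα
  -- Letters outside `u` stand 2 above their opposites. Reversing and raising by 2 then amounts to
  -- one step for every letter of `u` and none for the others.
  let a : Fin (2 * n + 1) → ℤ := fun i => α (distMid i) + if i ∈ u then 0 else 2
  have hmid : mid n ∈ u := by
    rcases hu.exists_mem (mid n) with h | h
    · exact h
    · rwa [mid_rev] at h
  have hmem : ∀ {i : Fin (2 * n + 1)}, i ≠ mid n → (i ∈ u ↔ i.rev ∉ u) := by
    intro i hi
    constructor
    · exact fun h => hu.notMem_rev h (mt rev_eq_self_iff.1 hi)
    · exact (hu.exists_mem i).resolve_right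
  have hα0 : α 0 = 0 := by rw [hα, transversalHeight]
  have hd0 : ∀ i : Fin (2 * n + 1), distMid i = 0 ↔ i = mid n := by
    intro i
    simp only [distMid, Fin.ext_iff, mid_val]
    omega
  have ha0 : a (mid n) = 0 := by
    simp only [a, (hd0 _).2 rfl, hα0, hmid, if_true, add_zero]
  have ha_mem : ∀ i, i ∈ u → a i = α (distMid i) := by
    intro i hi
    simp [a, hi]
  have ha_notMem : ∀ i, i ∉ u → a i = α (distMid i) + 2 := by
    intro i hi
    simp [a, hi]
  -- the heights of a pair of adjacent letters, the second one being further away from the middle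
  have hstep : ∀ x y : Fin (2 * n + 1), Adjacent x y → distMid y = distMid x + 1 → x ≠ mid n →
      (x ∈ u → y ∈ u → ([y, x].Sublist u → a y = a x - 2) ∧ ([x, y].Sublist u → a y = a x + 2)) ∧
      (x ∈ u → y ∉ u → a y = a x + 2) ∧ (x ∉ u → y ∈ u → a y = a x - 2) ∧
      (x ∉ u → y ∉ u → a y = a x + 2 ∨ a y = a x - 2) := by
    intro x y hxy hd hx
    have hx0 : distMid x ≠ 0 := fun h => hx ((hd0 x).1 h)
    have hy : y ≠ mid n := fun h => by rw [← hd0] at h; omega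
    have hdr : distMid y.rev = distMid x.rev + 1 := by rw [distMid_rev, distMid_rev, hd]
    have hna : ¬ Adjacent x y.rev := by
      simp only [Adjacent, Fin.val_rev, distMid] at *
      omega
    have hna' : ¬ Adjacent x.rev y := by
      rwa [← adjacent_rev, Fin.rev_rev]
    refine ⟨fun h1 h2 => ⟨fun h => ?_, fun h => ?_⟩, fun h1 h2 => ?_, fun h1 h2 => ?_,
      fun h1 h2 => ?_⟩
    · rw [ha_mem _ h1, ha_mem _ h2, hα, transversalHeight_of_sublist hd hxy h, if_neg hx0]
      ring
    · rw [ha_mem _ h1, ha_mem _ h2, hα, hu.transversalHeight_of_sublist' hd hxy h, if_neg hx0]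
    · have h3 : y.rev ∈ u := (hu.exists_mem y).resolve_left h2
      have h4 := hu.transversalHeight_of_not_adjacent (x := x) (y := y.rev)
        (by rw [distMid_rev, hd]) hna h1 h3
      rw [distMid_rev] at h4
      rw [ha_mem _ h1, ha_notMem _ h2, hα, h4]
    · have h3 : x.rev ∈ u := (hu.exists_mem x).resolve_left h1
      have h4 := hu.transversalHeight_of_not_adjacent (x := x.rev) (y := y)
        (by rw [distMid_rev, hd]) hna' h3 h2
      rw [distMid_rev] at h4
      rw [ha_mem _ h2, ha_notMem _ h1, hα, h4]
      ring
    · have h3 : x.rev ∈ u := (hu.exists_mem x).resolve_left h1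
      have h4 : y.rev ∈ u := (hu.exists_mem y).resolve_left h2
      have h5 := adjacent_rev.2 hxy
      have h0 : distMid x.rev ≠ 0 := by rwa [distMid_rev]
      rw [ha_notMem _ h1, ha_notMem _ h2, hα, ← distMid_rev x, ← distMid_rev y]
      rcases pair_sublist_total h5.ne h3 h4 with h | h
      · rw [hu.transversalHeight_of_sublist' hdr h5 h, if_neg h0]
        left; ring
      · rw [transversalHeight_of_sublist hdr h5 h, if_neg h0]
        right; ring
  have hstep0 : ∀ y : Fin (2 * n + 1), Adjacent (mid n) y →
      (y ∈ u → ([y, mid n].Sublist u → a y = -1) ∧ ([mid n, y].Sublist u → a y = 1)) ∧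
      (y ∉ u → ([y.rev, mid n].Sublist u ∧ a y = 1) ∨ ([mid n, y.rev].Sublist u ∧ a y = 3)) := by
    intro y hy
    have hm0 := (hd0 (mid n)).2 rfl
    have hd : distMid y = distMid (mid n) + 1 := by
      rw [hm0]
      simp only [Adjacent, mid_val, distMid] at *
      omega
    refine ⟨fun h1 => ⟨fun h => ?_, fun h => ?_⟩, fun h1 => ?_⟩
    · rw [ha_mem _ h1, hα, transversalHeight_of_sublist hd hy h, if_pos hm0, hm0, ← hα, hα0]
      rfl
    · rw [ha_mem _ h1, hα, hu.transversalHeight_of_sublist' hd hy h, if_pos hm0, hm0, ← hα, hα0]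
      rfl
    · have h2 : y.rev ∈ u := (hu.exists_mem y).resolve_left h1
      have h3 : Adjacent (mid n) y.rev := by rwa [← adjacent_rev, Fin.rev_rev, mid_rev]
      have h4 : distMid y.rev = distMid (mid n) + 1 := by rw [distMid_rev, hd]
      rcases pair_sublist_total h3.ne hmid h2 with h | h
      · right
        refine ⟨h, ?_⟩
        rw [ha_notMem _ h1, hα, ← distMid_rev, hu.transversalHeight_of_sublist' h4 h3 h,
          if_pos hm0, hm0, ← hα, hα0]
        rfl
      · left
        refine ⟨h, ?_⟩
        rw [ha_notMem _ h1, hα, ← distMid_rev, transversalHeight_of_sublist h4 h3 h,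
          if_pos hm0, hm0, ← hα, hα0]
        rfl
  have hdir : ∀ x y : Fin (2 * n + 1), Adjacent x y →
      distMid y = distMid x + 1 ∨ distMid x = distMid y + 1 := by
    intro x y h
    simp only [Adjacent, distMid] at *
    omega
  refine ⟨a, ⟨?_, ?_, ?_⟩, ha0, ?_⟩
  · have key : ∀ x y : Fin (2 * n + 1), Adjacent x y → distMid y = distMid x + 1 → x ≠ mid n →
        a x = a y + 2 ∨ a y = a x + 2 := by
      intro x y hxy hd hx
      obtain ⟨h1, h2, h3, h4⟩ := hstep x y hxy hd hx
      by_cases hxu : x ∈ u <;> by_cases hyu : y ∈ u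
      · rcases pair_sublist_total hxy.ne hxu hyu with h | h
        · have := (h1 hxu hyu).2 h; omega
        · have := (h1 hxu hyu).1 h; omega
      · have := h2 hxu hyu; omega
      · have := h3 hxu hyu; omega
      · have := h4 hxu hyu; omega
    intro i j hij hi hj
    have hadj : Adjacent i j := Or.inl hij
    rcases hdir i j hadj with h | h
    · exact key i j hadj h (ne_mid_iff.2 hi)
    · exact (key j i hadj.symm h (ne_mid_iff.2 hj)).symm
  -- The conditions `central` and `mid_eq` share one case distinction: the neighbours of the middle
  -- letter, itself at 0, have heights -1 and 1, or 1 and 3. The remaining goal, the walk, is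
  -- skipped.
  all_goals try
    intro i j hi hj
    have hai : Adjacent (mid n) i := Or.inr hi
    have haj : Adjacent (mid n) j := Or.inl hj.symm
    have hij : i.rev = j := by
      apply Fin.ext
      simp only [Fin.val_rev]
      omega
    have him : i ≠ mid n := hai.ne.symm
    have hsi := hstep0 i hai
    have hsj := hstep0 j haj
    have hm := hmem him
    rw [hij] at hm hsi
    rw [← hij, Fin.rev_rev, hij] at hsj
    try rw [ha0]
    by_cases hiu : i ∈ u
    · have hju := hm.1 hiu
      rcases hsj.2 hju with ⟨h1, h2⟩ | ⟨h1, h2⟩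
      · have := (hsi.1 hiu).1 h1; omega
      · have := (hsi.1 hiu).2 h1; omega
    · have hju : j ∈ u := by
        by_contra h
        exact hiu (hm.2 h)
      rcases hsi.2 hiu with ⟨h1, h2⟩ | ⟨h1, h2⟩
      · have := (hsj.1 hju).1 h1; omega
      · have := (hsj.1 hju).2 h1; omega
  have hfun : (fun j => a j.rev + 2) = fun j => a j + if j ∈ u then twistedStep j else 0 := by
    ext j
    by_cases hj : j = mid n
    · subst hj
      simp only [mid_rev, hmid, if_true, twistedStep_mid]
    · rw [twistedStep_of_ne hj]
      by_cases hju : j ∈ u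
      · rw [ha_notMem _ ((hmem hj).1 hju), ha_mem _ hju, distMid_rev, if_pos hju]
        ring
      · have : j.rev ∈ u := (hu.exists_mem j).resolve_left hju
        rw [ha_mem _ this, ha_notMem _ hju, distMid_rev, if_neg hju]
        ring
  rw [hfun]
  refine walk_of_nodup hu.nodup fun i hi j hij => ?_
  have hsub : ¬ [j, i].Sublist u → j ∈ u → [i, j].Sublist u := fun h hj =>
    (pair_sublist_total hij.ne hi hj).resolve_right h
  have hju : [j, i].Sublist u → j ∈ u := fun h => h.subset (by simp)
  by_cases him : i = mid n
  · subst him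
    have h := hstep0 j hij
    have hjm : j ≠ mid n := hij.ne.symm
    rw [ha0, twistedStep_of_ne hjm]
    by_cases hj : j ∈ u
    · refine ⟨fun h1 => ?_, fun h1 => ?_⟩
      · have := (h.1 hj).2 (hsub h1 hj); omega
      · have := (h.1 hj).1 h1; omega
    · refine ⟨fun _ => ?_, fun h1 => absurd (hju h1) hj⟩
      rcases h.2 hj with h | h <;> omega
  by_cases hjm : j = mid n
  · subst hjm
    have h := hstep0 i hij.symm
    rw [ha0, twistedStep_mid]
    refine ⟨fun h1 => ?_, fun h1 => ?_⟩
    · have := (h.1 hi).1 (hsub h1 hmid); omega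
    · have := (h.1 hi).2 h1; omega
  rw [twistedStep_of_ne hjm]
  rcases hdir i j hij with hd | hd
  · obtain ⟨h1, h2, -, -⟩ := hstep i j hij hd him
    by_cases hj : j ∈ u
    · refine ⟨fun h3 => ?_, fun h3 => ?_⟩
      · have := (h1 hi hj).2 (hsub h3 hj); omega
      · have := (h1 hi hj).1 h3; omega
    · refine ⟨fun _ => ?_, fun h3 => absurd (hju h3) hj⟩
      have := h2 hi hj; omega
  · obtain ⟨h1, -, h2, -⟩ := hstep j i hij.symm hd hjm
    by_cases hj : j ∈ u
    · refine ⟨fun h3 => ?_, fun h3 => ?_⟩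
      · have := (h1 hj hi).1 (hsub h3 hj); omega
      · have := (h1 hj hi).2 h3; omega
    · refine ⟨fun _ => ?_, fun h3 => absurd (hju h3) hj⟩
      have := h2 hj hi; omega

/-- The heights of `i` and `i^∨` are consecutive. -/
def IsBalanced (a : Fin (2 * n + 1) → ℤ) : Prop :=
  ∀ i, i ≠ mid n → a i = a i.rev + 2 ∨ a i.rev = a i + 2

/-- Each outer letter occurs at most once, so `a i.rev + 2 - a i` is 0 or 4. -/
theorem IsTransversal.isBalanced {u : List (Fin (2 * n + 1))} (hu : IsTransversal u)
    {a : Fin (2 * n + 1) → ℤ} (h : Walk twistedStep a u fun j => a j.rev + 2) :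
    IsBalanced a := by
  intro i hi
  have h1 := h.eq_add_count i
  have h2 := List.nodup_iff_count_le_one.1 hu.nodup i
  rw [twistedStep_of_ne hi] at h1
  omega

/-- Balance says that raising `a` to its reversal plus 2 takes one firing of the lower letter of
each pair `{i, i^∨}`, none of the higher one, and one of the middle letter. -/
theorem IsBalanced.exists_transversal {a : Fin (2 * n + 1) → ℤ} (hn : 1 ≤ n)
    (ha : IsTwistedHeight a) (hb : IsBalanced a) :
    ∃ u, IsTransversal u ∧ Walk twistedStep a u fun j => a j.rev + 2 := by
  obtain ⟨u, hu⟩ := (twistedSystem n hn).exists_walk ha (ha.rev.add 2) fun i => by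
    change ∃ k : ℕ, a i.rev + 2 = a i + k * twistedStep i
    by_cases hi : i = mid n
    · subst hi
      exact ⟨1, by simp [mid_rev]⟩
    · rw [twistedStep_of_ne hi]
      rcases hb i hi with h | h
      · exact ⟨0, by push_cast; omega⟩
      · exact ⟨1, by push_cast; omega⟩
  refine ⟨u, isTransversal_of_count fun i => ?_, hu⟩
  have h1 : a i.rev + 2 = a i + u.count i * twistedStep i := hu.eq_add_count i
  have h2 : a i.rev.rev + 2 = a i.rev + u.count i.rev * twistedStep i.rev :=
    hu.eq_add_count i.rev
  by_cases hi : i = mid n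
  · subst hi
    rw [mid_rev, twistedStep_mid] at h1
    rw [if_pos mid_rev]
    omega
  · have hir : i.rev ≠ mid n := fun h => hi (rev_eq_mid_iff.1 h)
    rw [if_neg (mt rev_eq_self_iff.1 hi)]
    rw [Fin.rev_rev, twistedStep_of_ne hir] at h2
    rw [twistedStep_of_ne hi] at h1
    have := hb i hi
    omega

theorem full_twistedPower {hn : 1 ≤ n} {a : Fin (2 * n + 1) → ℤ} {u : List (Fin (2 * n + 1))}
    (h : Walk twistedStep a u fun j => a j.rev + 2) :
    (twistedSystem n hn).Full a (twistedPower u) :=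
  (twistedSystem n hn).full_revPower (N := 2 * n + 1) (K := 2) (by simp) (by
    simp only [twistedSystem]
    push_cast
    ring) h

theorem isTransversal_initialWord : IsTransversal (initialWord n) := by
  have hmem : ∀ i, i ∈ initialWord n ↔ i.val < n + 1 :=
    fun i => mem_initialSegment (k := n + 1) (h := by omega)
  have hnd : (initialWord n).Nodup := nodup_initialSegment (k := n + 1) (h := by omega)
  refine isTransversal_of_count fun i => ?_
  rw [hnd.count, hnd.count]
  simp only [hmem, Fin.ext_iff, Fin.val_rev]
  split_ifs <;> omega

theorem isLongWord_twistedPower_initialWord : IsLongWord (twistedPower (initialWord n)) :=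
  isLongWord_revPower_initialSegment (m := 2 * n + 1) (k := n + 1) (n := n) (by omega) (by omega)
    (Or.inr rfl)

theorem twistedCluster_eq (hn : 1 ≤ n) :
    twistedCluster n = {c | ∃ a, IsTwistedHeight a ∧ c = (twistedSystem n hn).classOf a} := by
  obtain ⟨a, ha, -, hw⟩ := (isTransversal_initialWord (n := n)).exists_walk
  rw [twistedCluster, ((twistedSystem n hn).cls_eq_classOf_iff ha).2 (full_twistedPower hw)]
  exact (twistedSystem n hn).rCluster_classOf ha

theorem isLongWord_of_twistedSystem_full {hn : 1 ≤ n} {a : Fin (2 * n + 1) → ℤ}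
    (ha : IsTwistedHeight a) {w : List (Fin (2 * n + 1))}
    (hw : (twistedSystem n hn).Full a w) : IsLongWord w := by
  obtain ⟨c, hc, -, hcw⟩ := (isTransversal_initialWord (n := n)).exists_walk
  exact (twistedSystem n hn).isLongWord_of_full hc ha (full_twistedPower hcw)
    isLongWord_twistedPower_initialWord hw

/-- Equal products make the words commutation equivalent, so they fire from the same `a`. Conversely
the class gives `a` up to a constant, and the transversal word is, up to commutation, the only walk
from `a` to its reversal plus 2. -/
theorem wordProd_eq_iff_of_isTransversal (hn : 1 ≤ n) {u u' : List (Fin (2 * n + 1))}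
    (hu : IsTransversal u) (hu' : IsTransversal u') :
    wordProd u = wordProd u' ↔ cls (twistedPower u) = cls (twistedPower u') := by
  obtain ⟨a, ha, -, hw⟩ := hu.exists_walk
  obtain ⟨a', ha', -, hw'⟩ := hu'.exists_walk
  have hf := full_twistedPower (hn := hn) hw
  constructor
  · intro h
    have hc := cls_eq_of_wordProd_eq hu.nodup hu'.nodup h
    exact hf.cls_eq (twistedSystem n hn).step_pos
      (full_twistedPower (hn := hn) ((walk_iff_of_cls_eq hc).1 hw))
  · intro h
    have hf' := full_twistedPower (hn := hn) hw'
    have h1 := ((twistedSystem n hn).cls_eq_classOf_iff ha).2 hf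
    have h2 := ((twistedSystem n hn).cls_eq_classOf_iff ha').2 hf'
    obtain ⟨K, rfl⟩ := exists_eq_add_of_classOf_eq ha ha' (h1.symm.trans (h.trans h2))
    have hw2 : Walk twistedStep a u' fun j => a j.rev + 2 := by
      rw [← walk_add_iff K]
      convert hw' using 2
      ring
    exact wordProd_eq_of_cls_eq (hw.cls_eq (twistedSystem n hn).step_pos hw2)

theorem twistedElement_eq_iff {m : ℕ} {u u' : List (Fin m)} :
    twistedElement u = twistedElement u' ↔ wordProd u = wordProd u' := by
  rw [twistedElement, twistedElement, mul_left_inj, SemidirectProduct.inl_inj]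

end Transversal

/-! ### Balanced quivers -/

section Balanced

variable {m : ℕ}

theorem DynkinQuiver.arrowsToward_of_le (Q : DynkinQuiver m) {i j : Fin m} (hij : i ≤ j) :
    Q.arrowsToward i j =
      {p : Fin m × Fin m | Q.arrow p.1 p.2 ∧ p.2 < p.1 ∧ i ≤ p.2 ∧ p.1 ≤ j}.ncard := by
  rw [arrowsToward]
  congr 1
  ext ⟨p, q⟩
  simp only [Set.mem_ofPred_eq, Set.uIcc_of_le hij, Set.mem_Icc, Nat.dist, Fin.le_def, Fin.lt_def]
  exact and_congr_right fun _ => by omega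

theorem DynkinQuiver.arrowsToward_of_ge (Q : DynkinQuiver m) {i j : Fin m} (hij : i ≤ j) :
    Q.arrowsToward j i =
      {p : Fin m × Fin m | Q.arrow p.1 p.2 ∧ p.1 < p.2 ∧ i ≤ p.1 ∧ p.2 ≤ j}.ncard := by
  rw [arrowsToward]
  congr 1
  ext ⟨p, q⟩
  simp only [Set.mem_ofPred_eq, Set.uIcc_of_ge hij, Set.mem_Icc, Nat.dist, Fin.le_def, Fin.lt_def]
  exact and_congr_right fun _ => by omega

/-- Arrows go down by 2, so each edge between `i` and `j` contributes 2 to `a j - a i` if its arrow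
points toward `i`, and -2 otherwise. -/
theorem DynkinQuiver.HasHeight.arrowsToward_sub {Q : DynkinQuiver m} {a : Fin m → ℤ}
    (h : Q.HasHeight a) {i j : Fin m} (hij : i ≤ j) :
    2 * ((Q.arrowsToward i j : ℤ) - Q.arrowsToward j i) = a j - a i := by
  rw [Q.arrowsToward_of_le hij, Q.arrowsToward_of_ge hij]
  obtain ⟨k, hk⟩ := Nat.exists_eq_add_of_le (Fin.le_def.1 hij)
  have hadj : ∀ {p q : Fin m}, Q.arrow p q → Adjacent p q :=
    fun hpq => (Q.adjacent_iff _ _).2 (Or.inl hpq)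
  induction k generalizing j with
  | zero =>
    have : j = i := Fin.ext (by omega)
    subst this
    have h1 : {p : Fin m × Fin m | Q.arrow p.1 p.2 ∧ p.2 < p.1 ∧ j ≤ p.2 ∧ p.1 ≤ j} = ∅ := by
      ext ⟨p, q⟩
      simp only [Set.mem_ofPred_eq, Fin.le_def, Fin.lt_def, Set.mem_empty_iff_false, iff_false]
      omega
    have h2 : {p : Fin m × Fin m | Q.arrow p.1 p.2 ∧ p.1 < p.2 ∧ j ≤ p.1 ∧ p.2 ≤ j} = ∅ := by
      ext ⟨p, q⟩
      simp only [Set.mem_ofPred_eq, Fin.le_def, Fin.lt_def, Set.mem_empty_iff_false, iff_false]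
      omega
    rw [h1, h2]
    simp
  | succ k ih =>
    let l : Fin m := ⟨j.val - 1, by omega⟩
    have hl : l.val + 1 = j.val := by simp only [l]; omega
    have hil : i ≤ l := by rw [Fin.le_def]; omega
    have h0 := ih hil (by omega)
    have hlj : Adjacent l j := Or.inl hl
    have hheight := h.isHeight l j hlj
    -- Lengthening the segment by the edge between `l` and `j` adds one arrow to exactly one of the
    -- two sets.
    have hdown : {p : Fin m × Fin m | Q.arrow p.1 p.2 ∧ p.2 < p.1 ∧ i ≤ p.2 ∧ p.1 ≤ j} =
        {p : Fin m × Fin m | Q.arrow p.1 p.2 ∧ p.2 < p.1 ∧ i ≤ p.2 ∧ p.1 ≤ l} ∪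
          {p | Q.arrow j l ∧ p = (j, l)} := by
      ext ⟨p, q⟩
      simp only [Set.mem_ofPred_eq, Set.mem_union, Prod.mk.injEq]
      constructor
      · rintro ⟨h1, h2, h3, h4⟩
        by_cases hp : p = j
        · subst hp
          have hq : q = l := by
            have := hadj h1
            simp only [Adjacent, Fin.lt_def, Fin.ext_iff] at *
            omega
          subst hq
          exact Or.inr ⟨h1, rfl, rfl⟩
        · refine Or.inl ⟨h1, h2, h3, ?_⟩
          simp only [Fin.le_def, Fin.ext_iff] at *
          omega
      · rintro (⟨h1, h2, h3, h4⟩ | ⟨h1, rfl, rfl⟩)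
        · refine ⟨h1, h2, h3, ?_⟩
          simp only [Fin.le_def] at *
          omega
        · exact ⟨h1, by rw [Fin.lt_def]; omega, hil, le_rfl⟩
    have hup : {p : Fin m × Fin m | Q.arrow p.1 p.2 ∧ p.1 < p.2 ∧ i ≤ p.1 ∧ p.2 ≤ j} =
        {p : Fin m × Fin m | Q.arrow p.1 p.2 ∧ p.1 < p.2 ∧ i ≤ p.1 ∧ p.2 ≤ l} ∪
          {p | Q.arrow l j ∧ p = (l, j)} := by
      ext ⟨p, q⟩
      simp only [Set.mem_ofPred_eq, Set.mem_union, Prod.mk.injEq]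
      constructor
      · rintro ⟨h1, h2, h3, h4⟩
        by_cases hq : q = j
        · subst hq
          have hp : p = l := by
            have := hadj h1
            simp only [Adjacent, Fin.lt_def, Fin.ext_iff] at *
            omega
          subst hp
          exact Or.inr ⟨h1, rfl, rfl⟩
        · refine Or.inl ⟨h1, h2, h3, ?_⟩
          simp only [Fin.le_def, Fin.ext_iff] at *
          omega
      · rintro (⟨h1, h2, h3, h4⟩ | ⟨h1, rfl, rfl⟩)
        · refine ⟨h1, h2, h3, ?_⟩
          simp only [Fin.le_def] at *
          omega
        · exact ⟨h1, by rw [Fin.lt_def]; omega, hil, le_rfl⟩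
    have hnotle : ¬ j ≤ l := by rw [Fin.le_def]; omega
    rw [hdown, hup]
    by_cases hjl : Q.arrow j l
    · have hlj' := Q.asymm _ _ hjl
      have := ((h.arrow_iff j l).1 hjl).2
      simp only [hjl, hlj', true_and, false_and, Set.ofPred_eq_eq_singleton, Set.ofPred_false,
        Set.union_empty, Set.union_singleton]
      rw [Set.ncard_insert_of_notMem (by simp [hnotle])]
      push_cast
      omega
    · have hlj' := ((Q.adjacent_iff _ _).1 hlj).resolve_right hjl
      have := ((h.arrow_iff l j).1 hlj').2
      simp only [hjl, hlj', true_and, false_and, Set.ofPred_eq_eq_singleton, Set.ofPred_false,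
        Set.union_empty, Set.union_singleton]
      rw [Set.ncard_insert_of_notMem (by simp [hnotle])]
      push_cast
      omega

theorem DynkinQuiver.HasHeight.balanced_iff {Q : DynkinQuiver m} {a : Fin m → ℤ}
    (h : Q.HasHeight a) :
    Q.Balanced ↔ ∀ i, a i = a i.rev + 2 ∨ a i.rev = a i + 2 := by
  refine forall_congr' fun i => ?_
  rw [abs_eq (by norm_num)]
  rcases le_total i i.rev with hi | hi
  · have := h.arrowsToward_sub hi
    omega
  · have := h.arrowsToward_sub hi
    omega

end Balanced

/-! ### Counting height functions -/

section Counting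

/-- The number of paths of a given length in a directed graph whose relevant vertices have
outdegree `k`. -/
theorem exists_finset_paths {α : Type*} (start : Finset α) (next : α → Finset α)
    (T : Set α) (k : ℕ) (hstart : ∀ x ∈ start, x ∈ T) (hnext : ∀ x ∈ T, ∀ y ∈ next x, y ∈ T)
    (hcard : ∀ x ∈ T, (next x).card = k) (N : ℕ) :
    ∃ S : Finset (Fin (N + 1) → α),
      (∀ f, f ∈ S ↔ f 0 ∈ start ∧ ∀ i : Fin N, f i.succ ∈ next (f i.castSucc)) ∧
      (∀ f ∈ S, ∀ i, f i ∈ T) ∧ S.card = start.card * k ^ N := by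
  induction N with
  | zero =>
    refine ⟨start.map ⟨fun x _ => x, fun x y h => congrFun h 0⟩, fun f => ?_, ?_, by simp⟩
    · simp only [Finset.mem_map]
      constructor
      · rintro ⟨x, hx, rfl⟩
        exact ⟨hx, fun i => i.elim0⟩
      · rintro ⟨h, -⟩
        exact ⟨f 0, h, funext fun i => congrArg f (Fin.ext (by simp))⟩
    · simp only [Finset.mem_map]
      rintro f ⟨x, hx, rfl⟩ i
      exact hstart x hx
  | succ N ih =>
    obtain ⟨S, hS, hT, hc⟩ := ih
    let e : (Σ _ : Fin (N + 1) → α, α) ↪ (Fin (N + 1 + 1) → α) :=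
      ⟨fun p => Fin.snoc p.1 p.2, by
        rintro ⟨f, x⟩ ⟨g, y⟩ h
        obtain ⟨rfl, rfl⟩ := Fin.snoc_inj.1 h
        rfl⟩
    refine ⟨(S.sigma fun f => next (f (Fin.last N))).map e, fun f => ?_, ?_, ?_⟩
    · simp only [Finset.mem_map, Finset.mem_sigma]
      constructor
      · rintro ⟨⟨g, y⟩, ⟨hg, hy⟩, rfl⟩
        obtain ⟨h0, h1⟩ := (hS g).1 hg
        refine ⟨?_, fun i => ?_⟩
        · change (Fin.snoc g y : Fin (N + 1 + 1) → α) (Fin.castSucc 0) ∈ start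
          rw [Fin.snoc_castSucc]
          exact h0
        · change (Fin.snoc g y : Fin (N + 1 + 1) → α) i.succ ∈
            next ((Fin.snoc g y : Fin (N + 1 + 1) → α) i.castSucc)
          rw [Fin.snoc_castSucc]
          induction i using Fin.lastCases with
          | last => rw [Fin.succ_last, Fin.snoc_last]; exact hy
          | cast i => rw [Fin.succ_castSucc, Fin.snoc_castSucc]; exact h1 i
      · rintro ⟨h0, h1⟩
        refine ⟨⟨Fin.init f, f (Fin.last _)⟩, ⟨(hS _).2 ⟨h0, fun i => ?_⟩, ?_⟩,
          Fin.snoc_init_self f⟩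
        · have := h1 i.castSucc
          rwa [Fin.succ_castSucc] at this
        · exact h1 (Fin.last N)
    · simp only [Finset.mem_map, Finset.mem_sigma]
      rintro f ⟨⟨g, y⟩, ⟨hg, hy⟩, rfl⟩ i
      change (Fin.snoc g y : Fin (N + 1 + 1) → α) i ∈ T
      induction i using Fin.lastCases with
      | last => rw [Fin.snoc_last]; exact hnext _ (hT g hg _) y hy
      | cast i => rw [Fin.snoc_castSucc]; exact hT g hg i
    · rw [Finset.card_map, Finset.card_sigma,
        Finset.sum_congr rfl fun f hf => hcard _ (hT f hf _), Finset.sum_const, hc, smul_eq_mul,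
        pow_succ, mul_assoc]

variable {N : ℕ}

/-- The function on the letters whose values at `n - j` and `n + 2 + j` are the components of
`f j`, where `n = N + 1`. -/
def ofPairs (f : Fin (N + 1) → ℤ × ℤ) (i : Fin (2 * (N + 1) + 1)) : ℤ :=
  if h : i.val < N + 1 then (f ⟨N - i.val, by omega⟩).1
  else if h' : N + 1 < i.val then (f ⟨i.val - (N + 2), by omega⟩).2 else 0

theorem ofPairs_left (f : Fin (N + 1) → ℤ × ℤ) {i : Fin (2 * (N + 1) + 1)} {j : Fin (N + 1)}
    (h : i.val + j.val = N) : ofPairs f i = (f j).1 := by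
  have hj : (⟨N - i.val, by omega⟩ : Fin (N + 1)) = j := Fin.ext (by simp only; omega)
  rw [ofPairs, dif_pos (by omega), hj]

theorem ofPairs_right (f : Fin (N + 1) → ℤ × ℤ) {i : Fin (2 * (N + 1) + 1)} {j : Fin (N + 1)}
    (h : i.val = N + 2 + j.val) : ofPairs f i = (f j).2 := by
  have hj : (⟨i.val - (N + 2), by omega⟩ : Fin (N + 1)) = j := Fin.ext (by simp only; omega)
  rw [ofPairs, dif_neg (by omega), dif_pos (by omega), hj]

theorem ofPairs_mid (f : Fin (N + 1) → ℤ × ℤ) : ofPairs f (mid (N + 1)) = 0 := by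
  simp [ofPairs]

theorem ofPairs_injective : Function.Injective (ofPairs (N := N)) := by
  intro f g h
  ext j
  · have := congrFun h ⟨N - j.val, by omega⟩
    rwa [ofPairs_left f (j := j) (by simp only; omega),
      ofPairs_left g (j := j) (by simp only; omega)] at this
  · have := congrFun h ⟨N + 2 + j.val, by omega⟩
    rwa [ofPairs_right f (j := j) rfl, ofPairs_right g (j := j) rfl] at this

theorem exists_ofPairs_eq {a : Fin (2 * (N + 1) + 1) → ℤ} (ha : a (mid (N + 1)) = 0) :
    ∃ f, ofPairs f = a := by
  refine ⟨fun j => (a ⟨N - j.val, by omega⟩, a ⟨N + 2 + j.val, by omega⟩), ?_⟩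
  ext i
  have hi := i.isLt
  rcases lt_trichotomy i.val (N + 1) with h | h | h
  · rw [ofPairs_left _ (j := ⟨N - i.val, by omega⟩) (by simp only; omega)]
    exact congrArg a (Fin.ext (by simp only; omega))
  · have : i = mid (N + 1) := Fin.ext h
    rw [this, ofPairs_mid, ha]
  · rw [ofPairs_right _ (j := ⟨i.val - (N + 2), by omega⟩) (by simp only; omega)]
    exact congrArg a (Fin.ext (by simp only; omega))

/-- The heights of the neighbours of the letter `n + 1`, whose own height is `0`. -/
def startPairs : Finset (ℤ × ℤ) := {(-1, 1), (1, -1), (1, 3), (3, 1)}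

/-- The pairs of heights that may follow a pair. -/
def nextPairs (p : ℤ × ℤ) : Finset (ℤ × ℤ) := {p.1 + 2, p.1 - 2} ×ˢ {p.2 + 2, p.2 - 2}

/-- The balanced pairs of heights that may follow a balanced pair. -/
def nextBalancedPairs (p : ℤ × ℤ) : Finset (ℤ × ℤ) :=
  {(p.1 + 2, p.2 + 2), (p.1 - 2, p.2 - 2), (p.2, p.1)}

theorem mem_startPairs {p : ℤ × ℤ} : p ∈ startPairs ↔
    (p.1 = p.2 + 2 ∨ p.2 = p.1 + 2) ∧ (0 = min p.1 p.2 + 1 ∨ 0 = min p.1 p.2 - 1) := by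
  obtain ⟨x, y⟩ := p
  simp only [startPairs, Finset.mem_insert, Finset.mem_singleton, Prod.mk.injEq]
  omega

theorem mem_nextPairs {p q : ℤ × ℤ} : q ∈ nextPairs p ↔
    (p.1 = q.1 + 2 ∨ q.1 = p.1 + 2) ∧ (p.2 = q.2 + 2 ∨ q.2 = p.2 + 2) := by
  simp only [nextPairs, Finset.mem_product, Finset.mem_insert, Finset.mem_singleton]
  omega

theorem card_nextPairs (p : ℤ × ℤ) : (nextPairs p).card = 4 := by
  rw [nextPairs, Finset.card_product, Finset.card_pair (by omega), Finset.card_pair (by omega)]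

/-- Of the four continuations of a pair `(x, x ± 2)`, only the one that moves the entries apart
loses balance; moving them together exchanges them. -/
theorem mem_nextBalancedPairs {p q : ℤ × ℤ} (hp : p.1 = p.2 + 2 ∨ p.2 = p.1 + 2) :
    q ∈ nextBalancedPairs p ↔ q ∈ nextPairs p ∧ (q.1 = q.2 + 2 ∨ q.2 = q.1 + 2) := by
  rw [mem_nextPairs]
  obtain ⟨x, y⟩ := p
  obtain ⟨z, t⟩ := q
  simp only [nextBalancedPairs, Finset.mem_insert, Finset.mem_singleton, Prod.mk.injEq] at *
  omega

theorem card_nextBalancedPairs {p : ℤ × ℤ} (hp : p.1 = p.2 + 2 ∨ p.2 = p.1 + 2) :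
    (nextBalancedPairs p).card = 3 := by
  obtain ⟨x, y⟩ := p
  simp only at hp
  rw [nextBalancedPairs, Finset.card_eq_three]
  refine ⟨_, _, _, ?_, ?_, ?_, rfl⟩ <;> simp only [ne_eq, Prod.mk.injEq] <;> omega

theorem isTwistedHeight_ofPairs_iff (f : Fin (N + 1) → ℤ × ℤ) :
    IsTwistedHeight (ofPairs f) ↔
      f 0 ∈ startPairs ∧ ∀ i : Fin N, f i.succ ∈ nextPairs (f i.castSucc) := by
  constructor
  · intro h
    constructor
    · have h1 := h.central ⟨N, by omega⟩ ⟨N + 2, by omega⟩ rfl rfl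
      have h2 := h.mid_eq ⟨N, by omega⟩ ⟨N + 2, by omega⟩ rfl rfl
      rw [ofPairs_mid] at h2
      rw [ofPairs_left f (j := 0) rfl, ofPairs_right f (j := 0) rfl] at h1 h2
      exact mem_startPairs.2 ⟨h1, h2⟩
    · intro i
      have hi := i.isLt
      have h1 := h.outer ⟨N - (i.val + 1), by omega⟩ ⟨N - i.val, by omega⟩ (by simp only; omega)
        (by simp only; omega) (by simp only; omega)
      have h2 := h.outer ⟨N + 2 + i.val, by omega⟩ ⟨N + 2 + (i.val + 1), by omega⟩
        (by simp only; omega) (by simp only; omega) (by simp only; omega)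
      rw [ofPairs_left f (j := i.succ) (by simp only [Fin.val_succ]; omega),
        ofPairs_left f (j := i.castSucc) (by simp only [Fin.val_castSucc]; omega)] at h1
      rw [ofPairs_right f (j := i.castSucc) rfl, ofPairs_right f (j := i.succ) rfl] at h2
      exact mem_nextPairs.2 ⟨h1.symm, h2⟩
  · rintro ⟨h0, h1⟩
    rw [mem_startPairs] at h0
    have hcen : ∀ i j : Fin (2 * (N + 1) + 1), i.val + 1 = N + 1 → j.val = N + 1 + 1 →
        ofPairs f i = (f 0).1 ∧ ofPairs f j = (f 0).2 := fun i j hi hj =>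
      ⟨ofPairs_left f (j := 0) (by simp only [Fin.val_zero]; omega),
        ofPairs_right f (j := 0) (by simp only [Fin.val_zero]; omega)⟩
    constructor
    · intro i j hij hi hj
      have hj' := j.isLt
      rcases Nat.lt_or_gt_of_ne hi with hlt | hlt
      · have h2 := (mem_nextPairs.1 (h1 ⟨N - j.val, by omega⟩)).1
        rw [ofPairs_left f (i := i) (j := Fin.succ ⟨N - j.val, by omega⟩)
            (by simp only [Fin.val_succ]; omega),
          ofPairs_left f (i := j) (j := Fin.castSucc ⟨N - j.val, by omega⟩)
            (by simp only [Fin.val_castSucc]; omega)]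
        exact h2.symm
      · have h2 := (mem_nextPairs.1 (h1 ⟨i.val - (N + 2), by omega⟩)).2
        rw [ofPairs_right f (i := i) (j := Fin.castSucc ⟨i.val - (N + 2), by omega⟩)
            (by simp only [Fin.val_castSucc]; omega),
          ofPairs_right f (i := j) (j := Fin.succ ⟨i.val - (N + 2), by omega⟩)
            (by simp only [Fin.val_succ]; omega)]
        exact h2
    · intro i j hi hj
      rw [(hcen i j hi hj).1, (hcen i j hi hj).2]
      exact h0.1
    · intro i j hi hj
      rw [(hcen i j hi hj).1, (hcen i j hi hj).2, ofPairs_mid]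
      exact h0.2

theorem isBalanced_ofPairs_iff (f : Fin (N + 1) → ℤ × ℤ) :
    IsBalanced (ofPairs f) ↔ ∀ j, (f j).1 = (f j).2 + 2 ∨ (f j).2 = (f j).1 + 2 := by
  constructor
  · intro h j
    have h1 := h ⟨N - j.val, by omega⟩ (ne_mid_iff.2 (by simp only; omega))
    rwa [ofPairs_left f (j := j) (by simp only; omega),
      ofPairs_right f (j := j) (by simp only [Fin.val_rev]; omega)] at h1
  · intro h i hi
    rw [ne_mid_iff] at hi
    have hi' := i.isLt
    rcases Nat.lt_or_gt_of_ne hi with hlt | hlt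
    · have h1 := h ⟨N - i.val, by omega⟩
      rw [ofPairs_left f (i := i) (j := ⟨N - i.val, by omega⟩) (by simp only; omega),
        ofPairs_right f (i := i.rev) (j := ⟨N - i.val, by omega⟩)
          (by simp only [Fin.val_rev]; omega)]
      exact h1
    · have h1 := h ⟨i.val - (N + 2), by omega⟩
      rw [ofPairs_right f (i := i) (j := ⟨i.val - (N + 2), by omega⟩) (by simp only; omega),
        ofPairs_left f (i := i.rev) (j := ⟨i.val - (N + 2), by omega⟩)
          (by simp only [Fin.val_rev]; omega)]
      exact h1.symm

/-- Left and right heights continue independently, by ±2 each, from one of the 4 initial pairs. -/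
theorem ncard_isTwistedHeight :
    {a : Fin (2 * (N + 1) + 1) → ℤ | IsTwistedHeight a ∧ a (mid (N + 1)) = 0}.ncard =
      4 * 4 ^ N := by
  obtain ⟨S, hS, -, hc⟩ := exists_finset_paths startPairs nextPairs Set.univ 4
    (fun _ _ => trivial) (fun _ _ _ _ => trivial) (fun p _ => card_nextPairs p) N
  have h : {a : Fin (2 * (N + 1) + 1) → ℤ | IsTwistedHeight a ∧ a (mid (N + 1)) = 0} =
      ofPairs '' (S : Set (Fin (N + 1) → ℤ × ℤ)) := by
    ext a
    simp only [Set.mem_ofPred_eq, Set.mem_image, Finset.mem_coe, hS, ← isTwistedHeight_ofPairs_iff]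
    constructor
    · rintro ⟨ha, h0⟩
      obtain ⟨f, rfl⟩ := exists_ofPairs_eq h0
      exact ⟨f, ha, rfl⟩
    · rintro ⟨f, hf, rfl⟩
      exact ⟨hf, ofPairs_mid f⟩
  rw [h, Set.ncard_image_of_injective _ ofPairs_injective, Set.ncard_coe_finset, hc]
  rfl

theorem ncard_isBalanced :
    {a : Fin (2 * (N + 1) + 1) → ℤ |
      IsTwistedHeight a ∧ a (mid (N + 1)) = 0 ∧ IsBalanced a}.ncard = 4 * 3 ^ N := by
  obtain ⟨S, hS, hT, hc⟩ := exists_finset_paths startPairs nextBalancedPairs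
    {p | p.1 = p.2 + 2 ∨ p.2 = p.1 + 2} 3
    (fun p hp => (mem_startPairs.1 hp).1) (fun p hp q hq => ((mem_nextBalancedPairs hp).1 hq).2)
    (fun p hp => card_nextBalancedPairs hp) N
  have h : {a : Fin (2 * (N + 1) + 1) → ℤ |
      IsTwistedHeight a ∧ a (mid (N + 1)) = 0 ∧ IsBalanced a} =
      ofPairs '' (S : Set (Fin (N + 1) → ℤ × ℤ)) := by
    ext a
    simp only [Set.mem_ofPred_eq, Set.mem_image, Finset.mem_coe]
    constructor
    · rintro ⟨ha, h0, hb⟩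
      obtain ⟨f, rfl⟩ := exists_ofPairs_eq h0
      rw [isTwistedHeight_ofPairs_iff] at ha
      rw [isBalanced_ofPairs_iff] at hb
      exact ⟨f, (hS f).2 ⟨ha.1, fun i =>
        (mem_nextBalancedPairs (hb _)).2 ⟨ha.2 i, hb _⟩⟩, rfl⟩
    · rintro ⟨f, hf, rfl⟩
      have hb := hT f hf
      obtain ⟨h1, h2⟩ := (hS f).1 hf
      exact ⟨(isTwistedHeight_ofPairs_iff f).2
        ⟨h1, fun i => ((mem_nextBalancedPairs (hb _)).1 (h2 i)).1⟩, ofPairs_mid f,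
        (isBalanced_ofPairs_iff f).2 hb⟩
  rw [h, Set.ncard_image_of_injective _ ofPairs_injective, Set.ncard_coe_finset, hc]
  rfl

end Counting

/-! ### The map induced by `P` and the classes of twisted Coxeter elements -/

section Projection

variable {n : ℕ}

theorem cls_wordP_eq {hn : 1 ≤ n} {a : Fin (2 * n + 1) → ℤ} (ha : IsTwistedHeight a)
    {w : List (Fin (2 * n + 1))} (hw : cls w = (twistedSystem n hn).classOf a) :
    cls (wordP w) = (adaptedSystem (2 * n)).classOf fun i => a (shift i) :=
  ((adaptedSystem (2 * n)).cls_eq_classOf_iff ha.isHeight).2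
    (Full.wordP ha (((twistedSystem n hn).cls_eq_classOf_iff ha).1 hw))

theorem exists_of_mem_twistedCluster (hn : 1 ≤ n) {c : CommClass (2 * n + 1)}
    (hc : c ∈ twistedCluster n) :
    ∃ a, IsTwistedHeight a ∧ c = (twistedSystem n hn).classOf a := by
  rwa [twistedCluster_eq hn] at hc

theorem classOf_mem_twistedCluster {hn : 1 ≤ n} {a : Fin (2 * n + 1) → ℤ}
    (ha : IsTwistedHeight a) : (twistedSystem n hn).classOf a ∈ twistedCluster n := by
  rw [twistedCluster_eq hn]
  exact ⟨a, ha, rfl⟩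

theorem classOf_mem_adaptedCluster {a : Fin (2 * n) → ℤ} (ha : IsHeight a) :
    (adaptedSystem (2 * n)).classOf a ∈ adaptedCluster (2 * n) :=
  ⟨_, (DynkinQuiver.ofHeight_hasHeight a ha).isClassOf_iff.2 rfl⟩

/-- The map is characterised by heights instead of words, so that its fibres can be read off from
the offset of the middle letter. -/
theorem exists_projection (hn : 1 ≤ n) :
    ∃ PP : twistedCluster n → adaptedCluster (2 * n),
      ∀ (c : twistedCluster n) (a : Fin (2 * n + 1) → ℤ), IsTwistedHeight a →
        (c : CommClass (2 * n + 1)) = (twistedSystem n hn).classOf a →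
        (PP c : CommClass (2 * n)) = (adaptedSystem (2 * n)).classOf fun i => a (shift i) := by
  have h : ∀ c : twistedCluster n, ∃ d : adaptedCluster (2 * n),
      ∀ a : Fin (2 * n + 1) → ℤ, IsTwistedHeight a →
        (c : CommClass (2 * n + 1)) = (twistedSystem n hn).classOf a →
        (d : CommClass (2 * n)) = (adaptedSystem (2 * n)).classOf fun i => a (shift i) := by
    rintro ⟨c, hc⟩
    obtain ⟨a, ha, rfl⟩ := exists_of_mem_twistedCluster hn hc
    refine ⟨⟨_, classOf_mem_adaptedCluster ha.isHeight⟩, fun b hb hab => ?_⟩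
    obtain ⟨w, hw⟩ := (twistedSystem n hn).exists_full ha
    have hwa := ((twistedSystem n hn).cls_eq_classOf_iff ha).2 hw
    exact (cls_wordP_eq ha hwa).symm.trans (cls_wordP_eq hb (hwa.trans hab))
  exact ⟨fun c => (h c).choose, fun c => (h c).choose_spec⟩

theorem classOf_twistedLift_ne {hn : 1 ≤ n} {a : Fin (2 * n) → ℤ} (ha : IsHeight a) :
    (twistedSystem n hn).classOf (twistedLift hn a (-1)) ≠
      (twistedSystem n hn).classOf (twistedLift hn a 1) := by
  intro h
  have h1 := (isSink_mid_iff (hn := hn) ha (Or.inr rfl)).2 rfl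
  rw [h, isSink_mid_iff (hn := hn) ha (Or.inl rfl)] at h1
  norm_num at h1

/-- The quiver fixes the outer heights up to a constant; only the offset of the middle letter
remains free. -/
theorem isClassOf_projection_iff {hn : 1 ≤ n}
    {PP : twistedCluster n → adaptedCluster (2 * n)}
    (hPP : ∀ (c : twistedCluster n) (a : Fin (2 * n + 1) → ℤ), IsTwistedHeight a →
      (c : CommClass (2 * n + 1)) = (twistedSystem n hn).classOf a →
      (PP c : CommClass (2 * n)) = (adaptedSystem (2 * n)).classOf fun i => a (shift i))
    {Q : DynkinQuiver (2 * n)} {a : Fin (2 * n) → ℤ} (hQ : Q.HasHeight a)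
    (c : twistedCluster n) :
    Q.IsClassOf (PP c) ↔
      (c : CommClass (2 * n + 1)) = (twistedSystem n hn).classOf (twistedLift hn a (-1)) ∨
      (c : CommClass (2 * n + 1)) = (twistedSystem n hn).classOf (twistedLift hn a 1) := by
  constructor
  · intro h
    obtain ⟨b, hb, hcb⟩ := exists_of_mem_twistedCluster hn c.2
    have hQb := DynkinQuiver.ofHeight_hasHeight _ hb.isHeight
    have hQQ := h.unique (hQb.isClassOf_iff.2 (hPP c b hb hcb))
    rw [← hQQ] at hQb
    obtain ⟨K, hK⟩ := hQ.unique hQb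
    obtain ⟨ε, hε, hbε⟩ := IsTwistedHeight.exists_eq_lift (hn := hn) hb
    rw [hK, twistedLift_add] at hbε
    rw [hcb, hbε, (twistedSystem n hn).classOf_add (isTwistedHeight_twistedLift hQ.isHeight hε)]
    rcases hε with rfl | rfl
    · exact Or.inr rfl
    · exact Or.inl rfl
  · intro h
    rw [hQ.isClassOf_iff]
    rcases h with h | h
    · have := hPP c _ (isTwistedHeight_twistedLift hQ.isHeight (Or.inr rfl)) h
      simpa only [twistedLift_shift] using this
    · have := hPP c _ (isTwistedHeight_twistedLift hQ.isHeight (Or.inl rfl)) h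
      simpa only [twistedLift_shift] using this

theorem image_isClassOf_projection {hn : 1 ≤ n}
    {PP : twistedCluster n → adaptedCluster (2 * n)}
    (hPP : ∀ (c : twistedCluster n) (a : Fin (2 * n + 1) → ℤ), IsTwistedHeight a →
      (c : CommClass (2 * n + 1)) = (twistedSystem n hn).classOf a →
      (PP c : CommClass (2 * n)) = (adaptedSystem (2 * n)).classOf fun i => a (shift i))
    {Q : DynkinQuiver (2 * n)} {a : Fin (2 * n) → ℤ} (hQ : Q.HasHeight a) :
    (Subtype.val '' {c : twistedCluster n | Q.IsClassOf (PP c)} : Set (CommClass (2 * n + 1))) =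
      {(twistedSystem n hn).classOf (twistedLift hn a (-1)),
        (twistedSystem n hn).classOf (twistedLift hn a 1)} := by
  ext c
  simp only [Set.mem_image, Set.mem_ofPred_eq, isClassOf_projection_iff hPP hQ,
    Set.mem_insert_iff, Set.mem_singleton_iff]
  constructor
  · rintro ⟨c, hc, rfl⟩
    exact hc
  · intro hc
    refine ⟨⟨c, ?_⟩, hc, rfl⟩
    rcases hc with rfl | rfl
    · exact classOf_mem_twistedCluster (isTwistedHeight_twistedLift hQ.isHeight (Or.inr rfl))
    · exact classOf_mem_twistedCluster (isTwistedHeight_twistedLift hQ.isHeight (Or.inl rfl))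

theorem ncard_fiber_projection {hn : 1 ≤ n}
    {PP : twistedCluster n → adaptedCluster (2 * n)}
    (hPP : ∀ (c : twistedCluster n) (a : Fin (2 * n + 1) → ℤ), IsTwistedHeight a →
      (c : CommClass (2 * n + 1)) = (twistedSystem n hn).classOf a →
      (PP c : CommClass (2 * n)) = (adaptedSystem (2 * n)).classOf fun i => a (shift i))
    (d : adaptedCluster (2 * n)) : {c | PP c = d}.ncard = 2 := by
  obtain ⟨d, Q, hd⟩ := d
  obtain ⟨a, hQ⟩ := Q.exists_hasHeight
  have h : {c | PP c = ⟨d, Q, hd⟩} = {c : twistedCluster n | Q.IsClassOf (PP c)} := by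
    ext c
    simp only [Set.mem_ofPred_eq]
    rw [hQ.isClassOf_iff, Subtype.ext_iff, ← hQ.isClassOf_iff.1 hd]
  rw [h, ← Set.ncard_image_of_injective _ Subtype.val_injective,
    image_isClassOf_projection hPP hQ, Set.ncard_pair (classOf_twistedLift_ne hQ.isHeight)]

theorem xor_isSource_isSink_mid (hn : 1 ≤ n) {c : CommClass (2 * n + 1)}
    (hc : c ∈ twistedCluster n) : Xor (IsSource c (mid n)) (IsSink c (mid n)) := by
  obtain ⟨a, ha, rfl⟩ := exists_of_mem_twistedCluster hn hc
  obtain ⟨ε, hε, haε⟩ := IsTwistedHeight.exists_eq_lift (hn := hn) ha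
  rw [haε, isSource_mid_iff ha.isHeight hε, isSink_mid_iff ha.isHeight hε]
  rcases hε with rfl | rfl
  · exact Or.inl ⟨rfl, by norm_num⟩
  · exact Or.inr ⟨rfl, by norm_num⟩

theorem exists_twistedPower_iff (hn : 1 ≤ n) {a : Fin (2 * n + 1) → ℤ} (ha : IsTwistedHeight a) :
    (∃ u, IsTransversal u ∧ (twistedSystem n hn).classOf a = cls (twistedPower u)) ↔
      IsBalanced a := by
  constructor
  · rintro ⟨u, hu, h⟩
    obtain ⟨b, hb, -, hw⟩ := hu.exists_walk
    have h1 := ((twistedSystem n hn).cls_eq_classOf_iff hb).2 (full_twistedPower hw)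
    obtain ⟨K, rfl⟩ := exists_eq_add_of_classOf_eq hb ha (h.trans h1).symm
    intro i hi
    have := hu.isBalanced hw i hi
    change b i + K = b i.rev + K + 2 ∨ b i.rev + K = b i + K + 2
    omega
  · intro hb
    obtain ⟨u, hu, hw⟩ := hb.exists_transversal hn ha
    exact ⟨u, hu, (((twistedSystem n hn).cls_eq_classOf_iff ha).2 (full_twistedPower hw)).symm⟩

theorem isBalanced_iff_balanced {a : Fin (2 * n + 1) → ℤ} (ha : IsTwistedHeight a) :
    IsBalanced a ↔ (DynkinQuiver.ofHeight _ ha.isHeight).Balanced := by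
  rw [(DynkinQuiver.ofHeight_hasHeight _ ha.isHeight).balanced_iff]
  simp only [shift_rev]
  constructor
  · exact fun h i => h _ (shift_ne_mid i)
  · intro h i hi
    obtain ⟨i, rfl⟩ := exists_shift_eq hi
    exact h i

theorem twistedPower_mem (hn : 1 ≤ n) {u : List (Fin (2 * n + 1))} (hu : IsTransversal u) :
    IsReducedLongest (twistedPower u) ∧ cls (twistedPower u) ∈ twistedCluster n := by
  obtain ⟨a, ha, -, hw⟩ := hu.exists_walk
  have hf := full_twistedPower (hn := hn) hw
  refine ⟨(isLongWord_of_twistedSystem_full ha hf).isReducedLongest, ?_⟩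
  rw [((twistedSystem n hn).cls_eq_classOf_iff ha).2 hf]
  exact classOf_mem_twistedCluster ha

theorem ncard_twistedCluster (hn : 1 ≤ n) : (twistedCluster n).ncard = 2 ^ (2 * n) := by
  -- Height functions are normalised by height 0 at the middle letter, which makes the
  -- parametrisation of classes injective.
  have h : twistedCluster n = (twistedSystem n hn).classOf ''
      {a | IsTwistedHeight a ∧ a (mid n) = 0} := by
    rw [twistedCluster_eq hn]
    ext c
    constructor
    · rintro ⟨a, ha, rfl⟩
      exact ⟨_, ⟨ha.add (-a (mid n)), by simp⟩, (twistedSystem n hn).classOf_add ha _⟩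
    · rintro ⟨a, ⟨ha, -⟩, rfl⟩
      exact ⟨a, ha, rfl⟩
  rw [h, Set.InjOn.ncard_image]
  · obtain ⟨N, rfl⟩ := Nat.exists_eq_add_of_le' hn
    rw [ncard_isTwistedHeight, pow_mul, pow_succ]
    ring
  · rintro a ⟨ha, ha0⟩ b ⟨hb, hb0⟩ hab
    obtain ⟨K, rfl⟩ := exists_eq_add_of_classOf_eq ha hb hab
    simp only [ha0, zero_add] at hb0
    simp [hb0]

theorem ncard_twistedCoxeterElements (hn : 1 ≤ n) :
    (twistedCoxeterElements (2 * n + 1)).ncard = 4 * 3 ^ (n - 1) := by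
  have hex : ∀ a ∈ {a : Fin (2 * n + 1) → ℤ | IsTwistedHeight a ∧ a (mid n) = 0 ∧ IsBalanced a},
      ∃ u, IsTransversal u ∧ Walk twistedStep a u fun j => a j.rev + 2 :=
    fun a ha => ha.2.2.exists_transversal hn ha.1
  -- One transversal word is chosen for each normalised balanced height function; its product does
  -- not depend on the choice.
  choose! U hU hW using hex
  have h := Set.ncard_congr (s := {a : Fin (2 * n + 1) → ℤ |
      IsTwistedHeight a ∧ a (mid n) = 0 ∧ IsBalanced a})
    (t := twistedCoxeterElements (2 * n + 1)) (fun a _ => twistedElement (U a))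
    (fun a ha => ⟨U a, hU a ha, rfl⟩) (fun a b ha hb hab => ?_) ?_
  · rw [← h]
    obtain ⟨N, rfl⟩ := Nat.exists_eq_add_of_le' hn
    exact ncard_isBalanced
  · rw [twistedElement_eq_iff, wordProd_eq_iff_of_isTransversal hn (hU a ha) (hU b hb),
      ((twistedSystem n hn).cls_eq_classOf_iff ha.1).2 (full_twistedPower (hW a ha)),
      ((twistedSystem n hn).cls_eq_classOf_iff hb.1).2 (full_twistedPower (hW b hb))] at hab
    obtain ⟨K, rfl⟩ := exists_eq_add_of_classOf_eq ha.1 hb.1 hab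
    have hb0 := hb.2.1
    simp only [ha.2.1, zero_add] at hb0
    simp [hb0]
  · rintro x ⟨u, hu, rfl⟩
    obtain ⟨a, ha, ha0, hw⟩ := hu.exists_walk
    have hmem : IsTwistedHeight a ∧ a (mid n) = 0 ∧ IsBalanced a := ⟨ha, ha0, hu.isBalanced hw⟩
    refine ⟨a, hmem, twistedElement_eq_iff.2 (wordProd_eq_of_cls_eq ?_)⟩
    exact (hW a hmem).cls_eq (twistedSystem n hn).step_pos hw

end Projection

end TwistedAdapted

/-! ### Assembly of the theorem -/

open TwistedAdapted
theorem mainTheorem2 (n : ℕ) (hn : 1 ≤ n) :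
    -- the classes of the twisted adapted cluster point consist of reduced words of `w₀`
    (∀ w : List (Fin (2 * n + 1)), cls w ∈ twistedCluster n → IsReducedLongest w) ∧
    -- the map induced by `P` on classes
    (∃ PP : twistedCluster n → adaptedCluster (2 * n),
      (∀ (w : List (Fin (2 * n + 1))) (hw : cls w ∈ twistedCluster n),
        (PP ⟨cls w, hw⟩ : CommClass (2 * n)) = cls (wordP w)) ∧
      -- it is onto and two-to-one
      Function.Surjective PP ∧
      (∀ d : adaptedCluster (2 * n), {c | PP c = d}.ncard = 2) ∧
      -- the surgery
      (∀ Q : DynkinQuiver (2 * n),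
        (∃ w, Q.IsAdaptedLongest w) ∧
        (∀ w, Q.IsAdaptedLongest w → ∃ v, IsInsertion w v) ∧
        (∀ w w' v v', Q.IsAdaptedLongest w → Q.IsAdaptedLongest w' →
          IsInsertion w v → IsInsertion w' v' → cls v = cls v') ∧
        (∀ w v, Q.IsAdaptedLongest w → IsInsertion w v →
          IsReducedWord v ∧
          cls (mid n :: v) ≠ cls (v ++ [mid n]) ∧
          (Subtype.val '' {c : twistedCluster n | Q.IsClassOf (PP c)} : Set (CommClass (2 * n + 1)))
            = {cls (mid n :: v), cls (v ++ [mid n])})) ∧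
      -- the classes of twisted Coxeter elements correspond to the balanced quivers
      (∀ c : twistedCluster n,
        (∃ u, IsTransversal u ∧ (c : CommClass (2 * n + 1)) = cls (twistedPower u)) ↔
          ∃ Q : DynkinQuiver (2 * n), Q.Balanced ∧ Q.IsClassOf (PP c))) ∧
    -- `n + 1` is a source or a sink, but not both
    (∀ c ∈ twistedCluster n, Xor (IsSource c (mid n)) (IsSink c (mid n))) ∧
    -- the number of classes
    (twistedCluster n).ncard = 2 ^ (2 * n) ∧
    -- the number of twisted Coxeter elements
    (twistedCoxeterElements (2 * n + 1)).ncard = 4 * 3 ^ (n - 1) ∧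
    -- the class of a twisted Coxeter element
    (∀ u : List (Fin (2 * n + 1)), IsTransversal u →
      IsReducedLongest (twistedPower u) ∧ cls (twistedPower u) ∈ twistedCluster n) ∧
    (∀ u u' : List (Fin (2 * n + 1)), IsTransversal u → IsTransversal u' →
      (twistedElement u = twistedElement u' ↔ cls (twistedPower u) = cls (twistedPower u'))) := by
  refine ⟨fun w hw => ?_, ?_, fun c hc => xor_isSource_isSink_mid hn hc, ncard_twistedCluster hn,
    ncard_twistedCoxeterElements hn, fun u hu => twistedPower_mem hn hu, fun u u' hu hu' =>
    twistedElement_eq_iff.trans (wordProd_eq_iff_of_isTransversal hn hu hu')⟩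
  · obtain ⟨a, ha, hwa⟩ := exists_of_mem_twistedCluster hn hw
    exact (isLongWord_of_twistedSystem_full ha
      (((twistedSystem n hn).cls_eq_classOf_iff ha).1 hwa)).isReducedLongest
  obtain ⟨PP, hPP⟩ := exists_projection hn
  refine ⟨PP, fun w hw => ?_, fun d => ?_, ncard_fiber_projection hPP, fun Q => ?_, fun c => ?_⟩
  · obtain ⟨a, ha, hwa⟩ := exists_of_mem_twistedCluster hn hw
    exact (hPP ⟨cls w, hw⟩ a ha hwa).trans (cls_wordP_eq ha hwa).symm
  · have h := ncard_fiber_projection hPP d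
    obtain ⟨c, hc⟩ := Set.nonempty_of_ncard_ne_zero (h.trans_ne two_ne_zero)
    exact ⟨c, hc⟩
  · obtain ⟨a, hQ⟩ := Q.exists_hasHeight
    have hmid := fun w v (hw : Q.IsAdaptedLongest w) (hv : IsInsertion w v) =>
      full_mid_cons_of_isInsertion (hn := hn) hQ.isHeight (hQ.isAdaptedLongest_iff.1 hw) hv
    refine ⟨?_, fun w _ => exists_isInsertion w, fun w w' v v' hw hw' hv hv' => ?_,
      fun w v hw hv => ?_⟩
    · obtain ⟨w, hw⟩ := (adaptedSystem (2 * n)).exists_full hQ.isHeight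
      exact ⟨w, hQ.isAdaptedLongest_iff.2 hw⟩
    -- Without the leading middle letter, both insertions are walks from offset +1 at `a` to the
    -- same end, whatever the choices.
    · exact Walk.cls_eq (twistedSystem n hn).step_pos (hmid w v hw hv).2 (hmid w' v' hw' hv').2
    · have h1 : IsTwistedHeight (twistedLift hn a (-1)) :=
        isTwistedHeight_twistedLift hQ.isHeight (Or.inr rfl)
      have h2 : IsTwistedHeight (twistedLift hn a 1) :=
        isTwistedHeight_twistedLift hQ.isHeight (Or.inl rfl)
      have hf := full_append_mid_of_isInsertion (hn := hn) hQ.isHeight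
        (hQ.isAdaptedLongest_iff.1 hw) hv
      rw [((twistedSystem n hn).cls_eq_classOf_iff h1).2 (hmid w v hw hv),
        ((twistedSystem n hn).cls_eq_classOf_iff h2).2 hf]
      exact ⟨(isLongWord_of_twistedSystem_full h1 (hmid w v hw hv)).isReducedLongest.1.of_append_left
        (x := [mid n]), classOf_twistedLift_ne hQ.isHeight, image_isClassOf_projection hPP hQ⟩
  · obtain ⟨a, ha, hca⟩ := exists_of_mem_twistedCluster hn c.2
    rw [hca, exists_twistedPower_iff hn ha, isBalanced_iff_balanced ha]
    have hQ := DynkinQuiver.ofHeight_hasHeight _ ha.isHeight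
    have hc := hQ.isClassOf_iff.2 (hPP c a ha hca)
    constructor
    · exact fun h => ⟨_, h, hc⟩
    · rintro ⟨Q, hQb, hQc⟩
      rwa [← hQc.unique hc]
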